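/- Let $\alpha\ge\omega$ be an ordinal, or $\alpha=\mathbf{Ord}$ (in which case $\beta<\alpha$ means that $\beta$ is any ordinal). **Definitions.** For ordinals $\gamma,\beta<\alpha$, a $\gamma$-partition of $\beta$ is a sequence of ordinals $p=(p_i)_{i<\gamma}$ (zeros allowed) with $\sum_{i<\gamma}p_i=\beta$; the categories $\prod_{i<\gamma}\mathscr C^{p_i}$ and $\mathscr C^{\beta}$ are identified by concatenation. If $d$ is a $\gamma$-partition of $\delta$, $p$ is a $\gamma$-partition of $\beta$, and $p_{i,\bullet}$ is a $d_i$-partition of $p_i$ for each $i<\gamma$ (where $\gamma,\delta,\beta<\alpha$), then $p^{\cup}$ denotes the induced $\delta$-partition of $\beta$, obtained by concatenating the sequences $p_{i,\bullet}$. An *$\alpha$-ary unbiased monoidal category* is a category $\mathscr C$ with functors $\mathcal T_\beta\colon\mathscr C^\beta\to\mathscr C$ for all $\beta<\alpha$, a natural isomorphism $\iota\colon \mathrm{id}_{\mathscr C}\to\mathcal T_1$, and, for all $\gamma,\beta<\alpha$ and each $\gamma$-partition $p$ of $\beta$, a natural isomorphism $\eta_p\colon\mathcal T_\gamma\circ\prod_{i<\gamma}\mathcal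 T_{p_i}\to\mathcal T_\beta$, such that for all $d,p,p_{i,\bullet}$ as above $$\eta_p\circ\mathcal T_\gamma\Big(\prod_{i<\gamma}\eta_{p_{i,\bullet}}\Big)=\eta_{p^\cup}\circ\Big(\eta_d\prod_{k<\delta}\mathcal T_{p^\cup_k}\Big),$$ and for all $\beta<\alpha$ $$\eta_{(1)_{i<\beta}}\circ\mathcal T_\beta\Big(\prod_{i<\beta}\iota\Big)=\mathrm{id}_{\mathcal T_\beta}=\eta_{(\beta)}\circ\iota\,\mathcal T_\beta ,$$ where $(1)_{i<\beta}$ is the $\beta$-partition of $\beta$ into ones and $(\beta)$ is the $1$-partition of $\beta$. It is *strict* if all components of $\iota$ and of all $\eta_p$ are identities. An *unbiased monoidal functor* $(\mathscr C,\mathcal T,\iota,\eta)\to(\mathscr C',\mathcal T',\iota',\eta')$ is a functor $F\colon\mathscr C\to\mathscr C'$ with natural isomorphisms $\chi_\beta\colon\mathcal T'_\beta\circ F^\beta\to F\circ\mathcal T_\beta$ for all $\beta<\alpha$ such that, for each $\gamma$-partition $p$ of $\beta$ with $\gamma,\beta<\alpha$, $$F\eta_p\circ\Big(\chi_\gamma\prod_{i<\gamma}\mathcal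 T_{p_i}\Big)\circ\mathcal T'_\gamma\Big(\prod_{i<\gamma}\chi_{p_i}\Big)=\chi_\beta\circ\eta'_pF,\qquad\text{and}\qquad \chi_1\circ\iota'F=F\iota .$$ Such functors compose in the evident way. An isomorphism between two unbiased monoidal functors $(F,\chi)$ and $(G,\psi)$ from $\mathscr C$ to $\mathscr C'$ is a natural isomorphism $\xi\colon F\to G$ with $\xi\mathcal T_\beta\circ\chi_\beta=\psi_\beta\circ\mathcal T'_\beta\xi^\beta$ for all $\beta<\alpha$. An unbiased monoidal functor $F\colon\mathscr C\to\mathscr C'$ is a *weak equivalence* if it is fully faithful and essentially surjective. It is a *strong equivalence* if there is an unbiased monoidal functor $G\colon\mathscr C'\to\mathscr C$ such that $G\circ F\cong\mathrm{id}_{\mathscr C}$ and $F\circ G\cong\mathrm{id}_{\mathscr C'}$ as unbiased monoidal functors. **Theorem (Unbiased Strictification).** For every $\alpha$-ary unbiased monoidal category $\mathscr C$ there are a strict $\alpha$-ary unbiased monoidal category $\mathscr C'$ and an unbiased monoidal functor $F\colon\mathscr C\to\mathscr C'$ that is a weak equivalence and, assuming the axiom of choice, also a strong equivalence. -/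

import Mathlib

open CategoryTheory

universe w v u v₁ u₁ v₂ u₂ v₃ u₃

noncomputable section

namespace Unbiased

/-! ### Arities, ordinal sums and ordinal partitions -/

/-- The ordinals `β < α`. Here `α` is an ordinal, or `α = ⊤`, which plays the role of the class
`Ord` of all ordinals (of the universe `w`). -/
abbrev Arity (α : WithTop Ordinal.{w}) : Type (w + 1) :=
  {β : Ordinal.{w} // (β : WithTop Ordinal.{w}) < α}

/-- The well-ordered set of positions `{i | i < β}` of a `β`-sequence, as a type of order
type `β`. A `β`-sequence in `X` is a function `Pos β → X`, and `Pos β → C` (with Mathlib's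
pointwise category structure) is the power category `C ^ β`. -/
abbrev Pos {α : WithTop Ordinal.{w}} (β : Arity α) : Type w := β.1.ToType

/-- The lexicographic order on the disjoint union of the ordinals of a family. -/
abbrev sumRel {I : Type w} [LinearOrder I] (p : I → Ordinal.{w}) :
    (Σ i, (p i).ToType) → (Σ i, (p i).ToType) → Prop :=
  Sigma.Lex (· < ·) (fun _ => (· < ·))

instance sumRel_isWellOrder {I : Type w} [LinearOrder I] [WellFoundedLT I]
    (p : I → Ordinal.{w}) : IsWellOrder (Σ i, (p i).ToType) (sumRel p) where
  wf := by
    have key : ∀ (i : I) (a : (p i).ToType), Acc (sumRel p) ⟨i, a⟩ := by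
      intro i
      induction i using WellFoundedLT.induction with
      | _ i ih =>
        intro a
        induction a using WellFoundedLT.induction with
        | _ a iha =>
          refine Acc.intro _ ?_
          rintro ⟨j, b⟩ h
          cases h with
          | left _ _ hij => exact ih _ hij b
          | right _ _ hab => exact iha _ hab
    exact ⟨fun x => key x.1 x.2⟩

/-- The ordinal sum `∑_{i} p i` of a well-ordered family of ordinals: the order type of the
disjoint union, ordered lexicographically. -/
def ordSum {I : Type w} [LinearOrder I] [WellFoundedLT I] (p : I → Ordinal.{w}) : Ordinal.{w} :=
  Ordinal.type (sumRel p)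

variable {α : WithTop Ordinal.{w}}

/-- A `γ`-partition of `β`: a `γ`-sequence of ordinals whose sum is `β`. (The entries of a
partition of `β` are at most `β`, so that requiring them to be `< α` is no restriction when
`β < α`; see `le_ordSum`. Entries may be zero.) -/
structure Partition (γ β : Arity α) where
  /-- the entries of the partition -/
  part : Pos γ → Arity α
  sum_eq : ordSum (fun i => (part i).1) = β.1

theorem le_ordSum {I : Type w} [LinearOrder I] [WellFoundedLT I] (p : I → Ordinal.{w}) (i : I) :
    p i ≤ ordSum p := by
  conv_lhs => rw [← Ordinal.type_toType (p i)]
  refine Ordinal.type_le_iff'.2 ⟨RelEmbedding.ofMonotone (fun a => ⟨i, a⟩) ?_⟩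
  intro a b h
  exact Sigma.Lex.right _ _ h

namespace Partition

variable {γ δ β : Arity α}

/-- The canonical order isomorphism between the disjoint union of the blocks of a partition of `β`
and `β`: the `j`-th position of the `i`-th block is sent to the corresponding position of `β`.
(An isomorphism of well-orders is unique.) -/
def pos (p : Partition γ β) :
    sumRel (fun i => (p.part i).1) ≃r ((· < ·) : Pos β → Pos β → Prop) :=
  Classical.choice (Ordinal.type_eq.1 (p.sum_eq.trans (Ordinal.type_toType β.1).symm))

/-- The concatenation of a `γ`-sequence of sequences whose lengths are the entries of a
partition of `β`, as a `β`-sequence. -/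
abbrev concat {X : Type*} (p : Partition γ β) (z : ∀ i, Pos (p.part i) → X) : Pos β → X :=
  fun k => z (p.pos.symm k).1 (p.pos.symm k).2

theorem concat_pos {X : Type*} (p : Partition γ β) (z : ∀ i, Pos (p.part i) → X) (i : Pos γ)
    (j : Pos (p.part i)) : p.concat z (p.pos ⟨i, j⟩) = z i j := by
  have h : p.pos.symm (p.pos ⟨i, j⟩) = ⟨i, j⟩ := RelIso.symm_apply_apply _ _
  unfold concat
  rw [h]

/-- Concatenation of families of morphisms. Together with `concat` this is the identification of
the category `∏_i C ^ (p i)` with `C ^ β`. -/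
abbrev concatMap {C : Type u} [Category.{v} C] (p : Partition γ β) {z z' : ∀ i, Pos (p.part i) → C}
    (f : ∀ i j, z i j ⟶ z' i j) : p.concat z ⟶ p.concat z' :=
  fun k => f (p.pos.symm k).1 (p.pos.symm k).2

/-- The entries of the partition of `β` induced by a double partition: the `k`-th entry is
`p_{i,j}`, where `k` is the `j`-th position of the `i`-th block of `δ`. -/
abbrev inducedPart (d : Partition γ δ) (p : Partition γ β)
    (q : ∀ i, Partition (d.part i) (p.part i)) (k : Pos δ) : Arity α :=
  (q (d.pos.symm k).1).part (d.pos.symm k).2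

/-- The position in `β` of the `m`-th position of the `k`-th block of the induced partition. -/
def inducedFun (d : Partition γ δ) (p : Partition γ β)
    (q : ∀ i, Partition (d.part i) (p.part i)) :
    (Σ k, Pos (inducedPart d p q k)) → Pos β :=
  fun x => p.pos ⟨(d.pos.symm x.1).1, (q (d.pos.symm x.1).1).pos ⟨(d.pos.symm x.1).2, x.2⟩⟩

theorem inducedFun_lt (d : Partition γ δ) (p : Partition γ β)
    (q : ∀ i, Partition (d.part i) (p.part i)) (x y : Σ k, Pos (inducedPart d p q k))
    (h : sumRel (fun k => (inducedPart d p q k).1) x y) :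
    inducedFun d p q x < inducedFun d p q y := by
  refine p.pos.map_rel_iff.2 ?_
  cases h with
  | right a b hab => exact Sigma.Lex.right _ _ ((q _).pos.map_rel_iff.2 (Sigma.Lex.right _ _ hab))
  | @left k l a b hkl =>
    have h1 : sumRel (fun i => (d.part i).1) (d.pos.symm k) (d.pos.symm l) :=
      d.pos.symm.map_rel_iff.2 hkl
    have aux : ∀ (s t : Σ i, Pos (d.part i)), sumRel (fun i => (d.part i).1) s t →
        ∀ (a : Pos ((q s.1).part s.2)) (b : Pos ((q t.1).part t.2)),
        sumRel (fun i => (p.part i).1) ⟨s.1, (q s.1).pos ⟨s.2, a⟩⟩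
          ⟨t.1, (q t.1).pos ⟨t.2, b⟩⟩ := by
      intro s t hst a b
      cases hst with
      | left _ _ hij => exact Sigma.Lex.left _ _ hij
      | right _ _ hjk =>
        exact Sigma.Lex.right _ _ ((q _).pos.map_rel_iff.2 (Sigma.Lex.left _ _ hjk))
    exact aux _ _ h1 a b

theorem inducedFun_surjective (d : Partition γ δ) (p : Partition γ β)
    (q : ∀ i, Partition (d.part i) (p.part i)) : Function.Surjective (inducedFun d p q) := by
  intro m
  obtain ⟨⟨i, n⟩, rfl⟩ := p.pos.surjective m
  obtain ⟨⟨j, l⟩, rfl⟩ := (q i).pos.surjective n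
  have aux : ∀ (s : Σ i, Pos (d.part i)) (l : Pos ((q s.1).part s.2)),
      ∃ x, inducedFun d p q x = p.pos ⟨s.1, (q s.1).pos ⟨s.2, l⟩⟩ := by
    intro s l
    obtain ⟨k, rfl⟩ := d.pos.symm.surjective s
    exact ⟨⟨k, l⟩, rfl⟩
  exact aux ⟨i, j⟩ l

/-- `inducedFun` as an isomorphism of well-orders. -/
def inducedIso (d : Partition γ δ) (p : Partition γ β)
    (q : ∀ i, Partition (d.part i) (p.part i)) :
    sumRel (fun k => (inducedPart d p q k).1) ≃r ((· < ·) : Pos β → Pos β → Prop) :=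
  RelIso.ofSurjective (RelEmbedding.ofMonotone (inducedFun d p q) (inducedFun_lt d p q))
    (inducedFun_surjective d p q)

/-- The `δ`-partition of `β` induced by a double partition: `d` is a `γ`-partition of `δ`, `p` is a
`γ`-partition of `β`, and `q i` is a `d_i`-partition of `p_i` for each `i < γ`. -/
abbrev induced (d : Partition γ δ) (p : Partition γ β)
    (q : ∀ i, Partition (d.part i) (p.part i)) : Partition δ β where
  part := inducedPart d p q
  sum_eq := (Ordinal.type_eq.2 ⟨inducedIso d p q⟩).trans (Ordinal.type_toType β.1)

theorem induced_pos (d : Partition γ δ) (p : Partition γ β)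
    (q : ∀ i, Partition (d.part i) (p.part i)) (x : Σ k, Pos (inducedPart d p q k)) :
    (induced d p q).pos x = inducedFun d p q x := by
  have h : (induced d p q).pos.toInitialSeg = (inducedIso d p q).toInitialSeg :=
    Subsingleton.elim _ _
  exact congrArg (fun f => f x) h

/-- A doubly nested family of sequences, indexed by a double partition, as a family indexed by
the blocks of the induced partition. -/
abbrev regroup {X : Type*} (d : Partition γ δ) (p : Partition γ β)
    (q : ∀ i, Partition (d.part i) (p.part i)) (z : ∀ i j, Pos ((q i).part j) → X) :
    ∀ k, Pos ((induced d p q).part k) → X :=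
  fun k => z (d.pos.symm k).1 (d.pos.symm k).2

/-- Concatenating in two steps is the same as concatenating along the induced partition. -/
theorem concat_concat {X : Type*} (d : Partition γ δ) (p : Partition γ β)
    (q : ∀ i, Partition (d.part i) (p.part i)) (z : ∀ i j, Pos ((q i).part j) → X) :
    p.concat (fun i => (q i).concat (z i)) = (induced d p q).concat (regroup d p q z) := by
  funext m
  obtain ⟨⟨k, l⟩, rfl⟩ := (induced d p q).pos.surjective m
  refine Eq.trans ?_ (concat_pos (induced d p q) (regroup d p q z) k l).symm
  refine (congrArg _ (induced_pos d p q ⟨k, l⟩)).trans ?_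
  exact (concat_pos p _ _ _).trans (concat_pos (q _) _ _ _)

end Partition

/-! ### The one-block partition and the partition into singletons -/

/-- The arity `1`, which is available as `α ≥ ω`. -/
def one (hα : (Ordinal.omega0.{w} : WithTop Ordinal.{w}) ≤ α) : Arity α :=
  ⟨1, lt_of_lt_of_le (WithTop.coe_lt_coe.2 Ordinal.one_lt_omega0) hα⟩

variable (hα : (Ordinal.omega0.{w} : WithTop Ordinal.{w}) ≤ α)

instance uniquePosOne : Unique (Pos (one hα)) := inferInstanceAs (Unique (Ordinal.ToType 1))

/-- The first projection, for the partition of `β` into singletons. -/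
def singletonsIso (β : Arity α) :
    sumRel (fun _ : Pos β => (one hα).1) ≃r ((· < ·) : Pos β → Pos β → Prop) where
  toFun x := x.1
  invFun k := ⟨k, (default : Pos (one hα))⟩
  left_inv x := by
    obtain ⟨k, l⟩ := x
    exact congrArg (Sigma.mk k) (Subsingleton.elim (α := Pos (one hα)) _ _)
  right_inv _ := rfl
  map_rel_iff' := by
    rintro ⟨k, a⟩ ⟨l, b⟩
    constructor
    · intro h
      exact Sigma.Lex.left _ _ h
    · intro h
      cases h with
      | left _ _ h => exact h
      | right _ _ h =>
        exact absurd (Subsingleton.elim (α := Pos (one hα)) a b ▸ h) (lt_irrefl _)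

/-- The constant `β`-partition `1` of `β`. -/
abbrev singletons (β : Arity α) : Partition β β where
  part := fun _ => one hα
  sum_eq := (Ordinal.type_eq.2 ⟨singletonsIso hα β⟩).trans (Ordinal.type_toType β.1)

/-- The second projection, for the partition of `β` into one block. -/
def wholeIso (β : Arity α) :
    sumRel (fun _ : Pos (one hα) => β.1) ≃r ((· < ·) : Pos β → Pos β → Prop) where
  toFun x := x.2
  invFun k := ⟨(default : Pos (one hα)), k⟩
  left_inv x := by
    obtain ⟨k, l⟩ := x
    exact congrArg (fun k => Sigma.mk k l) (Subsingleton.elim (α := Pos (one hα)) _ _)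
  right_inv _ := rfl
  map_rel_iff' := by
    rintro ⟨k, a⟩ ⟨l, b⟩
    obtain rfl : k = l := Subsingleton.elim (α := Pos (one hα)) _ _
    constructor
    · intro h
      exact Sigma.Lex.right _ _ h
    · intro h
      cases h with
      | left _ _ h => exact absurd h (lt_irrefl _)
      | right _ _ h => exact h

/-- The constant `1`-partition `β` of `β`. -/
abbrev whole (β : Arity α) : Partition (one hα) β where
  part := fun _ => β
  sum_eq := (Ordinal.type_eq.2 ⟨wholeIso hα β⟩).trans (Ordinal.type_toType β.1)

theorem concat_singletons {X : Type*} (β : Arity α) (x : Pos β → X) :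
    (singletons hα β).concat (fun i _ => x i) = x := by
  funext k
  have h : (singletons hα β).pos.toInitialSeg = (singletonsIso hα β).toInitialSeg :=
    Subsingleton.elim _ _
  obtain ⟨y, rfl⟩ := (singletons hα β).pos.surjective k
  have hy : (singletons hα β).pos y = y.1 := congrArg (fun f => f y) h
  exact (Partition.concat_pos (singletons hα β) _ y.1 y.2).trans (congrArg x hy.symm)

theorem concat_whole {X : Type*} (β : Arity α) (x : Pos β → X) :
    (whole hα β).concat (fun _ => x) = x := by
  funext k
  have h : (whole hα β).pos.toInitialSeg = (wholeIso hα β).toInitialSeg :=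
    Subsingleton.elim _ _
  obtain ⟨y, rfl⟩ := (whole hα β).pos.surjective k
  have hy : (whole hα β).pos y = y.2 := congrArg (fun f => f y) h
  exact (Partition.concat_pos (whole hα β) _ y.1 y.2).trans (congrArg x hy.symm)

/-! ### Unbiased monoidal categories -/

/-- An `α`-ary unbiased monoidal structure `(T, ι, η)` on a category `C`, where `α ≥ ω` is an
ordinal or `α = ⊤` stands for `Ord`. For a `γ`-partition `p` of `β`, the categories
`∏_{i < γ} C ^ (p i)` and `C ^ β` are identified by concatenation, and `C` is identified
with `C ^ 1` by constant families. Natural isomorphisms are given by their components. -/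
structure UnbiasedMonoidal (C : Type u) [Category.{v} C] where
  /-- the `β`-fold tensor product, for each `β < α` -/
  T : ∀ β : Arity α, (Pos β → C) ⥤ C
  /-- the natural isomorphism `id ≅ T 1` -/
  ι : ∀ X : C, X ≅ (T (one hα)).obj (fun _ => X)
  ι_naturality : ∀ {X Y : C} (f : X ⟶ Y),
    f ≫ (ι Y).hom = (ι X).hom ≫ (T (one hα)).map (fun _ => f)
  /-- the natural isomorphism `T γ ∘ ∏ T (p i) ≅ T β` for each `γ`-partition `p` of `β` -/
  η : ∀ {γ β : Arity α} (p : Partition γ β) (z : ∀ i, Pos (p.part i) → C),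
    (T γ).obj (fun i => (T (p.part i)).obj (z i)) ≅ (T β).obj (p.concat z)
  η_naturality : ∀ {γ β : Arity α} (p : Partition γ β) {z z' : ∀ i, Pos (p.part i) → C}
    (f : ∀ i j, z i j ⟶ z' i j),
    (T γ).map (fun i => (T (p.part i)).map (f i)) ≫ (η p z').hom =
      (η p z).hom ≫ (T β).map (p.concatMap f)
  /-- the coherence square for a double partition; both ways end at `T β` of the total
  concatenation, formed in two steps or in one, which are equal by `concat_concat` -/
  coherence : ∀ {γ δ β : Arity α} (d : Partition γ δ) (p : Partition γ β)
    (q : ∀ i, Partition (d.part i) (p.part i)) (z : ∀ i j, Pos ((q i).part j) → C),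
    (T γ).map (fun i => (η (q i) (z i)).hom) ≫
        (η p (fun i => (q i).concat (z i))).hom ≫
          (T β).map (eqToHom (Partition.concat_concat d p q z)) =
      (η d (fun i j => (T ((q i).part j)).obj (z i j))).hom ≫
        (η (Partition.induced d p q) (Partition.regroup d p q z)).hom
  /-- `η(1) ∘ T β (ι, ι, …) = id` -/
  unit_inner : ∀ (β : Arity α) (x : Pos β → C),
    (T β).map (fun i => (ι (x i)).hom) ≫
        (η (singletons hα β) (fun i _ => x i)).hom ≫
          (T β).map (eqToHom (concat_singletons hα β x)) = 𝟙 ((T β).obj x)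
  /-- `η(β) ∘ ι (T β) = id` -/
  unit_outer : ∀ (β : Arity α) (x : Pos β → C),
    (ι ((T β).obj x)).hom ≫ (η (whole hα β) (fun _ => x)).hom ≫
        (T β).map (eqToHom (concat_whole hα β x)) = 𝟙 ((T β).obj x)

variable {hα}

/-- An unbiased monoidal structure is strict if all components of `ι` and of all the `η p` are
identities (in particular their sources and targets are equal). -/
def UnbiasedMonoidal.IsStrict {C : Type u} [Category.{v} C] (M : UnbiasedMonoidal hα C) : Prop :=
  (∀ X : C, ∃ h : X = (M.T (one hα)).obj (fun _ => X), (M.ι X).hom = eqToHom h) ∧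
    ∀ {γ β : Arity α} (p : Partition γ β) (z : ∀ i, Pos (p.part i) → C),
      ∃ h : (M.T γ).obj (fun i => (M.T (p.part i)).obj (z i)) = (M.T β).obj (p.concat z),
        (M.η p z).hom = eqToHom h

/-! ### Unbiased monoidal functors -/

/-- An unbiased monoidal functor `(F, χ)`. -/
structure UnbiasedFunctor {C : Type u₁} [Category.{v₁} C] {D : Type u₂} [Category.{v₂} D]
    (M : UnbiasedMonoidal hα C) (N : UnbiasedMonoidal hα D) where
  /-- the underlying functor -/
  F : C ⥤ D
  /-- the natural isomorphisms `T' β ∘ F ^ β ≅ F ∘ T β` -/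
  χ : ∀ (β : Arity α) (x : Pos β → C),
    (N.T β).obj (fun i => F.obj (x i)) ≅ F.obj ((M.T β).obj x)
  χ_naturality : ∀ (β : Arity α) {x y : Pos β → C} (f : ∀ i, x i ⟶ y i),
    (N.T β).map (fun i => F.map (f i)) ≫ (χ β y).hom = (χ β x).hom ≫ F.map ((M.T β).map f)
  pentagon : ∀ {γ β : Arity α} (p : Partition γ β) (z : ∀ i, Pos (p.part i) → C),
    (N.T γ).map (fun i => (χ (p.part i) (z i)).hom) ≫
        (χ γ (fun i => (M.T (p.part i)).obj (z i))).hom ≫ F.map (M.η p z).hom =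
      (N.η p (fun i j => F.obj (z i j))).hom ≫ (χ β (p.concat z)).hom
  triangle : ∀ X : C,
    (N.ι (F.obj X)).hom ≫ (χ (one hα) (fun _ => X)).hom = F.map (M.ι X).hom

namespace UnbiasedFunctor

variable {C : Type u₁} [Category.{v₁} C] {D : Type u₂} [Category.{v₂} D]
  {E : Type u₃} [Category.{v₃} E]
  {M : UnbiasedMonoidal hα C} {N : UnbiasedMonoidal hα D} {P : UnbiasedMonoidal hα E}

/-- The identity unbiased monoidal functor. -/
def id (M : UnbiasedMonoidal hα C) : UnbiasedFunctor M M where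
  F := 𝟭 C
  χ β x := Iso.refl ((M.T β).obj x)
  χ_naturality β x y f := (Category.comp_id _).trans (Category.id_comp _).symm
  pentagon {γ β} p z := by
    have h : (M.T γ).map (fun i => 𝟙 ((M.T (p.part i)).obj (z i))) = 𝟙 _ := (M.T γ).map_id _
    change (M.T γ).map (fun i => 𝟙 ((M.T (p.part i)).obj (z i))) ≫ 𝟙 _ ≫ (M.η p z).hom =
      (M.η p z).hom ≫ 𝟙 _
    rw [h]
    exact (Category.id_comp _).trans ((Category.id_comp _).trans (Category.comp_id _).symm)
  triangle X := Category.comp_id _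

/-- The composite `G ∘ F` of unbiased monoidal functors, with structure isomorphisms
`T'' ∘ (G F) ^ β ≅ G ∘ T' ∘ F ^ β ≅ G ∘ F ∘ T`. -/
def comp (F : UnbiasedFunctor M N) (G : UnbiasedFunctor N P) : UnbiasedFunctor M P where
  F := F.F ⋙ G.F
  χ β x := G.χ β (fun i => F.F.obj (x i)) ≪≫ G.F.mapIso (F.χ β x)
  χ_naturality β x y f := by
    have h1 := G.χ_naturality β (fun i => F.F.map (f i))
    have h2 := congrArg G.F.map (F.χ_naturality β f)
    rw [G.F.map_comp, G.F.map_comp] at h2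
    simp only [Functor.comp_map, Iso.trans_hom, Functor.mapIso_hom, Category.assoc]
    rw [← h2, ← Category.assoc, ← Category.assoc]
    exact congrArg (· ≫ _) h1
  pentagon {γ β} p z := by
    have h1 := G.χ_naturality γ (fun i => (F.χ (p.part i) (z i)).hom)
    have h2 := congrArg G.F.map (F.pentagon p z)
    have h3 := G.pentagon p (fun i j => F.F.obj (z i j))
    rw [G.F.map_comp, G.F.map_comp, G.F.map_comp] at h2
    have h4 : (P.T γ).map (fun i => (G.χ (p.part i) (fun j => F.F.obj (z i j))).hom ≫
          G.F.map (F.χ (p.part i) (z i)).hom) =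
        (P.T γ).map (fun i => (G.χ (p.part i) (fun j => F.F.obj (z i j))).hom) ≫
          (P.T γ).map (fun i => G.F.map (F.χ (p.part i) (z i)).hom) :=
      (P.T γ).map_comp _ _
    simp only [Functor.comp_map, Iso.trans_hom, Functor.mapIso_hom, Category.assoc]
    refine (congrArg (· ≫ _) h4).trans ?_
    rw [Category.assoc]
    refine (congrArg (_ ≫ ·) ((Category.assoc _ _ _).symm.trans
      ((congrArg (· ≫ _) h1).trans ((Category.assoc _ _ _).trans (congrArg (_ ≫ ·) h2))))).trans ?_
    rw [← Category.assoc, ← Category.assoc, Category.assoc _ _ (G.F.map (N.η p _).hom), h3]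
    exact Category.assoc _ _ _
  triangle X := by
    have h1 := G.triangle (F.F.obj X)
    have h2 := congrArg G.F.map (F.triangle X)
    rw [G.F.map_comp] at h2
    refine Eq.trans (Category.assoc _ _ _).symm ?_
    exact (congrArg (· ≫ _) h1).trans h2

/-- A weak equivalence: fully faithful and essentially surjective. -/
def IsWeakEquivalence (F : UnbiasedFunctor M N) : Prop :=
  F.F.Full ∧ F.F.Faithful ∧ F.F.EssSurj

/-- An isomorphism between unbiased monoidal functors: a natural isomorphism of the underlying
functors that is compatible with the structure isomorphisms `χ`. -/
structure MonoidalIso (F G : UnbiasedFunctor M N) where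
  /-- the natural isomorphism -/
  iso : F.F ≅ G.F
  compat : ∀ (β : Arity α) (x : Pos β → C),
    (F.χ β x).hom ≫ iso.hom.app ((M.T β).obj x) =
      (N.T β).map (fun i => iso.hom.app (x i)) ≫ (G.χ β x).hom

/-- A strong equivalence: there is an unbiased monoidal functor `G` in the other direction with
`G ∘ F ≅ id` and `F ∘ G ≅ id` as unbiased monoidal functors. -/
def IsStrongEquivalence (F : UnbiasedFunctor M N) : Prop :=
  ∃ G : UnbiasedFunctor N M,
    Nonempty (MonoidalIso (F.comp G) (id M)) ∧ Nonempty (MonoidalIso (G.comp F) (id N))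

end UnbiasedFunctor

end Unbiased

end

/-! The objects of the strict category are isomorphism classes of words, that is, of families of
objects of `C` indexed by well-orders; the tensor product is concatenation. Well-orders are rigid,
so concatenation of classes is strictly associative and unital. What has to be supplied is a value
in `C` for every word, with isomorphisms from `T γ` of the values of the blocks to the value of
their concatenation, coherent with `η` and `ι` (`StrictCover`). Morphisms are then copied from `C`
along the value map, and the structure isomorphisms become identities.

The difficulty is that `α` need not be closed under sums: a concatenation of words shorter than `α`
may be longer than `α`, and then no single `T β` evaluates it. So words live on any well-order
generated from singletons by sums of length `< α` (`Good`), and their values must not depend on how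
it was generated. A valuation (`Val`) assigns an object to every subset, with coherent comparison
isomorphisms for partitions. On a good set a morphism of valuations is determined by its components
at singletons (`Good.hom_ext`), these can be prescribed arbitrarily (`Good.exists_hom`), and
valuations with prescribed letters exist (`Good.exists_val`). Both existence results glue along one
partition; compatibility with another partition is checked on the common refinement, indexed by the
pairs of blocks that meet.

This refinement can be too long: for `α = ω + 2`, two partitions of length `ω + 1` may have a common
refinement of length at least `ω + ω`. Gluing therefore uses only partitions whose order type is
bounded by an initial ordinal below `α`. A cardinality count shows that these are closed under
common refinement (`isIndexClass`). Every well-order of type `< α` is generated by sums of such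
lengths (`good_of_isSmall`), so valuations and their morphisms extend to all partitions of length `<
α` (`Val.extend`, `HomOn.extend`).

Throughout, index sets are subsets of an ambient well-order and families are defined on the whole of
it. Passing to a part then changes only the subset, and the coherence laws hold without transport
along equalities of objects. -/

noncomputable section

namespace Unbiased

set_option linter.unusedSectionVars false

variable {α : WithTop Ordinal.{w}}

/-! ### Tensor products of families indexed by subsets of small well-orders -/

/-- The order type of a subset of a well-order. -/
abbrev otype {Ω : Type w} [LinearOrder Ω] [WellFoundedLT Ω] (J : Set Ω) : Ordinal.{w} :=
  Ordinal.type ((· < ·) : J → J → Prop)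

/-- A well-order is small if its order type is `< α`. -/
class IsSmall (α : WithTop Ordinal.{w}) (Ω : Type w) [LinearOrder Ω] [WellFoundedLT Ω] :
    Prop where
  lt : ((Ordinal.type ((· < ·) : Ω → Ω → Prop) : Ordinal.{w}) : WithTop Ordinal.{w}) < α

section Order

variable {Ω : Type w} [LinearOrder Ω] [WellFoundedLT Ω]

theorem otype_mono {J J' : Set Ω} (h : J ⊆ J') : otype J ≤ otype J' :=
  Ordinal.type_le_iff'.2 ⟨RelEmbedding.ofMonotone (fun a => ⟨a.1, h a.2⟩) fun _ _ h => h⟩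

theorem otype_le_type (J : Set Ω) :
    otype J ≤ Ordinal.type ((· < ·) : Ω → Ω → Prop) :=
  Ordinal.type_le_iff'.2 ⟨RelEmbedding.ofMonotone (fun a => a.1) fun _ _ h => h⟩

instance isSmall_pos (β : Arity α) : IsSmall α (Pos β) :=
  ⟨by rw [Ordinal.type_toType]; exact β.2⟩

/-- The order type of a subset of a small well-order, as an arity. -/
def ar [IsSmall α Ω] (J : Set Ω) : Arity α :=
  ⟨otype J, lt_of_le_of_lt (WithTop.coe_le_coe.2 (otype_le_type J)) (IsSmall.lt (Ω := Ω))⟩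

/-- The increasing enumeration of a subset of a small well-order. -/
def en [IsSmall α Ω] (J : Set Ω) : Pos (ar (α := α) J) ≃o J :=
  OrderIso.ofRelIsoLT (Classical.choice (Ordinal.type_eq.1 (Ordinal.type_toType (otype J))))

end Order

/-- `J` is the union of the sets `L k`, for `k ∈ K`, which are arranged in increasing order. -/
structure IsPart {Γ Ω : Type w} [LinearOrder Γ] [LinearOrder Ω] (K : Set Γ) (L : Γ → Set Ω)
    (J : Set Ω) : Prop where
  mem : ∀ a, a ∈ J ↔ ∃ k ∈ K, a ∈ L k
  lt : ∀ k ∈ K, ∀ l ∈ K, k < l → ∀ a ∈ L k, ∀ b ∈ L l, a < b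

theorem IsPart.subset {Γ Ω : Type w} [LinearOrder Γ] [LinearOrder Ω] {K : Set Γ} {L : Γ → Set Ω}
    {J : Set Ω} (h : IsPart K L J) {k : Γ} (hk : k ∈ K) : L k ⊆ J :=
  fun _ ha => (h.mem _).2 ⟨k, hk, ha⟩

theorem IsPart.mem_of_mem {Γ Ω : Type w} [LinearOrder Γ] [LinearOrder Ω] {K : Set Γ}
    {L : Γ → Set Ω} {J : Set Ω} (h : IsPart K L J) {k : Γ} (hk : k ∈ K) {a : Ω} (ha : a ∈ L k) :
    a ∈ J :=
  h.subset hk ha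

theorem isPart_singleton {Γ Ω : Type w} [LinearOrder Γ] [LinearOrder Ω] (k : Γ)
    (L : Γ → Set Ω) : IsPart {k} L (L k) where
  mem a := by simp
  lt := by
    rintro _ rfl _ rfl h
    exact absurd h (lt_irrefl _)

/-! ### Partitions of subsets as partitions of arities -/

section Order

variable {Γ Ω : Type w} [LinearOrder Γ] [WellFoundedLT Γ] [LinearOrder Ω] [WellFoundedLT Ω]
  [IsSmall α Γ] [IsSmall α Ω]

namespace IsPart

variable {K : Set Γ} {L : Γ → Set Ω} {J : Set Ω}

/-- The order isomorphism between the disjoint union of the blocks and the whole. -/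
def iso (h : IsPart K L J) :
    sumRel (fun k => (ar (α := α) (L (en (α := α) K k))).1) ≃r
      ((· < ·) : Pos (ar (α := α) J) → Pos (ar (α := α) J) → Prop) :=
  RelIso.ofSurjective
    (RelEmbedding.ofMonotone
      (fun x => (en J).symm ⟨en (α := α) (L (en (α := α) K x.1)) x.2,
        h.subset (en K x.1).2 (en (α := α) (L (en (α := α) K x.1)) x.2).2⟩)
      (by
        intro x y hxy
        rw [(en J).symm.lt_iff_lt]
        cases hxy with
        | @left i j a b hij =>
          exact h.lt _ (en K i).2 _ (en K j).2 ((en K).lt_iff_lt.2 hij) _ (Subtype.coe_prop _) _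
            (Subtype.coe_prop _)
        | @right i a b hab =>
          exact (en (L (en (α := α) K i))).lt_iff_lt.2 hab))
    (by
      intro m
      obtain ⟨k, hk, ha⟩ := (h.mem _).1 (en J m).2
      -- The block is indexed by `en K ((en K).symm ⟨k, hk⟩)`, which equals `k` only
      -- propositionally; quantifying over `k'` lets that equation be substituted.
      have key : ∀ (k' : Γ) (_ : k' = k) (_ : k' ∈ K), ∃ j : Pos (ar (α := α) (L k')),
          ((en (L k') j : L k') : Ω) = en J m := by
        rintro k' rfl _
        exact ⟨(en _).symm ⟨_, ha⟩, by rw [OrderIso.apply_symm_apply]⟩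
      obtain ⟨j, hj⟩ := key (en (α := α) K ((en K).symm ⟨k, hk⟩))
        (by rw [OrderIso.apply_symm_apply]) (Subtype.coe_prop _)
      refine ⟨⟨(en K).symm ⟨k, hk⟩, j⟩, ?_⟩
      change (en J).symm ⟨_, _⟩ = m
      rw [OrderIso.symm_apply_eq]
      exact Subtype.ext hj)

/-- The partition of arities underlying a partition of a set. -/
@[reducible] def toPartition (h : IsPart K L J) : Partition (ar (α := α) K) (ar (α := α) J) where
  part := fun k => ar (L (en (α := α) K k))
  sum_eq := (Ordinal.type_eq.2 ⟨h.iso⟩).trans (Ordinal.type_toType _)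

/-- Isomorphisms of well-orders are unique, so the abstractly chosen `Partition.pos` agrees with the
explicit `iso`. -/
theorem en_pos (h : IsPart K L J) (k : Pos (ar (α := α) K))
    (j : Pos (ar (α := α) (L (en (α := α) K k)))) :
    ((en J ((h.toPartition (α := α)).pos ⟨k, j⟩) : J) : Ω) = en (L (en (α := α) K k)) j := by
  have h1 : (h.toPartition (α := α)).pos.toInitialSeg = (h.iso (α := α)).toInitialSeg :=
    Subsingleton.elim _ _
  have h2 : (h.toPartition (α := α)).pos ⟨k, j⟩ = h.iso (α := α) ⟨k, j⟩ :=
    congrArg (fun f => f ⟨k, j⟩) h1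
  rw [h2]
  change ((en J ((en J).symm ⟨_, _⟩) : J) : Ω) = _
  rw [OrderIso.apply_symm_apply]

theorem concat_eq {X : Type*} (h : IsPart K L J) (x : Ω → X) :
    (h.toPartition (α := α)).concat (fun k j => x (en (α := α) (L (en (α := α) K k)) j)) =
      fun k => x (en (α := α) J k) := by
  funext m
  obtain ⟨⟨k, j⟩, rfl⟩ := (h.toPartition (α := α)).pos.surjective m
  rw [h.en_pos]
  exact Partition.concat_pos (h.toPartition (α := α)) _ k j

end IsPart

end Order

theorem comp_eq_comp_assoc {C : Type u} [Category.{v} C] {V W X Y Z : C} {f : X ⟶ Y} {g : Y ⟶ Z}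
    {f' : X ⟶ W} {g' : W ⟶ Z} (e : f ≫ g = f' ≫ g') (h : Z ⟶ V) : f ≫ g ≫ h = f' ≫ g' ≫ h := by
  rw [← Category.assoc, e, Category.assoc]

theorem eqToHom_family_comm {C : Type u} [Category.{v} C] {Ω : Type w} {J : Set Ω} {x y : Ω → C}
    (f : ∀ a ∈ J, x a ⟶ y a) {a b : Ω}
    (hab : a = b) (ha : a ∈ J) (hb : b ∈ J) (h1 : y a = y b) (h2 : x a = x b) :
    f a ha ≫ eqToHom h1 = eqToHom h2 ≫ f b hb := by
  subst hab
  simp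

/-! ### Tensor products over subsets of an ambient order -/

section Tens

variable {hα : (Ordinal.omega0.{w} : WithTop Ordinal.{w}) ≤ α}
  {C : Type u} [Category.{v} C] (M : UnbiasedMonoidal hα C)
  {Γ Δ Ω : Type w} [LinearOrder Γ] [WellFoundedLT Γ] [LinearOrder Δ] [WellFoundedLT Δ]
  [LinearOrder Ω] [WellFoundedLT Ω] [IsSmall α Γ] [IsSmall α Δ] [IsSmall α Ω]

/-- The tensor product of the restriction of a family to a subset of its index set. -/
def tens (J : Set Ω) (x : Ω → C) : C := (M.T (ar J)).obj fun k => x (en (α := α) J k)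

variable {M}

/-- The tensor product of morphisms. -/
def tensMap {J : Set Ω} {x y : Ω → C} (f : ∀ a ∈ J, x a ⟶ y a) : tens M J x ⟶ tens M J y :=
  (M.T (ar J)).map fun k => f (en (α := α) J k) (en (α := α) J k).2

theorem tensMap_id (J : Set Ω) (x : Ω → C) : tensMap (M := M) (J := J) (fun a _ => 𝟙 (x a)) = 𝟙 _ :=
  (M.T (ar J)).map_id _

theorem tensMap_comp {J : Set Ω} {x y z : Ω → C} (f : ∀ a ∈ J, x a ⟶ y a)
    (g : ∀ a ∈ J, y a ⟶ z a) :
    tensMap (M := M) f ≫ tensMap g = tensMap fun a ha => f a ha ≫ g a ha :=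
  ((M.T (ar J)).map_comp _ _).symm

theorem tensMap_comp_assoc {J : Set Ω} {x y z : Ω → C} (f : ∀ a ∈ J, x a ⟶ y a)
    (g : ∀ a ∈ J, y a ⟶ z a) {Z : C} (h : tens M J z ⟶ Z) :
    tensMap f ≫ tensMap g ≫ h = tensMap (fun a ha => f a ha ≫ g a ha) ≫ h := by
  rw [← tensMap_comp, Category.assoc]

/-- The tensor product of isomorphisms. -/
@[simps]
def tensIso {J : Set Ω} {x y : Ω → C} (f : ∀ a ∈ J, x a ≅ y a) : tens M J x ≅ tens M J y where
  hom := tensMap fun a ha => (f a ha).hom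
  inv := tensMap fun a ha => (f a ha).inv
  hom_inv_id := by simp [tensMap_comp, tensMap_id]
  inv_hom_id := by simp [tensMap_comp, tensMap_id]

theorem T_map_eqToHom {β : Arity α} {x y : Pos β → C} (h : x = y) :
    (M.T β).map (eqToHom h) = eqToHom (congrArg (M.T β).obj h) := by
  subst h
  exact (M.T β).map_id _

theorem T_map_eqToHom_self {β : Arity α} {x : Pos β → C} (h : x = x) :
    (M.T β).map (eqToHom h) = 𝟙 _ :=
  T_map_eqToHom h

theorem η_naturality_congr {γ β : Arity α} (p : Partition γ β) {z z' : ∀ i, Pos (p.part i) → C}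
    (f : ∀ i j, z i j ⟶ z' i j) {y y' : Pos β → C} (hy : p.concat z = y) (hy' : p.concat z' = y')
    (g : y ⟶ y') (hg : p.concatMap f ≫ eqToHom hy' = eqToHom hy ≫ g) :
    (M.T γ).map (fun i => (M.T (p.part i)).map (f i)) ≫
        (M.η p z').hom ≫ (M.T β).map (eqToHom hy') =
      ((M.η p z).hom ≫ (M.T β).map (eqToHom hy)) ≫ (M.T β).map g := by
  rw [Category.assoc, ← Functor.map_comp, ← hg, Functor.map_comp, ← Category.assoc,
    ← Category.assoc, M.η_naturality]

/-- The blocks of the double partition carry labels in a common type `I`, so that the induced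
partition differs from the given one only through `d.concat a = g`. With every equality of objects a
hypothesis between variables, substitution reduces the claim to the coherence axiom. -/
theorem η_coherence_congr {I : Type*} (B : I → Arity α) (X : ∀ k, Pos (B k) → C)
    {γ δ β : Arity α} (d : Partition γ δ) (p : Partition γ β) (a : ∀ i, Pos (d.part i) → I)
    (s : ∀ i, ordSum (fun j => (B (a i j)).1) = (p.part i).1) {g : Pos δ → I} (hg : d.concat a = g)
    (s' : ordSum (fun k => (B (g k)).1) = β.1) {y : ∀ i, Pos (p.part i) → C}
    (hy : ∀ i, (Partition.mk (fun j => B (a i j)) (s i)).concat (fun j => X (a i j)) = y i)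
    {x : Pos β → C} (hx : p.concat y = x)
    (hd : (d.concat fun i j => (M.T (B (a i j))).obj (X (a i j))) =
      fun k => (M.T (B (g k))).obj (X (g k)))
    (hz : (Partition.mk (fun k => B (g k)) s').concat (fun k => X (g k)) = x) :
    (M.T γ).map (fun i => (M.η ⟨fun j => B (a i j), s i⟩ fun j => X (a i j)).hom ≫
          (M.T (p.part i)).map (eqToHom (hy i))) ≫
        (M.η p y).hom ≫ (M.T β).map (eqToHom hx) =
      ((M.η d fun i j => (M.T (B (a i j))).obj (X (a i j))).hom ≫ (M.T δ).map (eqToHom hd)) ≫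
        (M.η ⟨fun k => B (g k), s'⟩ fun k => X (g k)).hom ≫ (M.T β).map (eqToHom hz) := by
  obtain rfl : y = fun i =>
    (Partition.mk (fun j => B (a i j)) (s i)).concat (fun j => X (a i j)) :=
    funext fun i => (hy i).symm
  subst hg
  subst hz
  have h := M.coherence d p (fun i => ⟨fun j => B (a i j), s i⟩) (fun i j => X (a i j))
  simp only [T_map_eqToHom_self, Category.comp_id]
  exact h

variable (M)

/-- The associativity isomorphism of a partition of a set. -/
def etaT {K : Set Γ} {L : Γ → Set Ω} {J : Set Ω} (h : IsPart K L J) (x : Ω → C) :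
    tens M K (fun k => tens M (L k) x) ≅ tens M J x :=
  M.η (h.toPartition (α := α)) (fun k j => x (en (α := α) (L (en (α := α) K k)) j)) ≪≫
    (M.T (ar J)).mapIso (eqToIso (h.concat_eq (α := α) x))

variable {M}

theorem etaT_naturality {K : Set Γ} {L : Γ → Set Ω} {J : Set Ω} (h : IsPart K L J)
    {x y : Ω → C} (f : ∀ a ∈ J, x a ⟶ y a) :
    tensMap (fun _ hk => tensMap fun a ha => f a (h.mem_of_mem hk ha)) ≫ (etaT M h y).hom =
      (etaT M h x).hom ≫ tensMap f := by
  refine η_naturality_congr (M := M) (h.toPartition (α := α))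
    (fun k j => f _ (h.subset (en K k).2 (en (α := α) (L (en (α := α) K k)) j).2))
    (h.concat_eq (α := α) x) (h.concat_eq (α := α) y)
    (fun k => f (en (α := α) J k) (en (α := α) J k).2) ?_
  funext m
  rw [Pi.comp_apply, Pi.comp_apply, Functor.eqToHom_proj, Functor.eqToHom_proj]
  exact eqToHom_family_comm f (congrFun (h.concat_eq (α := α) id) m) _ _ _ _

theorem etaT_naturality_assoc {K : Set Γ} {L : Γ → Set Ω} {J : Set Ω} (h : IsPart K L J)
    {x y : Ω → C} (f : ∀ a ∈ J, x a ⟶ y a) {Z : C} (g : tens M J y ⟶ Z) :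
    tensMap (fun _ hk => tensMap fun a ha => f a (h.mem_of_mem hk ha)) ≫ (etaT M h y).hom ≫ g =
      (etaT M h x).hom ≫ tensMap f ≫ g :=
  comp_eq_comp_assoc (etaT_naturality h f) g

/-- The coherence axiom free of transports: concatenation in one step or in two ends at the same
object `tens M J x`. -/
theorem etaT_coherence {D : Set Δ} {Q : Δ → Set Γ} {K : Set Γ} {N : Δ → Set Ω} {L : Γ → Set Ω}
    {J : Set Ω} (hQ : IsPart D Q K) (hN : ∀ d ∈ D, IsPart (Q d) L (N d)) (hL : IsPart K L J)
    (hJ : IsPart D N J) (x : Ω → C) :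
    tensMap (fun d hd => (etaT M (hN d hd) x).hom) ≫ (etaT M hJ x).hom =
      (etaT M hQ fun k => tens M (L k) x).hom ≫ (etaT M hL x).hom :=
  η_coherence_congr (M := M) (fun k => ar (L k)) (fun k j => x (en (α := α) (L k) j))
    (hQ.toPartition (α := α)) (hJ.toPartition (α := α))
    (fun i j => en (α := α) (Q (en (α := α) D i)) j)
    (fun i => ((hN _ (en (α := α) D i).2).toPartition (α := α)).sum_eq)
    (hQ.concat_eq (α := α) _root_.id) (hL.toPartition (α := α)).sum_eq
    (fun i => (hN _ (en (α := α) D i).2).concat_eq (α := α) x) (hJ.concat_eq (α := α) x)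
    (hQ.concat_eq (α := α) fun k => tens M (L k) x) (hL.concat_eq (α := α) x)

/-! ### Tensor products over singletons -/

/-- A tensor product of arity one. -/
def unitIso {β : Arity α} (hβ : β = one hα) {y : Pos β → C} {c : C} (hy : ∀ j, y j = c) :
    (M.T β).obj y ≅ c :=
  (M.T β).mapIso (eqToIso (funext hy)) ≪≫
    eqToIso (by subst hβ; rfl : (M.T β).obj (fun _ => c) = (M.T (one hα)).obj fun _ => c) ≪≫
      (M.ι c).symm

theorem unitIso_naturality {β : Arity α} (hβ : β = one hα) {y y' : Pos β → C} {c c' : C}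
    (hy : ∀ j, y j = c) (hy' : ∀ j, y' j = c') (f : y ⟶ y') (g : c ⟶ c')
    (hfg : ∀ j, f j = eqToHom (hy j) ≫ g ≫ eqToHom (hy' j).symm) :
    (M.T β).map f ≫ (unitIso (M := M) hβ hy').hom = (unitIso (M := M) hβ hy).hom ≫ g := by
  obtain rfl : y = fun _ => c := funext hy
  obtain rfl : y' = fun _ => c' := funext hy'
  obtain rfl : f = fun _ => g := funext fun j => by simpa using hfg j
  subst hβ
  simp only [unitIso, Iso.trans_hom, Functor.mapIso_hom, eqToIso.hom, T_map_eqToHom_self,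
    Category.id_comp, Iso.symm_hom]
  simp only [eqToHom_refl, Category.id_comp]
  rw [Iso.comp_inv_eq, Category.assoc, M.ι_naturality, Iso.inv_hom_id_assoc]

/-- The outer unit axiom, for an index arity such as `ar {k}` that equals `one hα` only
propositionally. -/
theorem unitIso_whole {β : Arity α} (hβ : β = one hα) {b : Arity α}
    {z : Pos b → C} (s : ordSum (fun _ : Pos β => b.1) = b.1)
    (hz : (Partition.mk (γ := β) (fun _ => b) s).concat (fun _ => z) = z) :
    (M.η ⟨fun _ => b, s⟩ (fun _ => z)).hom ≫ (M.T b).map (eqToHom hz) =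
      (unitIso (M := M) hβ (y := fun _ => (M.T b).obj z) fun _ => rfl).hom := by
  subst hβ
  have h := M.unit_outer b z
  simp only [unitIso, Iso.trans_hom, Functor.mapIso_hom, eqToIso.hom, T_map_eqToHom_self,
    Category.id_comp, Iso.symm_hom]
  simp only [eqToHom_refl, Category.id_comp]
  rw [← cancel_epi (M.ι ((M.T b).obj z)).hom]
  exact h.trans (Iso.hom_inv_id _).symm

theorem ar_singleton (k : Γ) : ar (α := α) {k} = one hα :=
  Subtype.ext (Ordinal.type_eq_one_of_unique _)

/-- The tensor product over a singleton. -/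
def sing (k : Γ) (x : Γ → C) : tens M {k} x ≅ x k :=
  unitIso (ar_singleton k) fun j => congrArg x (en (α := α) {k} j).2

theorem sing_naturality (k : Γ) {x y : Γ → C} (f : ∀ a ∈ ({k} : Set Γ), x a ⟶ y a) :
    tensMap (M := M) f ≫ (sing k y).hom = (sing k x).hom ≫ f k rfl := by
  refine unitIso_naturality (M := M) (ar_singleton k) _ _ _ _ fun j => ?_
  have : ∀ a (ha : a ∈ ({k} : Set Γ)) (h1 : x a = x k) (h2 : y k = y a),
      f a ha = eqToHom h1 ≫ f k rfl ≫ eqToHom h2 := by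
    rintro a rfl _ _
    simp
  exact this _ _ _ _

theorem etaT_sing (k : Γ) (x : Γ → C) :
    (etaT M (isPart_singleton k fun _ => {k}) x).hom = (sing k fun _ => tens M {k} x).hom :=
  unitIso_whole (M := M) (ar_singleton k) (b := ar {k}) (z := fun j => x (en (α := α) {k} j))
    ((isPart_singleton k fun _ => {k}).toPartition (α := α)).sum_eq
    ((isPart_singleton k fun _ => {k}).concat_eq (α := α) x)

end Tens

/-! ### Valuations -/

section Val

variable {hα : (Ordinal.omega0.{w} : WithTop Ordinal.{w}) ≤ α}
  {C : Type u} [Category.{v} C] (M : UnbiasedMonoidal hα C)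

/-- A valuation on a linear order `Λ`: an object for each subset of `Λ`, which is the tensor
product of the objects of the blocks, for each partition of the subset whose order type
belongs to `S`. -/
structure Val (S : Set Ordinal.{w}) (Λ : Type w) [LinearOrder Λ] where
  /-- the value of a subset -/
  e : Set Λ → C
  /-- the comparison isomorphism of a partition -/
  m : ∀ {Γ : Type w} [LinearOrder Γ] [WellFoundedLT Γ] [IsSmall α Γ] {K : Set Γ}
    {L : Γ → Set Λ} {J : Set Λ}, otype K ∈ S → IsPart K L J → (tens M K (fun k => e (L k)) ≅ e J)
  coh : ∀ {Γ Δ : Type w} [LinearOrder Γ] [WellFoundedLT Γ] [IsSmall α Γ] [LinearOrder Δ]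
    [WellFoundedLT Δ] [IsSmall α Δ] {D : Set Δ} {Q : Δ → Set Γ} {K : Set Γ} {N : Δ → Set Λ}
    {L : Γ → Set Λ} {J : Set Λ} (sD : otype D ∈ S) (sQ : ∀ d ∈ D, otype (Q d) ∈ S)
    (sK : otype K ∈ S) (hQ : IsPart D Q K) (hN : ∀ d ∈ D, IsPart (Q d) L (N d))
    (hL : IsPart K L J) (hJ : IsPart D N J),
    tensMap (fun d hd => (m (sQ d hd) (hN d hd)).hom) ≫ (m sD hJ).hom =
      (etaT M hQ fun k => e (L k)).hom ≫ (m sK hL).hom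

variable {M} {S : Set Ordinal.{w}}

/-- The valuation given by the tensor products of the restrictions of a family. -/
def tensVal (S : Set Ordinal.{w}) {Ω : Type w} [LinearOrder Ω] [WellFoundedLT Ω] [IsSmall α Ω]
    (x : Ω → C) : Val M S Ω where
  e J := tens M J x
  m _ h := etaT M h x
  coh _ _ _ hQ hN hL hJ := etaT_coherence hQ hN hL hJ x

variable {Λ Ω : Type w} [LinearOrder Λ] [LinearOrder Ω]

/-- The pullback of a valuation along a map of subsets that preserves partitions. -/
def Val.comap (V : Val M S Ω) (Φ : Set Λ → Set Ω)
    (hΦ : ∀ {Γ : Type w} [LinearOrder Γ] {K : Set Γ} {L : Γ → Set Λ} {J : Set Λ},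
      IsPart K L J → IsPart K (fun k => Φ (L k)) (Φ J)) : Val M S Λ where
  e J := V.e (Φ J)
  m s h := V.m s (hΦ h)
  coh sD sQ sK hQ hN hL hJ := V.coh sD sQ sK hQ (fun d hd => hΦ (hN d hd)) (hΦ hL) (hΦ hJ)

/-- The restriction of a valuation to fewer partitions. -/
def Val.restrict {S' : Set Ordinal.{w}} (V : Val M S Λ) (h : S' ⊆ S) : Val M S' Λ where
  e := V.e
  m s := V.m (h s)
  coh sD sQ sK := V.coh (h sD) (fun d hd => h (sQ d hd)) (h sK)

/-- A morphism of valuations, on the subsets of `U`. -/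
structure HomOn (V V' : Val M S Λ) (U : Set Λ) where
  /-- the components -/
  app : ∀ J, J ⊆ U → (V.e J ⟶ V'.e J)
  comm : ∀ {Γ : Type w} [LinearOrder Γ] [WellFoundedLT Γ] [IsSmall α Γ] {K : Set Γ}
    {L : Γ → Set Λ} {J : Set Λ} (s : otype K ∈ S) (h : IsPart K L J) (hJ : J ⊆ U),
    (V.m s h).hom ≫ app J hJ =
      tensMap (fun k hk => app (L k) ((h.subset hk).trans hJ)) ≫ (V'.m s h).hom

variable {Γ : Type w} [LinearOrder Γ] [WellFoundedLT Γ] [IsSmall α Γ]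

/-- A valuation needs no unit axiom. Coherence for `{k}` split into the one block `{k}`, after
cancelling the invertible `m`, says that `m` tensored over `{k}` is `sing`; naturality of `sing`
then forces `m` itself to be `sing`. -/
theorem Val.m_singleton (V : Val M S Λ) (k : Γ) (s : otype {k} ∈ S) (L : Γ → Set Λ) :
    (V.m s (isPart_singleton k L)).hom = (sing k fun k => V.e (L k)).hom := by
  have hN : ∀ d ∈ ({k} : Set Γ), IsPart {k} L (L d) := by
    rintro d rfl
    exact isPart_singleton _ L
  have h1 := V.coh (Q := fun _ => {k}) (N := L) s (fun _ _ => s) s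
    (isPart_singleton k fun _ => {k}) hN (isPart_singleton k L) (isPart_singleton k L)
  rw [cancel_mono, etaT_sing] at h1
  have h2 := sing_naturality (M := M) k fun d hd => (V.m s (hN d hd)).hom
  rw [h1, cancel_epi] at h2
  exact h2.symm

theorem Val.m_singleton_eq (V : Val M S Λ) (k : Γ) (s : otype {k} ∈ S) (L : Γ → Set Λ)
    {J : Set Λ} (h : IsPart {k} L J) (hJ : L k = J) :
    (V.m s h).hom = (sing k fun k => V.e (L k)).hom ≫ eqToHom (congrArg V.e hJ) := by
  subst hJ
  rw [eqToHom_refl, Category.comp_id]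
  exact V.m_singleton k s L

theorem IsPart.eq_of_singleton {k : Γ} {L : Γ → Set Λ} {J : Set Λ} (h : IsPart {k} L J) :
    L k = J := by
  ext a
  simp [h.mem a]

/-- Sets which are generated from singletons by partitions with order type in `S`. -/
inductive Good (α : WithTop Ordinal.{w}) (S : Set Ordinal.{w}) {Λ : Type w} [LinearOrder Λ] :
    Set Λ → Prop
  | singleton (a : Λ) : Good α S {a}
  | part {Γ : Type w} [LinearOrder Γ] [WellFoundedLT Γ] [IsSmall α Γ] {K : Set Γ}
    {L : Γ → Set Λ} {U : Set Λ} (s : otype K ∈ S) (h : IsPart K L U)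
    (ih : ∀ k ∈ K, Good α S (L k)) : Good α S U

theorem tensMap_congr {K : Set Γ} {x y : Γ → C} {f g : ∀ a ∈ K, x a ⟶ y a}
    (h : ∀ a ha, f a ha = g a ha) : tensMap (M := M) f = tensMap g := by
  obtain rfl : f = g := funext fun a => funext fun ha => h a ha
  rfl

/-- Comparison isomorphisms are invertible, so the component at a set is determined by those at the
blocks of any admissible partition; induction along the generation of `J` descends to singletons. -/
theorem Good.hom_ext {J U : Set Λ} (hJ : Good α S J) (hU : J ⊆ U) {V V' : Val M S Λ}
    (ξ ζ : HomOn V V' U)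
    (h : ∀ a (ha : a ∈ J), ξ.app {a} (Set.singleton_subset_iff.2 (hU ha)) =
      ζ.app {a} (Set.singleton_subset_iff.2 (hU ha))) : ξ.app J hU = ζ.app J hU := by
  induction hJ with
  | singleton a => exact h a rfl
  | part s hp _ ih =>
    rw [← cancel_epi (V.m s hp).hom, ξ.comm, ζ.comm]
    congr 1
    exact tensMap_congr fun k hk => ih k hk _ fun a ha => h a (hp.subset hk ha)

theorem isIso_tensMap {K : Set Γ} {x y : Γ → C} (f : ∀ a ∈ K, x a ⟶ y a)
    (h : ∀ a ha, IsIso (f a ha)) : IsIso (tensMap (M := M) f) :=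
  inferInstanceAs (IsIso (tensIso (M := M) fun a ha => @asIso _ _ _ _ (f a ha) (h a ha)).hom)

theorem Good.isIso_app {J U : Set Λ} (hJ : Good α S J) (hU : J ⊆ U) {V V' : Val M S Λ}
    (ξ : HomOn V V' U)
    (h : ∀ a (ha : a ∈ J), IsIso (ξ.app {a} (Set.singleton_subset_iff.2 (hU ha)))) :
    IsIso (ξ.app J hU) := by
  induction hJ with
  | singleton a => exact h a rfl
  | part s hp _ ih =>
    have h1 := isIso_tensMap (M := M) (fun k hk => ξ.app _ ((hp.subset hk).trans hU)) fun k hk =>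
      ih k hk _ fun a ha => h a (hp.subset hk ha)
    rw [← isIso_comp_left_iff (V.m s hp).hom, ξ.comm]
    infer_instance

/-! ### Index classes and common refinements -/

/-- The closure properties of a class of ordinals that are needed to extend morphisms of
valuations. -/
structure IsIndexClass (α : WithTop Ordinal.{w}) (S : Set Ordinal.{w}) : Prop where
  down : ∀ {a b : Ordinal.{w}}, a ≤ b → b ∈ S → a ∈ S
  one_mem : 1 ∈ S
  lt : ∀ {a : Ordinal.{w}}, a ∈ S → (a : WithTop Ordinal.{w}) < α
  chain : ∀ {Θ Γ Γ' : Type w} [LinearOrder Θ] [WellFoundedLT Θ] [LinearOrder Γ]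
    [WellFoundedLT Γ] [LinearOrder Γ'] [WellFoundedLT Γ'] {K : Set Γ} {K' : Set Γ'}
    (f : Θ → Γ) (g : Θ → Γ'), Monotone f → Monotone g → (∀ r, f r ∈ K) → (∀ r, g r ∈ K') →
    (Function.Injective fun r => (f r, g r)) → otype K ∈ S → otype K' ∈ S →
    Ordinal.type ((· < ·) : Θ → Θ → Prop) ∈ S

theorem IsIndexClass.isSmall (hS : IsIndexClass α S) {Θ : Type w} [LinearOrder Θ]
    [WellFoundedLT Θ] (h : Ordinal.type ((· < ·) : Θ → Θ → Prop) ∈ S) : IsSmall α Θ :=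
  ⟨hS.lt h⟩

theorem IsIndexClass.otype_subset (hS : IsIndexClass α S) {J J' : Set Γ} (h : J ⊆ J')
    (h' : otype J' ∈ S) : otype J ∈ S :=
  hS.down (otype_mono h) h'

theorem IsIndexClass.otype_singleton (hS : IsIndexClass α S) (k : Γ) : otype {k} ∈ S := by
  rw [show otype {k} = 1 from Ordinal.type_eq_one_of_unique _]
  exact hS.one_mem

theorem IsIndexClass.otype_of_subsingleton (hS : IsIndexClass α S) [Subsingleton Γ] (J : Set Γ) :
    otype J ∈ S := by
  refine hS.down ?_ hS.one_mem
  rcases isEmpty_or_nonempty J with h | ⟨⟨k⟩⟩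
  · exact (Ordinal.type_eq_zero_iff_isEmpty.2 h).trans_le zero_le_one
  · have : Unique J := ⟨⟨k⟩, fun _ => Subsingleton.elim _ _⟩
    exact (Ordinal.type_eq_one_of_unique _).le

theorem IsIndexClass.isSmall_punit (hS : IsIndexClass α S) : IsSmall α PUnit.{w + 1} :=
  hS.isSmall (by rw [Ordinal.type_eq_one_of_unique]; exact hS.one_mem)

/-! ### The common refinement of two partitions -/

section Overlap

variable {Γ' : Type w} [LinearOrder Γ'] [WellFoundedLT Γ'] {K : Set Γ} {L : Γ → Set Λ}
  {K' : Set Γ'} {L' : Γ' → Set Λ} {U U' : Set Λ}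

/-- The pairs of blocks of two partitions that meet each other, ordered lexicographically. -/
abbrev Overlap (K : Set Γ) (L : Γ → Set Λ) (K' : Set Γ') (L' : Γ' → Set Λ) : Type w :=
  {x : Γ ×ₗ Γ' // (ofLex x).1 ∈ K ∧ (ofLex x).2 ∈ K' ∧ (L (ofLex x).1 ∩ L' (ofLex x).2).Nonempty}

namespace Overlap

/-- The block of the first partition. -/
def fst (r : Overlap K L K' L') : Γ := (ofLex r.1).1

/-- The block of the second partition. -/
def snd (r : Overlap K L K' L') : Γ' := (ofLex r.1).2

/-- The intersection of the two blocks. -/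
def block (r : Overlap K L K' L') : Set Λ := L r.fst ∩ L' r.snd

theorem fst_mem (r : Overlap K L K' L') : r.fst ∈ K := r.2.1

theorem snd_mem (r : Overlap K L K' L') : r.snd ∈ K' := r.2.2.1

theorem block_nonempty (r : Overlap K L K' L') : r.block.Nonempty := r.2.2.2

theorem ext {r s : Overlap K L K' L'} (h : r.fst = s.fst) (h' : r.snd = s.snd) : r = s :=
  Subtype.ext (ofLex.injective (Prod.ext h h'))

theorem lt_of_fst_lt {r s : Overlap K L K' L'} (h : r.fst < s.fst) : r < s :=
  Prod.Lex.lt_iff.2 (Or.inl h)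

theorem fst_mono : Monotone (fst : Overlap K L K' L' → Γ) := fun _ _ h =>
  le_of_not_gt fun h' => not_lt_of_ge h (lt_of_fst_lt h')

/-- Blocks of overlaps are nonempty. If the second coordinate dropped, points of the two blocks
would be ordered one way by the second partition, and the other way by the first partition or the
lexicographic order. -/
theorem snd_mono (h : IsPart K L U) (h' : IsPart K' L' U') :
    Monotone (snd : Overlap K L K' L' → Γ') := by
  intro r s hrs
  refine le_of_not_gt fun hlt => ?_
  obtain ⟨a, ha, ha'⟩ := r.block_nonempty
  obtain ⟨b, hb, hb'⟩ := s.block_nonempty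
  have h1 : b < a := h'.lt _ s.snd_mem _ r.snd_mem hlt _ hb' _ ha'
  rcases (fst_mono hrs).lt_or_eq with h2 | h2
  · exact lt_asymm h1 (h.lt _ r.fst_mem _ s.fst_mem h2 _ ha _ hb)
  · rcases hrs.lt_or_eq with h3 | h3
    · rcases Prod.Lex.lt_iff.1 h3 with h4 | h4
      · exact h4.ne h2
      · exact lt_asymm h4.2 hlt
    · exact hlt.ne (congrArg snd h3).symm

theorem lt_of_snd_lt (h : IsPart K L U) (h' : IsPart K' L' U') {r s : Overlap K L K' L'}
    (hrs : r.snd < s.snd) : r < s :=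
  lt_of_not_ge fun h1 => not_lt_of_ge (snd_mono h h' h1) hrs

/-- Overlaps form a chain in the product of the two index orders, with both coordinates monotone;
this is the situation covered by the closure condition `chain`. -/
theorem type_mem (hS : IsIndexClass α S) (h : IsPart K L U) (h' : IsPart K' L' U')
    (s : otype K ∈ S) (t : otype K' ∈ S) :
    Ordinal.type ((· < ·) : Overlap K L K' L' → Overlap K L K' L' → Prop) ∈ S :=
  hS.chain fst snd fst_mono (snd_mono h h') fst_mem snd_mem
    (fun _ _ hrs => ext (congrArg Prod.fst hrs) (congrArg Prod.snd hrs)) s t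

/-- The overlap of the blocks of `k` and `k'`. -/
def mk {k : Γ} {k' : Γ'} (hk : k ∈ K) (hk' : k' ∈ K') {a : Λ} (ha : a ∈ L k) (ha' : a ∈ L' k') :
    Overlap K L K' L' :=
  ⟨toLex (k, k'), hk, hk', a, ha, ha'⟩

theorem block_lt (h : IsPart K L U) (h' : IsPart K' L' U') {r s : Overlap K L K' L'} (hrs : r < s)
    {a b : Λ} (ha : a ∈ r.block) (hb : b ∈ s.block) : a < b := by
  rcases (fst_mono hrs.le).lt_or_eq with h1 | h1
  · exact h.lt _ r.fst_mem _ s.fst_mem h1 _ ha.1 _ hb.1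
  · rcases (snd_mono h h' hrs.le).lt_or_eq with h2 | h2
    · exact h'.lt _ r.snd_mem _ s.snd_mem h2 _ ha.2 _ hb.2
    · exact absurd (ext h1 h2) hrs.ne

theorem isPart (h : IsPart K L U) (h' : IsPart K' L' U') {R : Set (Overlap K L K' L')} {J : Set Λ}
    (hJ : ∀ a, a ∈ J ↔ ∃ r ∈ R, a ∈ r.block) : IsPart R block J where
  mem := hJ
  lt _ _ _ _ hrs _ ha _ hb := block_lt h h' hrs ha hb

end Overlap

end Overlap

theorem IsPart.inter {K : Set Γ} {L : Γ → Set Λ} {U J : Set Λ} (h : IsPart K L U) (hJ : J ⊆ U) :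
    IsPart K (fun k => L k ∩ J) J where
  mem a := by
    constructor
    · intro ha
      obtain ⟨k, hk, h1⟩ := (h.mem a).1 (hJ ha)
      exact ⟨k, hk, h1, ha⟩
    · rintro ⟨k, -, -, ha⟩
      exact ha
  lt k hk l hl hkl a ha b hb := h.lt k hk l hl hkl a ha.1 b hb.1

theorem IsPart.eq_of_mem {K : Set Γ} {L : Γ → Set Λ} {U : Set Λ} (h : IsPart K L U) {k l : Γ}
    (hk : k ∈ K) (hl : l ∈ K) {a : Λ} (ha : a ∈ L k) (hb : a ∈ L l) : k = l := by
  rcases lt_trichotomy k l with h1 | h1 | h1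
  · exact absurd (h.lt k hk l hl h1 a ha a hb) (lt_irrefl _)
  · exact h1
  · exact absurd (h.lt l hl k hk h1 a hb a ha) (lt_irrefl _)

theorem IsPart.mono_left {Θ : Type w} [LinearOrder Θ] {R R' : Set Θ}
    {P : Θ → Set Λ} {J : Set Λ} (h : IsPart R P J) (hR : R' ⊆ R) {J' : Set Λ}
    (hJ : ∀ a, a ∈ J' ↔ ∃ r ∈ R', a ∈ P r) : IsPart R' P J' where
  mem := hJ
  lt r hr s hs := h.lt r (hR hr) s (hR hs)

/-- The fibres of a monotone map form a partition. -/
theorem isPart_fiber {Θ : Type w} [LinearOrder Θ] {K : Set Γ} {R : Set Θ} {κ : Θ → Γ}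
    (hK : ∀ r ∈ R, κ r ∈ K) (hκ : ∀ r ∈ R, ∀ s ∈ R, κ r < κ s → r < s) :
    IsPart K (fun k => {r | r ∈ R ∧ κ r = k}) R where
  mem r := ⟨fun hr => ⟨κ r, hK r hr, hr, rfl⟩, fun ⟨_, _, hr, _⟩ => hr⟩
  lt := by
    rintro _ _ _ _ h r ⟨hr, rfl⟩ s ⟨hs, rfl⟩
    exact hκ r hr s hs h

/-! ### Gluing of morphisms of valuations -/

/-- The value on a subset of the morphism glued from morphisms on the blocks of a partition. -/
def glueApp {V V' : Val M S Λ} {K : Set Γ} {L : Γ → Set Λ} {U : Set Λ} (s : otype K ∈ S)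
    (h : IsPart K L U) (ξ : ∀ k ∈ K, HomOn V V' (L k)) (J : Set Λ) (hJ : J ⊆ U) :
    V.e J ⟶ V'.e J :=
  (V.m s (h.inter hJ)).inv ≫
    tensMap (fun k hk => (ξ k hk).app (L k ∩ J) Set.inter_subset_left) ≫ (V'.m s (h.inter hJ)).hom

/-- The glued morphism may be computed on any refinement, `κ` recording the block of `L` that
contains each `P r`. Grouping `R` by the fibres of `κ`, coherence in `V` and `V'` reduces this to
the compatibility of each `ξ k`. -/
theorem glueApp_refined (hS : IsIndexClass α S) {V V' : Val M S Λ} {K : Set Γ} {L : Γ → Set Λ}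
    {U : Set Λ} (s : otype K ∈ S) (h : IsPart K L U) (ξ : ∀ k ∈ K, HomOn V V' (L k)) (J : Set Λ)
    (hJ : J ⊆ U) {Θ : Type w} [LinearOrder Θ] [WellFoundedLT Θ] [IsSmall α Θ] {R : Set Θ}
    {P : Θ → Set Λ} (sR : otype R ∈ S) (hR : IsPart R P J) (κ : Θ → Γ)
    (hK : ∀ r ∈ R, κ r ∈ K) (hκ : ∀ r ∈ R, ∀ s ∈ R, κ r < κ s → r < s)
    (hP : ∀ r ∈ R, P r ⊆ L (κ r)) :
    (V.m sR hR).hom ≫ glueApp s h ξ J hJ =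
      tensMap (fun r hr => (ξ (κ r) (hK r hr)).app (P r) (hP r hr)) ≫ (V'.m sR hR).hom := by
  have hQ := isPart_fiber hK hκ
  have hN : ∀ k ∈ K, IsPart {r | r ∈ R ∧ κ r = k} P (L k ∩ J) := by
    intro k hk
    refine hR.mono_left (fun r hr => hr.1) fun a => ?_
    constructor
    · rintro ⟨ha, haJ⟩
      obtain ⟨r, hr, har⟩ := (hR.mem a).1 haJ
      exact ⟨r, ⟨hr, h.eq_of_mem (hK r hr) hk (hP r hr har) ha⟩, har⟩
    · rintro ⟨r, ⟨hr, rfl⟩, har⟩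
      exact ⟨hP r hr har, hR.subset hr har⟩
  have sQ : ∀ k ∈ K, otype {r | r ∈ R ∧ κ r = k} ∈ S := fun k _ =>
    hS.otype_subset (fun r hr => hr.1) sR
  have e1 := V.coh s sQ sR hQ hN hR (h.inter hJ)
  have e2 := V'.coh s sQ sR hQ hN hR (h.inter hJ)
  rw [← cancel_epi (etaT M hQ fun r => V.e (P r)).hom, ← comp_eq_comp_assoc e1, glueApp,
    Iso.hom_inv_id_assoc, tensMap_comp_assoc]
  -- On the fibre over `k` every `κ r` is `k`, so this is the compatibility of `ξ k` with the
  -- partition of `L k ∩ J` by that fibre.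
  have e3 : tensMap (M := M) (fun k hk => (V.m (sQ k hk) (hN k hk)).hom ≫
        (ξ k hk).app (L k ∩ J) Set.inter_subset_left) =
      tensMap (fun k hk => tensMap fun r hr => (ξ (κ r) (hK r (hQ.mem_of_mem hk hr))).app (P r)
        (hP r (hQ.mem_of_mem hk hr))) ≫ tensMap fun k hk => (V'.m (sQ k hk) (hN k hk)).hom := by
    rw [tensMap_comp]
    refine tensMap_congr fun k hk => ?_
    rw [(ξ k hk).comm]
    congr 1
    refine tensMap_congr fun r hr => ?_
    obtain ⟨hr, rfl⟩ := hr
    rfl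
  rw [e3, Category.assoc, e2, etaT_naturality_assoc hQ
    fun r hr => (ξ (κ r) (hK r hr)).app (P r) (hP r hr)]

/-- Gluing of morphisms along a partition. -/
def HomOn.glue (hS : IsIndexClass α S) {V V' : Val M S Λ} {K : Set Γ} {L : Γ → Set Λ}
    {U : Set Λ} (s : otype K ∈ S) (h : IsPart K L U) (ξ : ∀ k ∈ K, HomOn V V' (L k)) :
    HomOn V V' U where
  app := glueApp s h ξ
  comm {Γ'} _ _ _ K' L' J s' h' hJ := by
    -- The overlaps refine `J` and, grouped by second coordinate, each `L' k'`. By `glueApp_refined`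
    -- the glued morphism on all these sets is computed from the same components on overlaps.
    have tΘ := Overlap.type_mem hS h h' s s'
    have : IsSmall α (Overlap K L K' L') := hS.isSmall tΘ
    have tR : ∀ R : Set (Overlap K L K' L'), otype R ∈ S := fun R =>
      hS.down (otype_le_type R) tΘ
    have hQ : IsPart K' (fun k' => {r : Overlap K L K' L' | r ∈ Set.univ ∧ r.snd = k'}) Set.univ :=
      isPart_fiber (fun r _ => r.snd_mem) fun r _ s _ => Overlap.lt_of_snd_lt h h'
    have hN : ∀ k' ∈ K', IsPart {r : Overlap K L K' L' | r ∈ Set.univ ∧ r.snd = k'}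
        Overlap.block (L' k') := by
      refine fun k' hk' => Overlap.isPart h h' fun a => ⟨fun ha => ?_, ?_⟩
      · obtain ⟨k, hk, hak⟩ := (h.mem a).1 (hJ (h'.subset hk' ha))
        exact ⟨Overlap.mk hk hk' hak ha, ⟨trivial, rfl⟩, hak, ha⟩
      · rintro ⟨r, ⟨-, rfl⟩, ha⟩
        exact ha.2
    have hL : IsPart (Set.univ : Set (Overlap K L K' L')) Overlap.block J := by
      refine Overlap.isPart h h' fun a => ⟨fun ha => ?_, ?_⟩
      · obtain ⟨k, hk, hak⟩ := (h.mem a).1 (hJ ha)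
        obtain ⟨k', hk', hak'⟩ := (h'.mem a).1 ha
        exact ⟨Overlap.mk hk hk' hak hak', trivial, hak, hak'⟩
      · rintro ⟨r, -, ha⟩
        exact h'.subset r.snd_mem ha.2
    have e1 := V.coh s' (fun k' _ => tR _) (tR _) hQ hN hL h'
    have e2 := V'.coh s' (fun k' _ => tR _) (tR _) hQ hN hL h'
    have e3 := isIso_tensMap (M := M) (fun k' hk' => (V.m (tR _) (hN k' hk')).hom)
      fun _ _ => inferInstance
    rw [← cancel_epi (tensMap fun k' hk' => (V.m (tR _) (hN k' hk')).hom), comp_eq_comp_assoc e1,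
      glueApp_refined hS s h ξ J hJ (tR _) hL Overlap.fst (fun r _ => r.fst_mem)
        (fun r _ s _ => Overlap.lt_of_fst_lt) (fun r _ => Set.inter_subset_left),
      tensMap_comp_assoc]
    have e4 : tensMap (M := M) (fun k' hk' => (V.m (tR _) (hN k' hk')).hom ≫
          glueApp s h ξ (L' k') ((h'.subset hk').trans hJ)) =
        tensMap (fun k' hk' => tensMap fun r hr => (ξ r.fst r.fst_mem).app r.block
          Set.inter_subset_left) ≫ tensMap fun k' hk' => (V'.m (tR _) (hN k' hk')).hom := by
      rw [tensMap_comp]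
      exact tensMap_congr fun k' hk' => glueApp_refined hS s h ξ (L' k')
        ((h'.subset hk').trans hJ) (tR _) (hN k' hk') Overlap.fst (fun r _ => r.fst_mem)
        (fun r _ s _ => Overlap.lt_of_fst_lt) (fun r _ => Set.inter_subset_left)
    rw [e4, Category.assoc, e2, ← etaT_naturality_assoc hQ
      fun r _ => (ξ r.fst r.fst_mem).app r.block Set.inter_subset_left]

/-- A point lies in at most one block, so testing membership of `a` turns partitions in `Λ` into
partitions of subsets of a point. This handles the singleton base case of the constructions by
generation. -/
theorem isPart_point (a : Λ) {Γ : Type w} [LinearOrder Γ] {K : Set Γ} {L : Γ → Set Λ} {J : Set Λ}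
    (h : IsPart K L J) : IsPart K (fun k => {_p : PUnit.{w + 1} | a ∈ L k}) {_p | a ∈ J} :=
  ⟨fun _ => h.mem a, fun k hk l hl hkl _ ha _ hb =>
    absurd (h.lt k hk l hl hkl a ha a hb) (lt_irrefl _)⟩

/-- Morphisms of valuations are glued from arbitrary morphisms on singletons. -/
theorem Good.exists_hom (hS : IsIndexClass α S) {U : Set Λ} (hU : Good α S U) (V V' : Val M S Λ)
    (φ : ∀ a ∈ U, V.e {a} ⟶ V'.e {a}) : ∃ ξ : HomOn V V' U, ∀ a (ha : a ∈ U),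
      ξ.app {a} (Set.singleton_subset_iff.2 ha) = φ a ha := by
  induction hU with
  | singleton a =>
    have := hS.isSmall_punit
    -- A subset of `{a}` is a sum of copies of `{a}` over a subset of a point; the empty set and
    -- `{a}` need no separate treatment.
    have hp : ∀ {J : Set Λ}, J ⊆ {a} →
        IsPart {_p : PUnit.{w + 1} | a ∈ J} (fun _ => {a}) J := by
      intro J hJ
      refine ⟨fun b => ⟨fun hb => ?_, ?_⟩, fun p _ q _ hpq => absurd hpq (lt_irrefl _)⟩
      · obtain rfl := hJ hb
        exact ⟨PUnit.unit, hb, rfl⟩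
      · rintro ⟨_, ha, rfl⟩
        exact ha
    have sp : ∀ J : Set PUnit.{w + 1}, otype J ∈ S := hS.otype_of_subsingleton
    refine ⟨⟨fun J hJ => (V.m (sp _) (hp hJ)).inv ≫ tensMap (fun _ _ => φ a rfl) ≫
      (V'.m (sp _) (hp hJ)).hom, ?_⟩, ?_⟩
    · intro Γ _ _ _ K L J s h hJ
      have hJ' : ∀ k ∈ K, L k ⊆ {a} := fun k hk => (h.subset hk).trans hJ
      have e1 := V.coh s (fun k _ => sp _) (sp _) (isPart_point a h) (fun k hk => hp (hJ' k hk)) (hp hJ) h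
      have e2 := V'.coh s (fun k _ => sp _) (sp _) (isPart_point a h) (fun k hk => hp (hJ' k hk)) (hp hJ) h
      have e3 := isIso_tensMap (M := M) (fun k hk => (V.m (sp _) (hp (hJ' k hk))).hom)
        fun _ _ => inferInstance
      rw [← cancel_epi (tensMap fun k hk => (V.m (sp _) (hp (hJ' k hk))).hom), comp_eq_comp_assoc e1,
        Iso.hom_inv_id_assoc, ← etaT_naturality_assoc (isPart_point a h) fun _ _ => φ a rfl, ← e2,
        tensMap_comp_assoc, tensMap_comp_assoc]
      congr 1
      exact tensMap_congr fun k hk => by simp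
    · rintro b rfl
      have key : ∀ (J : Set PUnit.{w + 1}) (_ : J = {PUnit.unit}) (h : IsPart J (fun _ => {b}) {b}),
          (V.m (sp J) h).inv ≫ tensMap (fun _ _ => φ b rfl) ≫ (V'.m (sp J) h).hom = φ b rfl := by
        rintro _ rfl h
        rw [Iso.inv_comp_eq, V.m_singleton, V'.m_singleton]
        exact sing_naturality PUnit.unit fun _ _ => φ b rfl
      exact key _ (Set.ext fun _ => ⟨fun _ => rfl, fun _ => rfl⟩) _
  | @part Γ _ _ _ K L U s h _ ih =>
    choose ξ hξ using fun k hk => ih k hk fun a ha => φ a (h.mem_of_mem hk ha)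
    refine ⟨HomOn.glue hS s h ξ, fun a ha => ?_⟩
    obtain ⟨k, hk, hak⟩ := (h.mem a).1 ha
    -- The set `{a}` meets only the block `L k`, so the glued component is read off from the
    -- refinement with the single index `k`.
    have h1 := glueApp_refined hS s h ξ {a} (Set.singleton_subset_iff.2 ha)
      (hS.otype_singleton k) (isPart_singleton k fun _ => {a}) (fun k => k)
      (by rintro _ rfl; exact hk) (by rintro _ rfl _ rfl h; exact h)
      (by rintro _ rfl; exact Set.singleton_subset_iff.2 hak)
    have h2 := (ξ k hk).comm (hS.otype_singleton k) (isPart_singleton k fun _ => {a})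
      (Set.singleton_subset_iff.2 hak)
    rw [hξ k hk a hak] at h2
    rw [← cancel_epi (V.m (hS.otype_singleton k) (isPart_singleton k fun _ => {a})).hom, h2]
    refine h1.trans ?_
    congr 1
    refine tensMap_congr ?_
    rintro _ rfl
    rfl

end Val

/-! ### Gluing of valuations -/

section Glue

variable {hα : (Ordinal.omega0.{w} : WithTop Ordinal.{w}) ≤ α}
  {C : Type u} [Category.{v} C] {M : UnbiasedMonoidal hα C} {S : Set Ordinal.{w}}
  {Λ Γ Θ Θ' : Type w} [LinearOrder Λ] [LinearOrder Γ] [WellFoundedLT Γ] [IsSmall α Γ]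
  [LinearOrder Θ'] [WellFoundedLT Θ'] [IsSmall α Θ'] [LinearOrder Θ] [WellFoundedLT Θ]
  [IsSmall α Θ]

/-- The comparison isomorphism of a partition, for a family of valuations which is constant on
the index set of the partition. -/
def Val.mix (V : Γ → Val M S Λ) {R : Set Θ} {P : Θ → Set Λ} {J : Set Λ} (s : otype R ∈ S)
    (h : IsPart R P J) (κ : Θ → Γ) (k : Γ) (hκ : ∀ r ∈ R, κ r = k) :
    tens M R (fun r => (V (κ r)).e (P r)) ≅ (V k).e J :=
  tensIso (fun r hr => eqToIso (by rw [hκ r hr])) ≪≫ (V k).m s h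

theorem Val.m_eqToHom (V : Γ → Val M S Λ) {R : Set Θ} {P : Θ → Set Λ} {J : Set Λ}
    (s : otype R ∈ S) (h : IsPart R P J) {l k : Γ} (hl : l = k) {κ : Θ → Γ}
    (h1 : ∀ r ∈ R, (V (κ r)).e (P r) = (V l).e (P r))
    (h2 : ∀ r ∈ R, (V (κ r)).e (P r) = (V k).e (P r)) (h3 : (V l).e J = (V k).e J) :
    (tensMap (fun r hr => eqToHom (h1 r hr)) ≫ ((V l).m s h).hom) ≫ eqToHom h3 =
      tensMap (fun r hr => eqToHom (h2 r hr)) ≫ ((V k).m s h).hom := by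
  subst hl
  simp

/-- Coherence of the one valuation `V k`, transported along `κ r = k` and `κ' r' = k`: each block is
written with the valuation of its own label. -/
theorem Val.mix_coh (V : Γ → Val M S Λ) {R : Set Θ} {R' : Set Θ'} {Q : Θ → Set Θ'}
    {P : Θ → Set Λ} {P' : Θ' → Set Λ} {J : Set Λ} (κ : Θ → Γ) (κ' : Θ' → Γ) (k : Γ)
    (hκ : ∀ r ∈ R, κ r = k) (hκ' : ∀ r ∈ R', κ' r = k)
    (s : otype R ∈ S) (s' : otype R' ∈ S) (sQ : ∀ r ∈ R, otype (Q r) ∈ S) (hQ : IsPart R Q R')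
    (hP : ∀ r ∈ R, IsPart (Q r) P' (P r)) (h : IsPart R P J) (h' : IsPart R' P' J)
    (hQκ : ∀ r ∈ R, ∀ r' ∈ Q r, κ' r' = κ r) :
    tensMap (fun r hr => (Val.mix V (sQ r hr) (hP r hr) κ' (κ r) (hQκ r hr)).hom) ≫
        (Val.mix V s h κ k hκ).hom =
      (etaT M hQ fun r' => (V (κ' r')).e (P' r')).hom ≫ (Val.mix V s' h' κ' k hκ').hom := by
  have e1 := (V k).coh s sQ s' hQ hP h' h
  simp only [mix, Iso.trans_hom, tensIso_hom, eqToIso.hom]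
  rw [← etaT_naturality_assoc hQ (fun r hr => eqToHom (by rw [hκ' r hr])), ← e1,
    tensMap_comp_assoc, tensMap_comp_assoc]
  congr 1
  refine tensMap_congr fun r hr => ?_
  exact Val.m_eqToHom V _ _ (hκ r hr) _ _ _

variable (K : Set Γ) (L : Γ → Set Λ) (V : Γ → Val M S Λ)

/-- The object glued from valuations on the blocks of a partition. -/
def glueObj (J : Set Λ) : C := tens M K fun k => (V k).e (L k ∩ J)

variable {K L}

/-- A partition of `J` that refines the partition of `J` into the sets `L k ∩ J`. -/
structure Refines (K : Set Γ) (L : Γ → Set Λ) (R : Set Θ) (P : Θ → Set Λ) (κ : Θ → Γ)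
    (J : Set Λ) : Prop where
  fiber : IsPart K (fun k => {r | r ∈ R ∧ κ r = k}) R
  block : ∀ k ∈ K, IsPart {r | r ∈ R ∧ κ r = k} P (L k ∩ J)

/-- The comparison isomorphism of a refined partition. -/
def glueRefined (hS : IsIndexClass α S) {R : Set Θ} {P : Θ → Set Λ} {κ : Θ → Γ} {J : Set Λ}
    (s : otype R ∈ S) (h : Refines K L R P κ J) :
    tens M R (fun r => (V (κ r)).e (P r)) ≅ glueObj K L V J :=
  (etaT M h.fiber _).symm ≪≫ tensIso fun k hk =>
    Val.mix V (hS.otype_subset (fun _ hr => hr.1) s) (h.block k hk) κ k fun _ hr => hr.2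

theorem etaT_glueRefined (hS : IsIndexClass α S) {R : Set Θ} {P : Θ → Set Λ} {κ : Θ → Γ}
    {J : Set Λ} (s : otype R ∈ S) (h : Refines K L R P κ J) :
    (etaT M h.fiber _).hom ≫ (glueRefined V hS s h).hom =
      tensMap fun k hk => (Val.mix V (hS.otype_subset (fun _ hr => hr.1) s) (h.block k hk) κ k
        fun _ hr => hr.2).hom :=
  Iso.hom_inv_id_assoc _ _

/-- Independence of the refinement: the comparison of a finer `R'` factors through `R`. Over each
`k` this is coherence of `V k`, and `etaT_coherence` assembles the fibres. -/
theorem glueRefined_trans (hS : IsIndexClass α S) {R : Set Θ} {P : Θ → Set Λ} {κ : Θ → Γ}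
    {R' : Set Θ'} {P' : Θ' → Set Λ} {κ' : Θ' → Γ} {J : Set Λ} (s : otype R ∈ S)
    (s' : otype R' ∈ S) (h : Refines K L R P κ J) (h' : Refines K L R' P' κ' J)
    {Q : Θ → Set Θ'} (hQ : IsPart R Q R') (hP : ∀ r ∈ R, IsPart (Q r) P' (P r))
    (hκ : ∀ r ∈ R, ∀ r' ∈ Q r, κ' r' = κ r) (sQ : ∀ r ∈ R, otype (Q r) ∈ S) :
    tensMap (fun r hr => (Val.mix V (sQ r hr) (hP r hr) κ' (κ r) (hκ r hr)).hom) ≫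
        (glueRefined V hS s h).hom =
      (etaT M hQ fun r' => (V (κ' r')).e (P' r')).hom ≫ (glueRefined V hS s' h').hom := by
  have hN : ∀ k ∈ K, IsPart {r | r ∈ R ∧ κ r = k} Q {r' | r' ∈ R' ∧ κ' r' = k} := by
    refine fun k hk => hQ.mono_left (fun _ hr => hr.1) fun r' => ⟨?_, ?_⟩
    · rintro ⟨hr', rfl⟩
      obtain ⟨r, hr, h1⟩ := (hQ.mem r').1 hr'
      exact ⟨r, ⟨hr, (hκ r hr r' h1).symm⟩, h1⟩
    · rintro ⟨r, ⟨hr, rfl⟩, h1⟩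
      exact ⟨hQ.subset hr h1, hκ r hr r' h1⟩
  have e1 := etaT_coherence (M := M) h.fiber hN hQ h'.fiber fun r' => (V (κ' r')).e (P' r')
  have e2 := etaT_naturality (M := M) h.fiber fun r hr =>
    (Val.mix V (sQ r hr) (hP r hr) κ' (κ r) (hκ r hr)).hom
  rw [← cancel_epi (etaT M h.fiber _).hom, ← comp_eq_comp_assoc e2, etaT_glueRefined, ← comp_eq_comp_assoc e1,
    etaT_glueRefined]
  refine (tensMap_comp _ _).trans (Eq.trans ?_ (tensMap_comp _ _).symm)
  refine tensMap_congr fun k hk => ?_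
  exact Val.mix_coh V κ κ' k _ _ _ _ (fun r hr => sQ r hr.1) (hN k hk) (fun r hr => hP r hr.1) _ _
    fun r hr => hκ r hr.1

/-! ### Comparison isomorphisms of the glued valuation -/

section Comparison

variable {Γ' : Type w} [LinearOrder Γ'] [WellFoundedLT Γ'] [IsSmall α Γ'] {K' : Set Γ'}
  {L' : Γ' → Set Λ} {U J : Set Λ}

theorem Refines.overlap (h : IsPart K L U) (h' : IsPart K' L' J) {R : Set (Overlap K L K' L')}
    {J' : Set Λ} (h1 : ∀ k ∈ K, ∀ a ∈ L k, a ∈ J' → ∃ r ∈ R, r.fst = k ∧ a ∈ r.block)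
    (h2 : ∀ r ∈ R, r.block ⊆ J') : Refines K L R Overlap.block Overlap.fst J' where
  fiber := isPart_fiber (fun r _ => r.fst_mem) fun r _ s _ => Overlap.lt_of_fst_lt
  block := by
    refine fun k hk => Overlap.isPart h h' fun a => ⟨?_, ?_⟩
    · rintro ⟨ha, haJ⟩
      obtain ⟨r, hr, hrk, har⟩ := h1 k hk a ha haJ
      exact ⟨r, ⟨hr, hrk⟩, har⟩
    · rintro ⟨r, ⟨hr, rfl⟩, har⟩
      exact ⟨har.1, h2 r hr har⟩

theorem Refines.overlap_univ (h : IsPart K L U) (h' : IsPart K' L' J) :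
    Refines K L (Set.univ : Set (Overlap K L K' L')) Overlap.block Overlap.fst J := by
  refine Refines.overlap h h' (fun k hk a ha haJ => ?_) fun r _ a ha => h'.subset r.snd_mem ha.2
  obtain ⟨k', hk', hak'⟩ := (h'.mem a).1 haJ
  exact ⟨Overlap.mk hk hk' ha hak', trivial, rfl, ha, hak'⟩

theorem Refines.overlap_fiber (h : IsPart K L U) (h' : IsPart K' L' J) {k' : Γ'} (hk' : k' ∈ K') :
    Refines K L {r : Overlap K L K' L' | r ∈ Set.univ ∧ r.snd = k'} Overlap.block Overlap.fst
      (L' k') := by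
  refine Refines.overlap h h' (fun k hk a ha haJ => ?_) ?_
  · exact ⟨Overlap.mk hk hk' ha haJ, ⟨trivial, rfl⟩, rfl, ha, haJ⟩
  · rintro r ⟨-, rfl⟩ a ha
    exact ha.2

theorem Overlap.isPart_snd (h : IsPart K L U) (hJ : IsPart K' L' J) :
    IsPart K' (fun k' => {r : Overlap K L K' L' | r ∈ Set.univ ∧ r.snd = k'}) Set.univ :=
  isPart_fiber (fun r _ => r.snd_mem) fun _ _ _ _ => Overlap.lt_of_snd_lt h hJ

/-- The comparison isomorphism of a partition, for the glued valuation. -/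
def glueM (hS : IsIndexClass α S) (s : otype K ∈ S) (s' : otype K' ∈ S) (h : IsPart K L U)
    (h' : IsPart K' L' J) : tens M K' (fun k' => glueObj K L V (L' k')) ≅ glueObj K L V J :=
  have tΘ := Overlap.type_mem hS h h' s s'
  have : IsSmall α (Overlap K L K' L') := hS.isSmall tΘ
  have tR : ∀ R : Set (Overlap K L K' L'), otype R ∈ S := fun R =>
    hS.down (otype_le_type R) tΘ
  (tensIso fun _ hk' =>
      (glueRefined V hS (tR _) (Refines.overlap_fiber (K := K) (L := L) h h' hk')).symm) ≪≫
    etaT M (Overlap.isPart_snd h h') _ ≪≫ glueRefined V hS (tR _) (Refines.overlap_univ h h')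

theorem glueM_overlap (hS : IsIndexClass α S) (s : otype K ∈ S) (s' : otype K' ∈ S)
    (h : IsPart K L U) (h' : IsPart K' L' J) [IsSmall α (Overlap K L K' L')]
    (tR : ∀ R : Set (Overlap K L K' L'), otype R ∈ S) :
    tensMap (fun _ hk' =>
        (glueRefined V hS (tR _) (Refines.overlap_fiber (K := K) (L := L) h h' hk')).hom) ≫
        (glueM V hS s s' h h').hom =
      (etaT M (Overlap.isPart_snd h h') _).hom ≫
        (glueRefined V hS (tR _) (Refines.overlap_univ h h')).hom :=
  Iso.hom_inv_id_assoc (tensIso fun _ hk' =>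
    glueRefined V hS (tR _) (Refines.overlap_fiber (K := K) (L := L) h h' hk')) _

/-- `glueM` is defined by overlaps but may be computed on any admissible refinement of both
partitions with nonempty blocks. Coherence of the glued valuation rests on this freedom. -/
theorem glueM_refined (hS : IsIndexClass α S) (s : otype K ∈ S) (s' : otype K' ∈ S)
    (h : IsPart K L U) (h' : IsPart K' L' J) {R : Set Θ} {P : Θ → Set Λ} {κ : Θ → Γ}
    (sR : otype R ∈ S) {Q : Γ' → Set Θ} (hQ : IsPart K' Q R) (sQ : ∀ k' ∈ K', otype (Q k') ∈ S)
    (h1 : ∀ k' ∈ K', Refines K L (Q k') P κ (L' k')) (h2 : Refines K L R P κ J)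
    (hP : ∀ r ∈ R, (P r).Nonempty) :
    tensMap (fun k' hk' => (glueRefined V hS (sQ k' hk') (h1 k' hk')).hom) ≫
        (glueM V hS s s' h h').hom =
      (etaT M hQ fun r => (V (κ r)).e (P r)).hom ≫ (glueRefined V hS sR h2).hom := by
  have tΘ := Overlap.type_mem hS h h' s s'
  have : IsSmall α (Overlap K L K' L') := hS.isSmall tΘ
  have tR : ∀ R : Set (Overlap K L K' L'), otype R ∈ S := fun R =>
    hS.down (otype_le_type R) tΘ
  -- `W r` collects the indices of `R` whose blocks lie in the overlap `r`. As the blocks of `R` are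
  -- nonempty, each of their label pairs really is an overlap, so the sets `W r` exhaust `R`.
  let W : Overlap K L K' L' → Set Θ := fun r => {r' | r' ∈ Q r.snd ∧ κ r' = r.fst}
  have hW : IsPart Set.univ W R := by
    refine ⟨fun r' => ⟨fun hr' => ?_, ?_⟩, ?_⟩
    · obtain ⟨k', hk', hr''⟩ := (hQ.mem r').1 hr'
      obtain ⟨k, hk, -, rfl⟩ := (h2.fiber.mem r').1 hr'
      obtain ⟨a, ha⟩ := hP r' hr'
      have ha' := ((h1 k' hk').block _ hk).subset (k := r') ⟨hr'', rfl⟩ ha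
      exact ⟨Overlap.mk hk hk' ha'.1 ha'.2, trivial, hr'', rfl⟩
    · rintro ⟨r, -, hr, -⟩
      exact hQ.subset r.snd_mem hr
    · rintro r - t - hrt a ⟨ha, ha'⟩ b ⟨hb, hb'⟩
      rcases (Overlap.fst_mono hrt.le).lt_or_eq with h3 | h3
      · exact h2.fiber.lt _ r.fst_mem _ t.fst_mem h3 _ ⟨hQ.subset r.snd_mem ha, ha'⟩ _
          ⟨hQ.subset t.snd_mem hb, hb'⟩
      · rcases (Overlap.snd_mono h h' hrt.le).lt_or_eq with h4 | h4
        · exact hQ.lt _ r.snd_mem _ t.snd_mem h4 _ ha _ hb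
        · exact absurd (Overlap.ext h3 h4) hrt.ne
  have hWQ : ∀ k' ∈ K', IsPart {r : Overlap K L K' L' | r ∈ Set.univ ∧ r.snd = k'} W (Q k') := by
    refine fun k' hk' => hW.mono_left (fun _ hr => hr.1) fun r' => ⟨fun hr' => ?_, ?_⟩
    · obtain ⟨r, -, hr, hr''⟩ := (hW.mem r').1 (hQ.subset hk' hr')
      exact ⟨r, ⟨trivial, hQ.eq_of_mem r.snd_mem hk' hr hr'⟩, hr, hr''⟩
    · rintro ⟨r, ⟨-, rfl⟩, hr, -⟩
      exact hr
  have hWP : ∀ r : Overlap K L K' L', IsPart (W r) P r.block := fun r =>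
    (h1 _ r.snd_mem).block _ r.fst_mem
  have sW : ∀ r : Overlap K L K' L', otype (W r) ∈ S := fun r =>
    hS.otype_subset (fun _ hr => hr.1) (sQ _ r.snd_mem)
  have e1 := glueRefined_trans V hS (tR _) sR (Refines.overlap_univ h h') h2 hW
    (fun r _ => hWP r) (fun r _ r' hr' => hr'.2) (fun r _ => sW r)
  have e2 : ∀ k' (hk' : k' ∈ K'), _ := fun k' hk' =>
    glueRefined_trans V hS (tR _) (sQ k' hk') (Refines.overlap_fiber h h' hk') (h1 k' hk')
      (hWQ k' hk') (fun r _ => hWP r) (fun r _ r' hr' => hr'.2) (fun r _ => sW r)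
  have e3 := etaT_coherence (M := M) (Overlap.isPart_snd h h') hWQ hW hQ fun r => (V (κ r)).e (P r)
  have e4 := isIso_tensMap (M := M)
    (fun k' hk' => (etaT M (hWQ k' hk') fun r => (V (κ r)).e (P r)).hom) fun _ _ => inferInstance
  rw [← cancel_epi (tensMap fun k' hk' => (etaT M (hWQ k' hk') fun r => (V (κ r)).e (P r)).hom),
    comp_eq_comp_assoc e3, ← e1, tensMap_comp_assoc]
  have e5 : tensMap (M := M) (fun k' hk' =>
        (etaT M (hWQ k' hk') fun r => (V (κ r)).e (P r)).hom ≫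
          (glueRefined V hS (sQ k' hk') (h1 k' hk')).hom) = _ :=
    (tensMap_congr fun k' hk' => (e2 k' hk').symm).trans (tensMap_comp _ _).symm
  rw [e5, Category.assoc, glueM_overlap V hS s s' h h' tR]
  exact etaT_naturality_assoc (M := M) (Overlap.isPart_snd h h') (fun r _ =>
    (Val.mix V (sW r) (hWP r) κ r.fst fun r' hr' => hr'.2).hom) _

/-- The valuation glued from valuations on the blocks of a partition. -/
def glueVal (hS : IsIndexClass α S) (s : otype K ∈ S) (h : IsPart K L U) : Val M S Λ where
  e := glueObj K L V
  m s' h' := glueM V hS s s' h h'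
  coh {Γ' Δ} _ _ _ _ _ _ D Q K' N L' J sD sQ sK hQ hN hL hJ := by
    have tΘ := Overlap.type_mem hS h hL s sK
    have : IsSmall α (Overlap K L K' L') := hS.isSmall tΘ
    have tR : ∀ R : Set (Overlap K L K' L'), otype R ∈ S := fun R =>
      hS.down (otype_le_type R) tΘ
    -- Overlaps with the finest partition `L'`, grouped by `d`, refine every `N d` as well. All
    -- comparison isomorphisms in the coherence square are computed on this one refinement.
    let W : Δ → Set (Overlap K L K' L') := fun d => {r | r.snd ∈ Q d}
    have hW : ∀ d ∈ D, Refines K L (W d) Overlap.block Overlap.fst (N d) := by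
      refine fun d hd => Refines.overlap h hL (fun k hk a ha haN => ?_) fun r hr a ha =>
        (hN d hd).subset hr ha.2
      obtain ⟨k', hk', hak'⟩ := ((hN d hd).mem a).1 haN
      exact ⟨Overlap.mk hk (hQ.subset hd hk') ha hak', hk', rfl, ha, hak'⟩
    have hDW : IsPart D W Set.univ := by
      refine ⟨fun r => ⟨fun _ => ?_, fun _ => trivial⟩, fun d hd d' hd' hdd r hr r' hr' => ?_⟩
      · obtain ⟨d, hd, hr⟩ := (hQ.mem _).1 r.snd_mem
        exact ⟨d, hd, hr⟩
      · exact Overlap.lt_of_snd_lt h hL (hQ.lt d hd d' hd' hdd _ hr _ hr')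
    have hWd : ∀ d ∈ D, IsPart (Q d)
        (fun k' => {r : Overlap K L K' L' | r ∈ Set.univ ∧ r.snd = k'}) (W d) := by
      refine fun d hd => (Overlap.isPart_snd h hL).mono_left (hQ.subset hd) fun r =>
        ⟨fun hr => ?_, ?_⟩
      · exact ⟨r.snd, hr, trivial, rfl⟩
      · rintro ⟨_, hk', -, rfl⟩
        exact hk'
    have e1 := glueM_refined V hS s sD h hJ (tR _) hDW (fun d _ => tR (W d)) hW
      (Refines.overlap_univ h hL) fun r _ => r.block_nonempty
    have e2 : ∀ d (hd : d ∈ D), _ := fun d hd =>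
      glueM_refined V hS s (sQ d hd) h (hN d hd) (tR _) (hWd d hd) (fun k' _ => tR _)
      (fun k' hk' => Refines.overlap_fiber h hL (hQ.subset hd hk')) (hW d hd)
      fun r _ => r.block_nonempty
    have e3 := glueM_overlap V hS s sK h hL tR
    let f : ∀ k' ∈ K', _ ⟶ glueObj K L V (L' k') := fun k' hk' =>
      (glueRefined V hS (tR _) (Refines.overlap_fiber (K := K) (L := L) h hL hk')).hom
    have e4 : tensMap (M := M) (fun d hd => (tensMap fun k' hk' => f k' (hQ.mem_of_mem hd hk')) ≫
        (glueM V hS s (sQ d hd) h (hN d hd)).hom) = _ :=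
      (tensMap_congr fun d hd => e2 d hd).trans (tensMap_comp _ _).symm
    have e5 := isIso_tensMap (M := M) (fun d hd => tensMap fun k' hk' =>
      f k' (hQ.mem_of_mem hd hk')) fun d hd => isIso_tensMap (M := M) _ fun _ _ => inferInstance
    rw [← cancel_epi (tensMap fun d hd => tensMap fun k' hk' => f k' (hQ.mem_of_mem hd hk')),
      etaT_naturality_assoc hQ f, e3, tensMap_comp_assoc, e4, Category.assoc, e1,
      comp_eq_comp_assoc (etaT_coherence hQ hWd (Overlap.isPart_snd h hL) hDW _)]

/-- By induction along the generation of `U`: a tensor valuation on a point, pulled back by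
membership, serves a singleton, and `glueVal` serves a sum. -/
theorem Good.exists_val (hS : IsIndexClass α S) {U : Set Λ} (hU : Good α S U) (x : Λ → C) :
    ∃ V : Val M S Λ, ∀ a ∈ U, Nonempty (V.e {a} ≅ x a) := by
  induction hU with
  | singleton a =>
    have := hS.isSmall_punit
    refine ⟨(tensVal S fun _ : PUnit.{w + 1} => x a).comap (fun J => {_p | a ∈ J})
      (isPart_point a), ?_⟩
    rintro b rfl
    have key : ∀ J : Set PUnit.{w + 1}, J = {PUnit.unit} →
        Nonempty (tens M J (fun _ => x b) ≅ x b) := by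
      rintro _ rfl
      exact ⟨sing PUnit.unit fun _ => x b⟩
    exact key _ (Set.ext fun _ => ⟨fun _ => rfl, fun _ => rfl⟩)
  | @part Γ _ _ _ K L U s h _ ih =>
    have h0 : IsSmall α PEmpty.{w + 1} := hS.isSmall
      (hS.down (Ordinal.type_eq_zero_iff_isEmpty.2 inferInstance).le
        (hS.down zero_le_one hS.one_mem))
    -- Gluing takes a valuation for every index in `Γ`. Outside `K` the valuation of the empty
    -- family, pulled back along the constant map to `∅`, is a harmless default.
    have hV : ∀ k, ∃ V : Val M S Λ, k ∈ K → ∀ a ∈ L k, Nonempty (V.e {a} ≅ x a) := by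
      intro k
      by_cases hk : k ∈ K
      · obtain ⟨V, hV⟩ := ih k hk
        exact ⟨V, fun _ => hV⟩
      · exact ⟨(tensVal S (PEmpty.elim : PEmpty.{w + 1} → C)).comap (fun _ => ∅)
          fun _ => ⟨fun a => a.elim, fun _ _ _ _ _ a => a.elim⟩, fun h => absurd h hk⟩
    choose V hV using hV
    refine ⟨glueVal V hS s h, fun a ha => ?_⟩
    obtain ⟨k, hk, hak⟩ := (h.mem a).1 ha
    obtain ⟨i⟩ := hV k hk a hak
    have hR : Refines K L {k} (fun _ => {a}) (fun k => k) {a} := by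
      refine ⟨isPart_fiber (by rintro _ rfl; exact hk) (by rintro _ rfl _ rfl h; exact h),
        fun l hl => ⟨fun b => ⟨?_, ?_⟩, ?_⟩⟩
      · rintro ⟨hb, rfl⟩
        exact ⟨k, ⟨rfl, h.eq_of_mem hk hl hak hb⟩, rfl⟩
      · rintro ⟨_, ⟨rfl, rfl⟩, rfl⟩
        exact ⟨hak, rfl⟩
      · rintro _ ⟨rfl, -⟩ _ ⟨rfl, -⟩ h
        exact absurd h (lt_irrefl _)
    exact ⟨(glueRefined V hS (hS.otype_singleton k) hR).symm ≪≫ sing k _ ≪≫ i⟩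

end Comparison

end Glue

/-! ### Extension of valuations to all partitions -/

section Extend

variable {hα : (Ordinal.omega0.{w} : WithTop Ordinal.{w}) ≤ α}
  {C : Type u} [Category.{v} C] {M : UnbiasedMonoidal hα C} {S : Set Ordinal.{w}}
  {Λ Γ : Type w} [LinearOrder Λ] [LinearOrder Γ] [WellFoundedLT Γ] [IsSmall α Γ]

/-- The union of the blocks of a set of indices. -/
def blockUnion {Γ Λ : Type w} (L : Γ → Set Λ) (K : Set Γ) : Set Λ := {a | ∃ k ∈ K, a ∈ L k}

section

variable {Δ : Type w} [LinearOrder Δ] {K : Set Γ} {L : Γ → Set Λ} {J : Set Λ}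

theorem IsPart.eq_blockUnion (h : IsPart K L J) : J = blockUnion L K := Set.ext h.mem

theorem IsPart.blockUnion_subset (h : IsPart K L J) {K' : Set Γ} (hK : K' ⊆ K) :
    IsPart K' L (blockUnion L K') :=
  h.mono_left hK fun _ => Iff.rfl

theorem IsPart.comp (h : IsPart K L J) {E : Set Δ} {P : Δ → Set Γ} (hP : IsPart E P K) :
    IsPart E (fun ε => blockUnion L (P ε)) J where
  mem a := by
    rw [h.mem]
    constructor
    · rintro ⟨k, hk, ha⟩
      obtain ⟨ε, hε, hk'⟩ := (hP.mem k).1 hk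
      exact ⟨ε, hε, k, hk', ha⟩
    · rintro ⟨ε, hε, k, hk, ha⟩
      exact ⟨k, hP.subset hε hk, ha⟩
  lt := by
    rintro ε hε ε' hε' hlt a ⟨k, hk, ha⟩ b ⟨l, hl, hb⟩
    exact h.lt k (hP.subset hε hk) l (hP.subset hε' hl) (hP.lt ε hε ε' hε' hlt k hk l hl) a ha b hb

/-- The intersection with `K` makes block unions preserve partitions of arbitrary subsets of `Γ`,
although the sets `L k` are known to be ordered only for `k ∈ K`; `Val.comap` requires this. -/
theorem IsPart.comap_blockUnion (h : IsPart K L J) {E : Set Δ} {P : Δ → Set Γ} {K' : Set Γ}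
    (hP : IsPart E P K') :
    IsPart E (fun ε => blockUnion L (P ε ∩ K)) (blockUnion L (K' ∩ K)) := by
  refine (h.blockUnion_subset Set.inter_subset_right).comp ⟨fun k => ?_, fun ε hε ε' hε' hlt k hk l hl =>
    hP.lt ε hε ε' hε' hlt k hk.1 l hl.1⟩
  constructor
  · rintro ⟨hk, hk'⟩
    obtain ⟨ε, hε, hkε⟩ := (hP.mem k).1 hk
    exact ⟨ε, hε, hkε, hk'⟩
  · rintro ⟨ε, hε, hk, hk'⟩
    exact ⟨hP.subset hε hk, hk'⟩

end

/-- Comparison isomorphisms ignore the blocks outside `K`. Splitting `K` into singletons, coherence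
expresses both sides through one-block comparisons, which `m_singleton_eq` computes. -/
theorem Val.m_congr (hS : IsIndexClass α S) (V : Val M S Λ) {K : Set Γ} {L L' : Γ → Set Λ}
    {J : Set Λ} (s : otype K ∈ S) (h : IsPart K L J) (h' : IsPart K L' J)
    (hL : ∀ k ∈ K, L k = L' k) :
    tensMap (fun k hk => eqToHom (congrArg V.e (hL k hk))) ≫ (V.m s h').hom = (V.m s h).hom := by
  have hQ : IsPart K (fun k => {k}) K :=
    ⟨fun k => by simp, by rintro k - l - h _ rfl _ rfl; exact h⟩
  have hN : ∀ k ∈ K, IsPart {k} L (L' k) := fun k hk => hL k hk ▸ isPart_singleton k L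
  have e1 := V.coh s (fun k _ => hS.otype_singleton k) s hQ (fun k _ => isPart_singleton k L) h h
  have e2 := V.coh s (fun k _ => hS.otype_singleton k) s hQ hN h h'
  have e3 := isIso_tensMap (M := M)
    (fun k (hk : k ∈ K) => (V.m (hS.otype_singleton k) (isPart_singleton k L)).hom)
    fun _ _ => inferInstance
  rw [← cancel_epi (tensMap fun k (hk : k ∈ K) =>
    (V.m (hS.otype_singleton k) (isPart_singleton k L)).hom), e1, ← e2, tensMap_comp_assoc]
  congr 1
  refine tensMap_congr fun k hk => ?_
  rw [V.m_singleton_eq k _ L (hN k hk) (hL k hk), V.m_singleton]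

/-- The comparison morphisms of a partition and of all its parts. -/
structure ExtOn (V : Val M S Λ) (K : Set Γ) (L : Γ → Set Λ) where
  /-- the comparison morphisms -/
  app : ∀ {K' : Set Γ} {J : Set Λ}, K' ⊆ K → IsPart K' L J →
    (tens M K' (fun k => V.e (L k)) ⟶ V.e J)
  single : ∀ {k : Γ} (hk : {k} ⊆ K) {J : Set Λ} (s : otype {k} ∈ S) (h : IsPart {k} L J),
    app hk h = (V.m s h).hom
  comm : ∀ {Δ : Type w} [LinearOrder Δ] [WellFoundedLT Δ] [IsSmall α Δ] {E : Set Δ}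
    {P : Δ → Set Γ} {K' : Set Γ} {N : Δ → Set Λ} {J : Set Λ} (s : otype E ∈ S) (hK : K' ⊆ K)
    (hP : IsPart E P K') (hN : ∀ ε ∈ E, IsPart (P ε) L (N ε)) (h : IsPart K' L J)
    (hJ : IsPart E N J),
    (etaT M hP _).hom ≫ app hK h =
      tensMap (fun ε hε => app ((hP.subset hε).trans hK) (hN ε hε)) ≫ (V.m s hJ).hom

/-- Values at single indices are fixed by `single` and `comm` propagates them along the generation
of `K`, so extensions built on different ambient sets agree. -/
theorem ExtOn.unique (hS : IsIndexClass α S) {V : Val M S Λ} {K₁ K₂ : Set Γ} {L : Γ → Set Λ}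
    (f : ExtOn V K₁ L) (g : ExtOn V K₂ L) {K : Set Γ} (hK : Good α S K) {J : Set Λ} (h₁ : K ⊆ K₁)
    (h₂ : K ⊆ K₂) (h : IsPart K L J) : f.app h₁ h = g.app h₂ h := by
  induction hK generalizing J with
  | singleton k => rw [f.single _ (hS.otype_singleton k), g.single _ (hS.otype_singleton k)]
  | part s hp _ ih =>
    have hN := fun ε hε => h.blockUnion_subset (hp.subset (k := ε) hε)
    rw [← cancel_epi (etaT M hp _).hom, f.comm s h₁ hp hN h (h.comp hp),
      g.comm s h₂ hp hN h (h.comp hp)]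
    congr 1
    exact tensMap_congr fun ε hε => ih ε hε _ _ _

theorem ExtOn.isIso (hS : IsIndexClass α S) {V : Val M S Λ} {K₁ : Set Γ} {L : Γ → Set Λ}
    (f : ExtOn V K₁ L) {K : Set Γ} (hK : Good α S K) {J : Set Λ} (h₁ : K ⊆ K₁)
    (h : IsPart K L J) : IsIso (f.app h₁ h) := by
  induction hK generalizing J with
  | singleton k =>
    rw [f.single _ (hS.otype_singleton k)]
    infer_instance
  | part s hp _ ih =>
    have hN := fun ε hε => h.blockUnion_subset (hp.subset (k := ε) hε)
    have h1 := isIso_tensMap (M := M) (fun ε hε => f.app ((hp.subset hε).trans h₁) (hN ε hε))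
      fun ε hε => ih ε hε _ _
    rw [← isIso_comp_left_iff (etaT M hp _).hom, f.comm s h₁ hp hN h (h.comp hp)]
    infer_instance

/-- Both the tensor product of the `V.e (L k)` over `K'` and the value of the union of these blocks
are valuations in the variable `K' ⊆ Γ`. They agree at singletons by `sing`, and the morphism given
by `Good.exists_hom` is the wanted family. -/
theorem exists_extOn (hS : IsIndexClass α S) (V : Val M S Λ) {K : Set Γ} (hK : Good α S K)
    {L : Γ → Set Λ} {J : Set Λ} (h : IsPart K L J) : Nonempty (ExtOn V K L) := by
  have hΦ : ∀ {K' : Set Γ}, K' ⊆ K → ∀ {J' : Set Λ}, IsPart K' L J' →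
      blockUnion L (K' ∩ K) = J' := by
    intro K' hK' J' h'
    rw [Set.inter_eq_left.2 hK', ← h'.eq_blockUnion]
  obtain ⟨ξ, hξ⟩ := hK.exists_hom hS (tensVal S fun k => V.e (L k))
    (V.comap (fun K' => blockUnion L (K' ∩ K)) h.comap_blockUnion) fun k hk =>
      (sing k fun k => V.e (L k)).hom ≫
        eqToHom (congrArg V.e (hΦ (Set.singleton_subset_iff.2 hk) (isPart_singleton k L)).symm)
  -- The same morphism, with the values of `tensVal` and `comap` unfolded so that later rewrites
  -- apply.
  obtain ⟨f, hf, hf'⟩ : ∃ f : ∀ K', K' ⊆ K →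
      (tens M K' (fun k => V.e (L k)) ⟶ V.e (blockUnion L (K' ∩ K))),
      (∀ k (hk : k ∈ K), f {k} (Set.singleton_subset_iff.2 hk) = (sing k fun k => V.e (L k)).hom ≫
        eqToHom (congrArg V.e (hΦ (Set.singleton_subset_iff.2 hk) (isPart_singleton k L)).symm)) ∧
      ∀ {Δ : Type w} [LinearOrder Δ] [WellFoundedLT Δ] [IsSmall α Δ] {E : Set Δ}
        {P : Δ → Set Γ} {K' : Set Γ} (s : otype E ∈ S) (hP : IsPart E P K') (hK' : K' ⊆ K),
        (etaT M hP fun k => V.e (L k)).hom ≫ f K' hK' =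
          tensMap (fun ε hε => f (P ε) ((hP.subset hε).trans hK')) ≫
            (V.m s (h.comap_blockUnion hP)).hom :=
    ⟨ξ.app, hξ, fun s hP hK' => ξ.comm s hP hK'⟩
  refine ⟨⟨fun hK' h' => f _ hK' ≫ eqToHom (congrArg V.e (hΦ hK' h')), ?_, ?_⟩⟩
  · intro k hk J' s h'
    rw [hf k (hk rfl), V.m_singleton_eq k s L h' h'.eq_of_singleton]
    simp
  · intro Δ _ _ _ E P K' N J' s hK' hP hN h' hJ
    obtain rfl := hΦ hK' h'
    have e2 := V.m_congr hS s (h.comap_blockUnion hP) hJ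
      fun ε hε => hΦ ((hP.subset hε).trans hK') (hN ε hε)
    rw [eqToHom_refl, Category.comp_id, hf' s hP hK', ← tensMap_comp_assoc, e2]

/-- The comparison morphism of an arbitrary small partition. -/
def extM (hS : IsIndexClass α S) (V : Val M S Λ) {K : Set Γ} (hK : Good α S K)
    {L : Γ → Set Λ} {J : Set Λ} (h : IsPart K L J) : tens M K (fun k => V.e (L k)) ⟶ V.e J :=
  (exists_extOn hS V hK h).some.app subset_rfl h

theorem extM_singleton (hS : IsIndexClass α S) (V : Val M S Λ) {k : Γ} (hK : Good α S {k})
    {L : Γ → Set Λ} {J : Set Λ} (h : IsPart {k} L J) :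
    extM hS V hK h = (V.m (hS.otype_singleton k) h).hom :=
  ExtOn.single _ _ _ _

/-- `extM` chooses an extension separately for each index set. By uniqueness the choice for `K`,
restricted to `P ε`, is the choice for `P ε`. -/
theorem extM_comm (hS : IsIndexClass α S) (V : Val M S Λ) {Δ : Type w} [LinearOrder Δ]
    [WellFoundedLT Δ] [IsSmall α Δ] {E : Set Δ} {P : Δ → Set Γ} {K : Set Γ} {N : Δ → Set Λ}
    {J : Set Λ} {L : Γ → Set Λ} (s : otype E ∈ S) (hK : Good α S K)
    (hKP : ∀ ε ∈ E, Good α S (P ε)) (hP : IsPart E P K)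
    (hN : ∀ ε ∈ E, IsPart (P ε) L (N ε)) (h : IsPart K L J) (hJ : IsPart E N J) :
    (etaT M hP _).hom ≫ extM hS V hK h =
      tensMap (fun ε hε => extM hS V (hKP ε hε) (hN ε hε)) ≫ (V.m s hJ).hom := by
  refine ((exists_extOn hS V hK h).some.comm s subset_rfl hP hN h hJ).trans ?_
  congr 1
  exact tensMap_congr fun ε hε => ExtOn.unique hS _ _ (hKP ε hε) _ _ _

/-- Induction along the generation of the outer index set. A partition of `D'` of type in `S`
induces one of `K` by unions, and `extM_comm` for both reduces the square to the parts; for one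
index it is naturality of `sing`. -/
theorem extM_coh (hS : IsIndexClass α S) (V : Val M S Λ) {Δ : Type w} [LinearOrder Δ]
    [WellFoundedLT Δ] [IsSmall α Δ] {D : Set Δ} {Q : Δ → Set Γ} {N : Δ → Set Λ} {L : Γ → Set Λ}
    (hG : ∀ K : Set Γ, Good α S K) (hG' : ∀ K : Set Δ, Good α S K)
    (hN : ∀ d ∈ D, IsPart (Q d) L (N d)) {D' : Set Δ} (hD : Good α S D') (hD' : D' ⊆ D)
    {K : Set Γ} {J : Set Λ} (hQ : IsPart D' Q K) (hL : IsPart K L J) (hJ : IsPart D' N J) :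
    tensMap (fun d hd => extM hS V (hG _) (hN d (hD' hd))) ≫ extM hS V (hG' _) hJ =
      (etaT M hQ fun k => V.e (L k)).hom ≫ extM hS V (hG _) hL := by
  induction hD generalizing K J with
  | singleton d =>
    have hd : d ∈ D := hD' rfl
    obtain rfl := hQ.eq_of_singleton
    obtain rfl := hJ.eq_of_singleton
    have e1 := (tensVal (M := M) S fun k => V.e (L k)).m_singleton d (hS.otype_singleton d) Q
    rw [extM_singleton, V.m_singleton]
    refine (sing_naturality (M := M) d fun _ hd' => extM hS V (hG _) (hN _ (hD' hd'))).trans ?_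
    refine Eq.trans ?_ (congrArg (· ≫ _) e1.symm)
    rfl
  | @part Ξ _ _ _ E P D' s hp _ ih =>
    have hNP := fun ε hε => hJ.blockUnion_subset (hp.subset (k := ε) hε)
    have hQP := fun ε hε => hQ.blockUnion_subset (hp.subset (k := ε) hε)
    have hLP : ∀ ε ∈ E, IsPart (blockUnion Q (P ε)) L (blockUnion N (P ε)) := by
      refine fun ε hε => hL.mono_left (?_) fun a => ⟨?_, ?_⟩
      · rintro k ⟨d, hd, hk⟩
        exact hQ.subset (hp.subset hε hd) hk
      · rintro ⟨d, hd, ha⟩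
        obtain ⟨k, hk, hak⟩ := ((hN d (hD' (hp.subset hε hd))).mem a).1 ha
        exact ⟨k, ⟨d, hd, hk⟩, hak⟩
      · rintro ⟨k, ⟨d, hd, hk⟩, ha⟩
        exact ⟨d, hd, (hN d (hD' (hp.subset hε hd))).subset hk ha⟩
    have e1 := extM_comm hS V s (hG' D') (fun ε _ => hG' (P ε)) hp hNP hJ (hJ.comp hp)
    have e2 := extM_comm hS V s (hG K) (fun ε _ => hG (blockUnion Q (P ε))) (hQ.comp hp) hLP hL
      (hJ.comp hp)
    have e3 := etaT_coherence (M := M) hp hQP hQ (hQ.comp hp) fun k => V.e (L k)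
    rw [← cancel_epi (etaT M hp _).hom, ← etaT_naturality_assoc hp, e1, ← comp_eq_comp_assoc e3, e2,
      tensMap_comp_assoc, tensMap_comp_assoc]
    congr 1
    exact tensMap_congr fun ε hε => ih ε hε ((hp.subset hε).trans hD') _ _ _

/-- The extension of a valuation to all small partitions. -/
def Val.extend (hS : IsIndexClass α S) (V : Val M S Λ)
    (hG : ∀ {Γ : Type w} [LinearOrder Γ] [WellFoundedLT Γ] [IsSmall α Γ] (K : Set Γ),
      Good α S K) : Val M Set.univ Λ where
  e := V.e
  m _ h :=
    have : IsIso (extM hS V (hG _) h) := ExtOn.isIso hS _ (hG _) _ _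
    asIso (extM hS V (hG _) h)
  coh _ _ _ hQ hN hL hJ := extM_coh hS V hG hG hN (hG _) subset_rfl hQ hL hJ

/-- A morphism of valuations is compatible with all small partitions. -/
def HomOn.extend (hS : IsIndexClass α S)
    (hG : ∀ {Γ : Type w} [LinearOrder Γ] [WellFoundedLT Γ] [IsSmall α Γ] (K : Set Γ),
      Good α S K) {V V' : Val M Set.univ Λ} {U : Set Λ}
    (ξ : HomOn (V.restrict (Set.subset_univ S)) (V'.restrict (Set.subset_univ S)) U) :
    HomOn V V' U where
  app := ξ.app
  comm {Γ} _ _ _ K L J _ h hJ := by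
    obtain ⟨f, hf, hξ⟩ : ∃ f : ∀ J, J ⊆ U → (V.e J ⟶ V'.e J), ξ.app = f ∧
        ∀ {Γ : Type w} [LinearOrder Γ] [WellFoundedLT Γ] [IsSmall α Γ] {K : Set Γ}
          {L : Γ → Set Λ} {J : Set Λ} (s : otype K ∈ S) (h : IsPart K L J) (hJ : J ⊆ U),
          (V.m (Set.mem_univ _) h).hom ≫ f J hJ =
            tensMap (fun k hk => f (L k) ((h.subset hk).trans hJ)) ≫
              (V'.m (Set.mem_univ _) h).hom :=
      ⟨ξ.app, rfl, ξ.comm⟩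
    -- Every small index set is good, so compatibility with partitions of type in `S` propagates
    -- along its generation.
    have key : ∀ {K : Set Γ} (hK : Good α S K) {J : Set Λ} (h : IsPart K L J) (hJ : J ⊆ U),
        (V.m (Set.mem_univ _) h).hom ≫ f J hJ =
          tensMap (fun k hk => f (L k) ((h.subset hk).trans hJ)) ≫
            (V'.m (Set.mem_univ _) h).hom := by
      intro K hK
      induction hK with
      | singleton k => exact fun h hJ => hξ (hS.otype_singleton k) h hJ
      | @part Ξ _ _ _ E P K s hp _ ih =>
        intro J h hJ
        have hN := fun ε hε => h.blockUnion_subset (hp.subset (k := ε) hε)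
        have e1 := V.coh (Set.mem_univ _) (fun _ _ => Set.mem_univ _) (Set.mem_univ _) hp hN h
          (h.comp hp)
        have e2 := V'.coh (Set.mem_univ _) (fun _ _ => Set.mem_univ _) (Set.mem_univ _) hp hN h
          (h.comp hp)
        rw [← cancel_epi (etaT M hp _).hom, ← comp_eq_comp_assoc e1,
          ← etaT_naturality_assoc hp fun k hk => f (L k) ((h.subset hk).trans hJ), ← e2,
          hξ s (h.comp hp) hJ, tensMap_comp_assoc, tensMap_comp_assoc]
        refine congrArg (· ≫ _) (tensMap_congr fun ε hε => ?_)
        exact ih ε hε (hN ε hε) _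
    have := key (hG K) h hJ
    rw [← hf] at this
    exact this

end Extend

/-! ### Ordinals bounded by an initial ordinal below `α` -/

section Index

open Cardinal

/-- The ordinals which are at most some initial ordinal below `α`. -/
def indexClass (α : WithTop Ordinal.{w}) : Set Ordinal.{w} :=
  {o | ∃ c : Cardinal.{w}, ((c.ord : Ordinal.{w}) : WithTop Ordinal.{w}) < α ∧ o ≤ c.ord}

variable {Γ Θ Λ Ω : Type w} [LinearOrder Γ] [WellFoundedLT Γ] [LinearOrder Θ] [WellFoundedLT Θ]
  [LinearOrder Λ] [LinearOrder Ω]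

theorem type_mem_indexClass_of_finite (hα : (Ordinal.omega0.{w} : WithTop Ordinal.{w}) ≤ α)
    (h : #Θ < ℵ₀) : Ordinal.type ((· < ·) : Θ → Θ → Prop) ∈ indexClass α := by
  refine ⟨#Θ, lt_of_lt_of_le (WithTop.coe_lt_coe.2 ?_) hα, ?_⟩
  · rw [← ord_aleph0]
    exact ord_lt_ord.2 h
  · rw [Cardinal.le_ord_iff_card_le_of_lt_aleph0 _ h, Ordinal.card_type]

/-- Proper initial segments of an initial ordinal have smaller cardinality, and for infinite `c`
adding the endpoint does no harm. -/
theorem mk_Iic_lt {K : Set Γ} {c : Cardinal.{w}} (hc : ℵ₀ ≤ c) (h : otype K ≤ c.ord) (k : K) :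
    #(Set.Iic k) < c := by
  have h1 : #(Set.Iio k) < c := by
    have h2 := lt_ord.1 ((Ordinal.typein_lt_type ((· < ·) : K → K → Prop) k).trans_le h)
    rwa [Ordinal.card_typein] at h2
  rw [← Set.Iio_insert]
  exact (mk_insert_le).trans_lt (add_lt_of_lt hc h1 (one_lt_aleph0.trans_le hc))

/-- A longer chain would have an element `r` with exactly `c` predecessors. These inject into the
product of the initial segments up to `f r` and `g r`, whose cardinality is `< c`. -/
theorem type_le_ord_of_chain {Γ' : Type w} [LinearOrder Γ'] [WellFoundedLT Γ'] {K : Set Γ}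
    {K' : Set Γ'} (f : Θ → K) (g : Θ → K') (hf : Monotone f) (hg : Monotone g)
    (hfg : Function.Injective fun r => (f r, g r)) {c : Cardinal.{w}} (hc : ℵ₀ ≤ c)
    (h : otype K ≤ c.ord) (h' : otype K' ≤ c.ord) :
    Ordinal.type ((· < ·) : Θ → Θ → Prop) ≤ c.ord := by
  by_contra! hlt
  obtain ⟨r, hr⟩ := Ordinal.typein_surj ((· < ·) : Θ → Θ → Prop) hlt
  have h1 : #(Set.Iio r) = c := by
    have h2 := congrArg Ordinal.card hr
    rwa [Ordinal.card_typein, card_ord] at h2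
  have h2 : #(Set.Iio r) ≤ #(Set.Iic (f r) × Set.Iic (g r)) := by
    refine mk_le_of_injective
      (f := fun s : Set.Iio r => (⟨f s, hf s.2.le⟩, ⟨g s, hg s.2.le⟩)) fun s t hst => ?_
    refine Subtype.ext (hfg (Prod.ext ?_ ?_))
    · exact congrArg (fun x => (x.1 : K)) hst
    · exact congrArg (fun x => (x.2 : K')) hst
  rw [h1, mk_prod, lift_id, lift_id] at h2
  exact h2.not_gt (mul_lt_of_lt hc (mk_Iic_lt hc h _) (mk_Iic_lt hc h' _))

/-- Initial ordinals replace `α` because boundedness by one of them survives common refinement. Two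
finite bounds give a finite chain; otherwise the larger bound is infinite and serves again. -/
theorem isIndexClass (hα : (Ordinal.omega0.{w} : WithTop Ordinal.{w}) ≤ α) :
    IsIndexClass α (indexClass α) where
  down := fun hab ⟨c, hc, hb⟩ => ⟨c, hc, hab.trans hb⟩
  one_mem := ⟨1, by
    rw [ord_one]
    exact lt_of_lt_of_le (WithTop.coe_lt_coe.2 Ordinal.one_lt_omega0) hα, by rw [ord_one]⟩
  lt := fun ⟨c, hc, ha⟩ => lt_of_le_of_lt (WithTop.coe_le_coe.2 ha) hc
  chain := by
    rintro Θ Γ Γ' _ _ _ _ _ _ K K' f g hf hg hfK hgK hfg ⟨c, hc, h⟩ ⟨c', hc', h'⟩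
    have hfg' : Function.Injective fun r => ((⟨f r, hfK r⟩ : K), (⟨g r, hgK r⟩ : K')) := by
      intro r s hrs
      refine hfg (Prod.ext ?_ ?_)
      · exact congrArg (fun x => (x.1 : Γ)) hrs
      · exact congrArg (fun x => (x.2 : Γ')) hrs
    rcases lt_or_ge (max c c') ℵ₀ with hcc | hcc
    · refine type_mem_indexClass_of_finite hα ((mk_le_of_injective hfg').trans_lt ?_)
      rw [mk_prod, lift_id, lift_id]
      refine mul_lt_aleph0 ?_ ?_
      · rw [← Ordinal.card_type ((· < ·) : K → K → Prop)]
        exact (card_le_of_le_ord h).trans_lt ((le_max_left _ _).trans_lt hcc)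
      · rw [← Ordinal.card_type ((· < ·) : K' → K' → Prop)]
        exact (card_le_of_le_ord h').trans_lt ((le_max_right _ _).trans_lt hcc)
    · refine ⟨max c c', ?_, type_le_ord_of_chain _ _ (fun r s hrs => hf hrs) (fun r s hrs => hg hrs)
        hfg' hcc (h.trans (ord_le_ord.2 (le_max_left _ _)))
        (h'.trans (ord_le_ord.2 (le_max_right _ _)))⟩
      -- The maximum is one of the two bounds, so no closure property of `α` is needed.
      rcases max_choice c c' with h1 | h1 <;> rwa [h1]

/-! ### Good sets -/

theorem Good.empty (hS : IsIndexClass α (indexClass α)) : Good α (indexClass α) (∅ : Set Λ) := by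
  have := hS.isSmall_punit
  exact Good.part (Γ := PUnit.{w + 1}) (K := ∅) (L := fun _ => ∅)
    (hS.otype_of_subsingleton _) ⟨fun a => by simp, fun k hk => hk.elim⟩ fun k hk => hk.elim

/-- A sum over a good index set unfolds into nested sums with index types in `S`. Together with
`good_of_isSmall` it gives closure under all sums of length `< α`. -/
theorem Good.sum {S : Set Ordinal.{w}} [IsSmall α Γ] {K : Set Γ} (hK : Good α S K)
    {L : Γ → Set Λ} {U : Set Λ} (h : IsPart K L U) (hL : ∀ k ∈ K, Good α S (L k)) :
    Good α S U := by
  induction hK generalizing U with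
  | singleton k => exact h.eq_of_singleton ▸ hL k rfl
  | part s hp _ ih =>
    exact Good.part s (h.comp hp) fun ε hε => ih ε hε (h.blockUnion_subset (hp.subset hε))
      fun k hk => hL k (hp.subset hε hk)

theorem IsPart.image {Γ Λ Ω : Type w} [LinearOrder Γ] [LinearOrder Λ] [LinearOrder Ω] {K : Set Γ}
    {L : Γ → Set Λ} {U : Set Λ} (h : IsPart K L U) {f : Λ → Ω}
    (hf : StrictMono f) : IsPart K (fun k => f '' L k) (f '' U) where
  mem b := by
    constructor
    · rintro ⟨a, ha, rfl⟩
      obtain ⟨k, hk, hak⟩ := (h.mem a).1 ha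
      exact ⟨k, hk, a, hak, rfl⟩
    · rintro ⟨k, hk, a, ha, rfl⟩
      exact ⟨a, h.subset hk ha, rfl⟩
  lt := by
    rintro k hk l hl hkl _ ⟨a, ha, rfl⟩ _ ⟨b, hb, rfl⟩
    exact hf (h.lt k hk l hl hkl a ha b hb)

theorem Good.image {S : Set Ordinal.{w}} {U : Set Λ} (hU : Good α S U) {f : Λ → Ω}
    (hf : StrictMono f) : Good α S (f '' U) := by
  induction hU with
  | singleton a =>
    rw [Set.image_singleton]
    exact Good.singleton _
  | part s hp _ ih => exact Good.part s (hp.image hf) ih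

theorem otype_lt_of_forall_lt {J K : Set Γ} (hJ : J ⊆ K) {m : Γ} (hm : m ∈ K)
    (h : ∀ a ∈ J, a < m) : otype J < otype K := by
  refine lt_of_le_of_lt ?_ (Ordinal.typein_lt_type ((· < ·) : K → K → Prop) ⟨m, hm⟩)
  change _ ≤ Ordinal.type _
  exact Ordinal.type_le_iff'.2 ⟨RelEmbedding.ofMonotone
    (fun a => ⟨⟨a.1, hJ a.2⟩, h a.1 a.2⟩) fun _ _ h => h⟩

/-- Induction on the order type. A maximum is split off by a two-block partition. Without a maximum,
`K` is cut into bounded blocks, hence blocks of smaller type, along an enumeration by the initial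
ordinal of its cardinality. -/
theorem good_of_isSmall (hα : (Ordinal.omega0.{w} : WithTop Ordinal.{w}) ≤ α) [IsSmall α Γ]
    (K : Set Γ) : Good α (indexClass α) K := by
  have hS := isIndexClass hα
  induction ho : otype K using WellFoundedLT.induction generalizing K with
  | _ o ih =>
    subst ho
    rcases K.eq_empty_or_nonempty with rfl | ⟨k, hk⟩
    · exact Good.empty hS
    by_cases hmax : ∃ m ∈ K, ∀ a ∈ K, a ≤ m
    · obtain ⟨m, hm, hmax⟩ := hmax
      have hlt : ∀ a ∈ K \ {m}, a < m := fun a ha => (hmax a ha.1).lt_of_ne ha.2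
      have hJ := ih _ (otype_lt_of_forall_lt Set.sdiff_subset hm hlt) (K \ {m}) rfl
      rcases (K \ {m}).eq_empty_or_nonempty with hK | ⟨l, hl⟩
      · rw [Set.sdiff_eq_empty] at hK
        rw [Set.Subset.antisymm hK (Set.singleton_subset_iff.2 hm)]
        exact Good.singleton m
      -- The two indices are taken from `Γ` itself, which is known to be small; any `l < m` in `K`
      -- will do.
      · refine Good.part (K := {l, m}) (L := fun k => if k = m then {m} else K \ {m})
          (type_mem_indexClass_of_finite hα ?_) ⟨fun a => ?_, ?_⟩ ?_
        · exact lt_aleph0_of_finite _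
        · have hlm : l ≠ m := hl.2
          by_cases ha : a = m
          · subst ha
            simp [hm]
          · simp [hlm, ha]
        · rintro i (rfl | rfl) j (rfl | rfl) hij a ha b hb
          · exact absurd hij (lt_irrefl _)
          · have hlm : i ≠ j := hl.2
            rw [if_neg hlm] at ha
            rw [if_pos rfl] at hb
            obtain rfl := hb
            exact hlt a ha
          · exact absurd hij (hlt j hl).not_gt
          · exact absurd hij (lt_irrefl _)
        · rintro i -
          split_ifs
          exacts [Good.singleton m, hJ]
    · push Not at hmax
      -- The enumeration need not be monotone. Block `i` consists of the elements bounded by `g i`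
      -- but by no earlier `g j`; some blocks may be empty. The initial ordinal of `#K` is at most
      -- the type of `K`, hence `< α`.
      obtain ⟨g⟩ : Nonempty ((#K).ord.ToType ≃ K) := Cardinal.eq.1 (mk_ord_toType _)
      have hc : (#K).ord ≤ otype K := ord_le_type _
      have hsm : (((#K).ord : Ordinal.{w}) : WithTop Ordinal.{w}) < α :=
        lt_of_le_of_lt (WithTop.coe_le_coe.2 (hc.trans (otype_le_type K))) (IsSmall.lt (Ω := Γ))
      have : IsSmall α (#K).ord.ToType := ⟨by rwa [Ordinal.type_toType]⟩
      refine Good.part (Γ := (#K).ord.ToType) (K := Set.univ)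
        (L := fun i => {a | a ∈ K ∧ a ≤ g i ∧ ∀ j < i, ¬ a ≤ g j}) ⟨#K, hsm, ?_⟩
        ⟨fun a => ⟨fun ha => ?_, ?_⟩, ?_⟩ ?_
      · exact (otype_le_type _).trans (Ordinal.type_toType _).le
      · have hne : {i | a ≤ g i}.Nonempty := ⟨g.symm ⟨a, ha⟩, by simp⟩
        obtain ⟨i, hi, hmin⟩ := WellFounded.has_min wellFounded_lt _ hne
        exact ⟨i, trivial, ha, hi, fun j hj hja => hmin j hja hj⟩
      · rintro ⟨i, -, ha, -⟩
        exact ha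
      · rintro i - j - hij a ⟨-, ha, -⟩ b ⟨-, -, hb⟩
        exact ha.trans_lt (not_le.1 (hb i hij))
      · rintro i -
        obtain ⟨m, hm, hlt⟩ := hmax _ (g i).2
        exact ih _ (otype_lt_of_forall_lt (fun a ha => ha.1) hm fun a ha => ha.2.1.trans_lt hlt) _ rfl

end Index

/-! ### Reindexing of tensor products -/

section Reindex

variable {hα : (Ordinal.omega0.{w} : WithTop Ordinal.{w}) ≤ α}
  {C : Type u} [Category.{v} C] {M : UnbiasedMonoidal hα C}
  {Γ Ω : Type w} [LinearOrder Γ] [WellFoundedLT Γ] [LinearOrder Ω] [WellFoundedLT Ω]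
  [IsSmall α Γ] [IsSmall α Ω]

/-- An order isomorphism onto `J` determines the arity and, by rigidity, is the canonical
enumeration; equality transports can thus be eliminated at once. -/
theorem arity_induction {J : Set Ω} {motive : ∀ b : Arity α, (Pos b ≃o J) → Prop}
    (h : motive (ar J) (en J)) (b : Arity α) (e : Pos b ≃o J) : motive b e := by
  have hb : b = ar J := by
    refine Subtype.ext ?_
    rw [← Ordinal.type_toType b.1]
    exact Ordinal.type_eq.2 ⟨e.toRelIsoLT⟩
  subst hb
  rwa [Subsingleton.elim e (en J)]

theorem sigma_eq_of_orderIso {X : Type*} {J : Set Ω} {b : Arity α} (e : Pos b ≃o J) {x : Pos b → X}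
    {y : Ω → X} (h : ∀ j, x j = y (e j)) :
    (⟨b, x⟩ : Σ b : Arity α, Pos b → X) = ⟨ar J, fun k => y (en (α := α) J k)⟩ := by
  obtain rfl : x = fun j => y (e j) := funext h
  exact arity_induction (motive := fun b e => (⟨b, fun j => y (e j)⟩ : Σ b : Arity α, Pos b → X) =
    ⟨ar J, fun k => y (en (α := α) J k)⟩) rfl b e

theorem T_obj_eq_tens {J : Set Ω} {b : Arity α} (e : Pos b ≃o J) {x : Pos b → C}
    {y : Ω → C} (h : ∀ j, x j = y (e j)) : (M.T b).obj x = tens M J y :=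
  congrArg (fun s : Σ b : Arity α, Pos b → C => (M.T s.1).obj s.2) (sigma_eq_of_orderIso e h)

theorem T_map_tens {J : Set Ω} {b : Arity α} (e : Pos b ≃o J) {x y : Ω → C}
    (f : ∀ a ∈ J, x a ⟶ y a) :
    (M.T b).map (fun j => f (e j) (e j).2) ≫ eqToHom (T_obj_eq_tens e fun _ => rfl) =
      eqToHom (T_obj_eq_tens e fun _ => rfl) ≫ tensMap f := by
  refine arity_induction (motive := fun b e => (M.T b).map (fun j => f (e j) (e j).2) ≫
    eqToHom (T_obj_eq_tens e fun _ => rfl) =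
      eqToHom (T_obj_eq_tens e fun _ => rfl) ≫ tensMap f) ?_ b e
  exact (Category.comp_id _).trans (Category.id_comp _).symm

/-- `η` depends only on the sequence of pairs (arity, family). Packing these as sigma types turns a
change of indexing into an equality of functions that can be substituted. -/
theorem η_transport {γ γ' β β' : Arity α} (eγ : Pos γ ≃o Pos γ') (hβ : β = β')
    {s : Pos γ → Σ b : Arity α, Pos b → C} {s' : Pos γ' → Σ b : Arity α, Pos b → C}
    (hs : ∀ k, s k = s' (eγ k)) (σ : ordSum (fun i => (s i).1.1) = β.1)
    (σ' : ordSum (fun i => (s' i).1.1) = β'.1)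
    (h : (M.T γ).obj (fun i => (M.T (s i).1).obj (s i).2) =
      (M.T γ').obj fun i => (M.T (s' i).1).obj (s' i).2)
    (h' : (M.T β).obj ((Partition.mk (fun i => (s i).1) σ).concat fun i => (s i).2) =
      (M.T β').obj ((Partition.mk (fun i => (s' i).1) σ').concat fun i => (s' i).2)) :
    (M.η ⟨fun i => (s i).1, σ⟩ fun i => (s i).2).hom ≫ eqToHom h' =
      eqToHom h ≫ (M.η ⟨fun i => (s' i).1, σ'⟩ fun i => (s' i).2).hom := by
  obtain rfl : γ = γ' := by
    refine Subtype.ext ?_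
    rw [← Ordinal.type_toType γ.1, ← Ordinal.type_toType γ'.1]
    exact Ordinal.type_eq.2 ⟨eγ.toRelIsoLT⟩
  obtain rfl : eγ = OrderIso.refl _ := Subsingleton.elim _ _
  obtain rfl : s = s' := funext hs
  subst hβ
  simp

/-- The comparison of `η` with `etaT`. -/
theorem η_eq_etaT {γ β : Arity α} (p : Partition γ β) (z : ∀ i, Pos (p.part i) → C) {K : Set Γ}
    {L : Γ → Set Ω} {J : Set Ω} (eγ : Pos γ ≃o K) (eβ : Pos β ≃o J)
    (e : ∀ i, Pos (p.part i) ≃o L (eγ i)) (hL : IsPart K L J) {y : Ω → C}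
    (hz : ∀ i j, z i j = y (e i j)) (hy : ∀ k, p.concat z k = y (eβ k)) :
    (M.η p z).hom ≫ eqToHom (T_obj_eq_tens eβ hy) =
      eqToHom (T_obj_eq_tens eγ (y := fun k => tens M (L k) y) fun i => T_obj_eq_tens (e i) (hz i)) ≫
        (etaT M hL y).hom := by
  have hβ : β = ar J := by
    refine Subtype.ext ?_
    rw [← Ordinal.type_toType β.1]
    exact Ordinal.type_eq.2 ⟨eβ.toRelIsoLT⟩
  have h := η_transport (M := M) (eγ.trans (en (α := α) K).symm) hβ
    (s := fun i => ⟨p.part i, z i⟩)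
    (s' := fun k => ⟨ar (L (en (α := α) K k)), fun j => y (en (α := α) (L (en (α := α) K k)) j)⟩)
    (fun k => by
      refine (sigma_eq_of_orderIso (e k) (hz k)).trans ?_
      exact congrArg (fun a : K => (⟨ar (L a), fun j => y (en (α := α) (L a) j)⟩ :
        Σ b : Arity α, Pos b → C)) ((en (α := α) K).apply_symm_apply (eγ k)).symm)
    p.sum_eq (hL.toPartition (α := α)).sum_eq
    (T_obj_eq_tens eγ (y := fun k => tens M (L k) y) fun i => T_obj_eq_tens (e i) (hz i))
    ((T_obj_eq_tens eβ hy).trans (congrArg (M.T (ar J)).obj (hL.concat_eq (α := α) y)).symm)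
  have h2 : (etaT M hL y).hom = (M.η (hL.toPartition (α := α))
      (fun k j => y (en (α := α) (L (en (α := α) K k)) j))).hom ≫
        eqToHom (congrArg (M.T (ar J)).obj (hL.concat_eq (α := α) y)) :=
    congrArg (_ ≫ ·) (T_map_eqToHom (hL.concat_eq (α := α) y))
  rw [h2]
  refine Eq.trans ?_ ((congrArg (· ≫ eqToHom (congrArg (M.T (ar J)).obj (hL.concat_eq (α := α) y)))
    h).trans (Category.assoc _ _ _))
  refine Eq.trans ?_ (Category.assoc _ _ _).symm
  exact congrArg (_ ≫ ·) (eqToHom_trans _ _).symm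

theorem sing_inv (k : Γ) (x : Γ → C) :
    ∃ h, (sing (M := M) k x).inv = (M.ι (x k)).hom ≫ eqToHom h := by
  have key : ∀ {β : Arity α} (hβ : β = one hα) {y : Pos β → C} {c : C} (hy : ∀ j, y j = c),
      ∃ h, (unitIso (M := M) hβ hy).inv = (M.ι c).hom ≫ eqToHom h := by
    intro β hβ y c hy
    obtain rfl : y = fun _ => c := funext hy
    subst hβ
    refine ⟨rfl, ?_⟩
    simp only [unitIso, Iso.trans_inv, Functor.mapIso_inv, eqToIso.inv, T_map_eqToHom_self,
      Category.comp_id, Iso.symm_inv]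
  exact key _ _

/-- A partition into singletons is an order isomorphism. -/
def IsPart.orderIso {K : Set Γ} {J : Set Ω} {e : Γ → Ω} (h : IsPart K (fun k => {e k}) J) :
    K ≃o J :=
  StrictMono.orderIsoOfSurjective (fun k : K => (⟨e k, h.subset k.2 rfl⟩ : J))
    (fun k l hkl => h.lt k k.2 l l.2 hkl _ rfl _ rfl) (fun a => by
      obtain ⟨k, hk, ha⟩ := (h.mem _).1 a.2
      exact ⟨⟨k, hk⟩, Subtype.ext ha.symm⟩)

/-- The inner unit axiom: the inverse of `sing` is `ι` up to transport, and the partition into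
singletons is `singletons` up to transport. -/
theorem etaT_singletons {K : Set Γ} {J : Set Ω} {e : Γ → Ω} (h : IsPart K (fun k => {e k}) J)
    (x : Ω → C) (eq : tens M K (fun k => x (e k)) = tens M J x) :
    tensMap (fun k _ => (sing (e k) x).inv) ≫ (etaT M h x).hom = eqToHom eq := by
  choose hs hs' using fun k => sing_inv (M := M) (e k) x
  have hs1 : (fun i : Pos (ar (α := α) K) => (M.T (one hα)).obj fun _ => x (e (en (α := α) K i))) =
      fun i => tens M {e (en (α := α) K i)} x := funext fun i => hs (en (α := α) K i)
  have h1 : tensMap (fun k _ => (sing (e k) x).inv) =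
      (M.T (ar K)).map (fun i => (M.ι (x (e (en (α := α) K i)))).hom) ≫
        eqToHom (congrArg (M.T (ar K)).obj hs1) := by
    rw [← T_map_eqToHom hs1]
    refine Eq.trans (congrArg (M.T (ar K)).map (funext fun i => ?_)) ((M.T (ar K)).map_comp _ _)
    rw [Pi.comp_apply, Functor.eqToHom_proj]
    exact hs' _
  have hβ : ar (α := α) K = ar J :=
    Subtype.ext (Ordinal.type_eq.2 ⟨h.orderIso.toRelIsoLT⟩)
  have h2 := η_transport (M := M) (OrderIso.refl (Pos (ar (α := α) K))) hβ
    (s := fun k => ⟨one hα, fun _ => x (e (en (α := α) K k))⟩)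
    (s' := fun k => ⟨ar {e (en (α := α) K k)}, fun j => x (en (α := α) {e (en (α := α) K k)} j)⟩)
    (fun k => sigma_eq_of_orderIso (OrderIso.ofUnique _ _) fun j => rfl)
    (singletons hα (ar K)).sum_eq (h.toPartition (α := α)).sum_eq
    (congrArg (M.T (ar K)).obj hs1)
    ((congrArg (M.T (ar K)).obj (concat_singletons hα (ar K) _)).trans
      (eq.trans (congrArg (M.T (ar J)).obj (h.concat_eq (α := α) x)).symm))
  have h3 := M.unit_inner (ar K) (fun i => x (e (en (α := α) K i)))
  have h4 : (etaT M h x).hom = (M.η (h.toPartition (α := α))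
      (fun k j => x (en (α := α) {e (en (α := α) K k)} j))).hom ≫
        eqToHom (congrArg (M.T (ar J)).obj (h.concat_eq (α := α) x)) :=
    congrArg (_ ≫ ·) (T_map_eqToHom (h.concat_eq (α := α) x))
  rw [T_map_eqToHom] at h3
  rw [h1, h4]
  refine (Category.assoc _ _ _).trans ?_
  refine (congrArg (_ ≫ ·) (((Category.assoc _ _ _).symm.trans
    (congrArg (· ≫ _) h2.symm)).trans (Category.assoc _ _ _))).trans ?_
  refine (congrArg (fun t => _ ≫ _ ≫ t) (eqToHom_trans _ _)).trans ?_
  refine (congrArg (fun t => _ ≫ _ ≫ t) (eqToHom_trans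
    (congrArg (M.T (ar K)).obj (concat_singletons hα (ar K) _)) eq).symm).trans ?_
  exact (congrArg (_ ≫ ·) (Category.assoc _ _ _).symm).trans ((Category.assoc _ _ _).symm.trans
    ((congrArg (· ≫ eqToHom eq) h3).trans (Category.id_comp _)))

/-! ### Values of full valuations on sequences of sets -/

variable {Λ : Type w} [LinearOrder Λ]

/-- Invariance under renaming the index order: coherence for `K'` split into the singletons `{e k}`,
where `m_singleton` and `etaT_singletons` make the extra terms cancel. -/
theorem Val.m_reindex (V : Val M Set.univ Λ) {K : Set Γ} {K' : Set Ω} {e : Γ → Ω}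
    (hK : IsPart K (fun k => {e k}) K') {L : Γ → Set Λ} {L' : Ω → Set Λ}
    (hL : L = fun k => L' (e k)) {J : Set Λ} (h : IsPart K L J) (h' : IsPart K' L' J)
    (eq : tens M K (fun k => V.e (L k)) = tens M K' fun k => V.e (L' k)) :
    (V.m (Set.mem_univ _) h).hom = eqToHom eq ≫ (V.m (Set.mem_univ _) h').hom := by
  subst hL
  have h1 := V.coh (Set.mem_univ _) (fun _ _ => Set.mem_univ _) (Set.mem_univ _) hK
    (fun k _ => isPart_singleton (e k) L') h' h
  have h2 := etaT_singletons (M := M) hK (fun k => V.e (L' k)) eq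
  rw [← h2, Category.assoc, ← h1, tensMap_congr fun k _ => V.m_singleton (e k) _ L',
    ← Category.assoc, tensMap_comp]
  simp [tensMap_id]

theorem T_univ_eq {γ : Arity α} (x : Pos γ → C) : (M.T γ).obj x = tens M Set.univ x :=
  T_obj_eq_tens OrderIso.Set.univ.symm fun _ => rfl

theorem T_univ_map {γ : Arity α} {x y : Pos γ → C} (f : ∀ k, x k ⟶ y k) :
    (M.T γ).map f ≫ eqToHom (T_univ_eq y) =
      eqToHom (T_univ_eq x) ≫ tensMap (J := Set.univ) fun k _ => f k :=
  T_map_tens OrderIso.Set.univ.symm fun k _ => f k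

/-- The comparison isomorphism of a full valuation, for a sequence of blocks. -/
def Val.mT (V : Val M Set.univ Λ) {γ : Arity α} {L : Pos γ → Set Λ} {J : Set Λ}
    (h : IsPart Set.univ L J) : (M.T γ).obj (fun k => V.e (L k)) ≅ V.e J :=
  eqToIso (T_univ_eq _) ≪≫ V.m (Set.mem_univ _) h

theorem HomOn.mT_comm {V V' : Val M Set.univ Λ} (ξ : HomOn V V' Set.univ) {γ : Arity α}
    {L : Pos γ → Set Λ} {J : Set Λ} (h : IsPart Set.univ L J) :
    (M.T γ).map (fun k => ξ.app (L k) (Set.subset_univ _)) ≫ (V'.mT h).hom =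
      (V.mT h).hom ≫ ξ.app J (Set.subset_univ _) := by
  have h1 := ξ.comm (Set.mem_univ _) h (Set.subset_univ _)
  have h2 := T_univ_map (M := M) fun k => ξ.app (L k) (Set.subset_univ _)
  simp only [Val.mT, Iso.trans_hom, eqToIso.hom, Category.assoc]
  rw [h1, ← Category.assoc, h2, Category.assoc]

theorem Val.mT_congr (V : Val M Set.univ Λ) {γ : Arity α} {L L' : Pos γ → Set Λ} {J J' : Set Λ}
    (h : IsPart Set.univ L J) (h' : IsPart Set.univ L' J') (hL : ∀ k, L k = L' k) (hJ : J = J') :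
    (M.T γ).map (fun k => eqToHom (congrArg V.e (hL k))) ≫ (V.mT h').hom =
      (V.mT h).hom ≫ eqToHom (congrArg V.e hJ) := by
  obtain rfl : L = L' := funext hL
  subst hJ
  exact (congrArg (· ≫ _) ((M.T γ).map_id _)).trans
    ((Category.id_comp _).trans (Category.comp_id _).symm)

theorem Val.mT_one (V : Val M Set.univ Λ) {L : Pos (one hα) → Set Λ} {J : Set Λ}
    (h : IsPart Set.univ L J) (hL : ∀ k, L k = J) :
    (M.ι (V.e J)).hom ≫ (M.T (one hα)).map (fun k => eqToHom (congrArg V.e (hL k).symm)) ≫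
      (V.mT h).hom = 𝟙 _ := by
  obtain rfl : L = fun _ => J := funext hL
  have key : ∀ (K : Set (Pos (one hα))) (hK : K = {default}) (h : IsPart K (fun _ => J) J)
      (eq : (M.T (one hα)).obj (fun _ => V.e J) = tens M K fun _ => V.e J),
      (M.ι (V.e J)).hom ≫ eqToHom eq ≫ (V.m (Set.mem_univ _) h).hom = 𝟙 _ := by
    rintro K rfl h eq
    obtain ⟨h', e⟩ := sing_inv (M := M) (default : Pos (one hα)) fun _ => V.e J
    rw [V.m_singleton default _ fun _ => J, ← Category.assoc, ← e, Iso.inv_hom_id]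
  have h1 := key Set.univ (Set.eq_univ_iff_forall.2 fun k => Subsingleton.elim _ _).symm h (T_univ_eq _)
  refine Eq.trans (congrArg (_ ≫ ·) ?_) h1
  exact (congrArg (· ≫ _) ((M.T (one hα)).map_id _)).trans (Category.id_comp _)

/-- Coherence of the valuation in terms of the original `T` and `η`; the rest of the proof
identifies sequences with subsets of their index orders. -/
theorem Val.mT_assoc (V : Val M Set.univ Λ) {γ β : Arity α} (p : Partition γ β)
    {L : ∀ i, Pos (p.part i) → Set Λ} {N : Pos γ → Set Λ} {J : Set Λ}
    (hL : ∀ i, IsPart Set.univ (L i) (N i)) (hN : IsPart Set.univ N J)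
    (hJ : IsPart Set.univ (p.concat L) J) :
    (M.T γ).map (fun i => (V.mT (hL i)).hom) ≫ (V.mT hN).hom =
      (M.η p fun i j => V.e (L i j)).hom ≫ (V.mT hJ).hom := by
  -- `Q i` is the `i`-th block of `p` as a set of positions of `β`; the position `p.pos ⟨i, j⟩`
  -- relabels the index `j`.
  let Q : Pos γ → Set (Pos β) := fun i => {k | (p.pos.symm k).1 = i}
  have hLpos : ∀ i, L i = fun j => p.concat L (p.pos ⟨i, j⟩) := fun i =>
    funext fun j => (p.concat_pos L i j).symm
  have hsymm : ∀ i j, p.pos.symm (p.pos ⟨i, j⟩) = ⟨i, j⟩ := fun i j => RelIso.symm_apply_apply _ _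
  have hpos : ∀ i k, k ∈ Q i → ∃ j, p.pos ⟨i, j⟩ = k := by
    rintro _ k rfl
    exact ⟨(p.pos.symm k).2, RelIso.apply_symm_apply _ _⟩
  have hpart : ∀ i, IsPart Set.univ (fun j => {p.pos ⟨i, j⟩}) (Q i) := by
    refine fun i => ⟨fun k => ⟨fun hk => ?_, ?_⟩, ?_⟩
    · obtain ⟨j, hj⟩ := hpos i k hk
      exact ⟨j, trivial, hj.symm⟩
    · rintro ⟨j, -, rfl⟩
      change (p.pos.symm _).1 = i
      rw [hsymm]
    · rintro j - l - hjl _ rfl _ rfl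
      exact p.pos.map_rel_iff.2 (Sigma.Lex.right _ _ hjl)
  have hQ : IsPart Set.univ Q Set.univ := by
    refine ⟨fun k => ⟨fun _ => ⟨_, trivial, rfl⟩, fun _ => trivial⟩, ?_⟩
    rintro i - j - hij a ha b hb
    obtain ⟨a', rfl⟩ := hpos i a ha
    obtain ⟨b', rfl⟩ := hpos j b hb
    exact p.pos.map_rel_iff.2 (Sigma.Lex.left _ _ hij)
  have hN' : ∀ i, IsPart (Q i) (p.concat L) (N i) := by
    refine fun i => ⟨fun a => ((hL i).mem a).trans ⟨?_, ?_⟩, ?_⟩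
    · rintro ⟨j, -, ha⟩
      rw [hLpos] at ha
      exact ⟨p.pos ⟨i, j⟩, ((hpart i).mem _).2 ⟨j, trivial, rfl⟩, ha⟩
    · rintro ⟨k, hk, ha⟩
      obtain ⟨j, rfl⟩ := hpos i k hk
      refine ⟨j, trivial, ?_⟩
      rw [hLpos]
      exact ha
    · intro k hk l hl
      exact hJ.lt k trivial l trivial
  have e1 : ∀ i, (fun j => V.e (L i j)) = fun j => (fun k => V.e (p.concat L k)) (p.pos ⟨i, j⟩) :=
    fun i => funext fun j => congrArg V.e (p.concat_pos L i j).symm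
  have e2 : ∀ i j, V.e (L i j) = V.e (p.concat L (((hpart i).orderIso
    (OrderIso.Set.univ.symm j : (Set.univ : Set (Pos (p.part i)))) : Q i))) := fun i j =>
    congrArg V.e (p.concat_pos L i j).symm
  have h1 := V.coh (Set.mem_univ _) (fun _ _ => Set.mem_univ _) (Set.mem_univ _) hQ
    (fun i _ => hN' i) hJ hN
  have h2 := η_eq_etaT (M := M) p (fun i j => V.e (L i j)) OrderIso.Set.univ.symm
    OrderIso.Set.univ.symm (fun i => OrderIso.Set.univ.symm.trans (hpart i).orderIso) hQ
    (y := fun k => V.e (p.concat L k)) e2 (fun k => rfl)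
  have e3 : ∀ i, (M.T (p.part i)).obj (fun j => V.e (L i j)) =
      tens M (Q i) fun k => V.e (p.concat L k) := fun i =>
    T_obj_eq_tens (OrderIso.Set.univ.symm.trans (hpart i).orderIso)
      (y := fun k => V.e (p.concat L k)) (e2 i)
  have h3 : ∀ i, (V.mT (hL i)).hom = eqToHom (e3 i) ≫ (V.m (Set.mem_univ _) (hN' i)).hom := by
    intro i
    have := V.m_reindex (hpart i) (hLpos i) (hL i) (hN' i) ((T_univ_eq _).symm.trans (e3 i))
    simp only [Val.mT, Iso.trans_hom, eqToIso.hom]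
    rw [this, ← Category.assoc, eqToHom_trans]
  have h4 : (M.T γ).map (fun i => (V.mT (hL i)).hom) =
      eqToHom (congrArg (M.T γ).obj (funext e3)) ≫
        (M.T γ).map fun i => (V.m (Set.mem_univ _) (hN' i)).hom := by
    rw [← T_map_eqToHom (funext e3)]
    refine Eq.trans (congrArg (M.T γ).map (funext fun i => ?_)) ((M.T γ).map_comp _ _)
    rw [Pi.comp_apply, Functor.eqToHom_proj]
    exact h3 i
  have h5 := T_univ_map (M := M) fun i => (V.m (Set.mem_univ _) (hN' i)).hom
  rw [h4]
  refine (Category.assoc _ _ _).trans ?_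
  refine (congrArg (_ ≫ ·) (Category.assoc _ _ _).symm).trans ?_
  refine (congrArg (fun t => _ ≫ t ≫ _) h5).trans ?_
  refine (congrArg (_ ≫ ·) ((Category.assoc _ _ _).trans (congrArg (_ ≫ ·) h1))).trans ?_
  refine Eq.trans ?_ ((congrArg (· ≫ (V.m (Set.mem_univ _) hJ).hom) h2).symm.trans
    (Category.assoc _ _ _))
  refine Eq.trans ?_ (Category.assoc _ _ _).symm
  refine (Category.assoc _ _ _).symm.trans ?_
  exact congrArg (· ≫ _) (eqToHom_trans _ _)

end Reindex

/-! ### Words -/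

section Full

variable {hα : (Ordinal.omega0.{w} : WithTop Ordinal.{w}) ≤ α}
  {C : Type u} [Category.{v} C] {M : UnbiasedMonoidal hα C} {Λ : Type w} [LinearOrder Λ]

theorem Good.toUniv {S : Set Ordinal.{w}} {J : Set Λ} (hJ : Good α S J) :
    Good α Set.univ J := by
  induction hJ with
  | singleton a => exact Good.singleton a
  | part s h _ ih => exact Good.part (Set.mem_univ _) h ih

/-- Gluing works only within the index class; the morphism obtained there is then automatically
compatible with all small partitions. -/
theorem Good.exists_full_hom {U : Set Λ} (hU : Good α (indexClass α) U)
    (V V' : Val M Set.univ Λ) (φ : ∀ a ∈ U, V.e {a} ⟶ V'.e {a}) :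
    ∃ ξ : HomOn V V' U, ∀ a (ha : a ∈ U),
      ξ.app {a} (Set.singleton_subset_iff.2 ha) = φ a ha := by
  obtain ⟨ξ, hξ⟩ := hU.exists_hom (isIndexClass hα) (V.restrict (Set.subset_univ _))
    (V'.restrict (Set.subset_univ _)) φ
  exact ⟨ξ.extend (isIndexClass hα) fun K => good_of_isSmall hα K, hξ⟩

theorem Good.exists_full_val {U : Set Λ} (hU : Good α (indexClass α) U) (x : Λ → C) :
    ∃ V : Val M Set.univ Λ, ∀ a ∈ U, Nonempty (V.e {a} ≅ x a) := by
  obtain ⟨V, hV⟩ := hU.exists_val (M := M) (isIndexClass hα) x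
  exact ⟨V.extend (isIndexClass hα) fun K => good_of_isSmall hα K, hV⟩

theorem HomOn.app_congr {S : Set Ordinal.{w}} {V V' : Val M S Λ} {U : Set Λ} (ξ : HomOn V V' U)
    {J J' : Set Λ} (h : J = J') (hJ : J ⊆ U) :
    ξ.app J hJ = eqToHom (congrArg V.e h) ≫ ξ.app J' (h ▸ hJ) ≫
      eqToHom (congrArg V'.e h.symm) := by
  subst h
  simp

theorem Val.m_eqToHom_congr (V : Val M Set.univ Λ) {Γ : Type w} [LinearOrder Γ]
    [WellFoundedLT Γ] [IsSmall α Γ] {K : Set Γ} {L L' : Γ → Set Λ} {J J' : Set Λ}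
    (s : otype K ∈ Set.univ) (h : IsPart K L J) (h' : IsPart K L' J') (hL : ∀ k, L k = L' k)
    (hJ : J = J') :
    tensMap (fun k _ => eqToHom (congrArg V.e (hL k))) ≫ (V.m s h').hom =
      (V.m s h).hom ≫ eqToHom (congrArg V.e hJ) := by
  obtain rfl : L = L' := funext hL
  subst hJ
  simp [tensMap_id]

theorem comp_eqToHom_eqToHom {X Y Z Z' : C} (f : X ⟶ Y) (g : Y ⟶ Z) (h : Z = Z') :
    (f ≫ g ≫ eqToHom h) ≫ eqToHom h.symm = f ≫ g := by
  subst h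
  simp

end Full

/-- A word in `C`: a family of objects of `C` indexed by a well-order which is generated from
singletons by iterated sums of length `< α`. -/
structure Word (α : WithTop Ordinal.{w}) (C : Type u) where
  /-- the positions of the word -/
  Λ : Type w
  [order : LinearOrder Λ]
  [wf : WellFoundedLT Λ]
  good : Good α (indexClass α) (Set.univ : Set Λ)
  /-- the letters of the word -/
  x : Λ → C

attribute [instance] Word.order Word.wf

/-- A strictly monotone map between words that preserves letters. -/
structure Emb {C : Type u} (u v : Word α C) where
  /-- the underlying map of positions -/
  toFun : u.Λ → v.Λ
  mono : StrictMono toFun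
  x_eq : ∀ a, u.x a = v.x (toFun a)

/-- Composition of embeddings of words. -/
def Emb.comp {C : Type u} {u v w : Word α C} (f : Emb u v) (g : Emb v w) : Emb u w where
  toFun a := g.toFun (f.toFun a)
  mono := g.mono.comp f.mono
  x_eq a := (f.x_eq a).trans (g.x_eq _)

theorem Emb.comp_image {C : Type u} {u v w : Word α C} (f : Emb u v) (g : Emb v w) (J : Set u.Λ) :
    g.toFun '' (f.toFun '' J) = (f.comp g).toFun '' J :=
  Set.image_image g.toFun f.toFun J

/-! ### Values of words and their functoriality in embeddings -/

section Words

variable {hα : (Ordinal.omega0.{w} : WithTop Ordinal.{w}) ≤ α}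
  {C : Type u} [Category.{v} C] (M : UnbiasedMonoidal hα C)

/-- A full valuation on the positions of a word, extending the letters. -/
def Word.val (W : Word α C) : Val M Set.univ W.Λ :=
  (W.good.exists_full_val (M := M) W.x).choose

/-- The value of a letter of a word. -/
def Word.letter (W : Word α C) (a : W.Λ) : (W.val M).e {a} ≅ W.x a :=
  ((W.good.exists_full_val (M := M) W.x).choose_spec a trivial).some

/-- The value of a word. -/
abbrev Word.ev (W : Word α C) : C := (W.val M).e Set.univ

variable {u v w : Word α C}

theorem Emb.exists_hom (f : Emb u v) :
    ∃ ξ : HomOn (u.val M) ((v.val M).comap (f.toFun '' ·) fun h => h.image f.mono) Set.univ,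
      ∀ a, ξ.app {a} (Set.subset_univ _) = (u.letter M a).hom ≫ eqToHom (f.x_eq a) ≫
        (v.letter M (f.toFun a)).inv ≫ eqToHom (congrArg (v.val M).e Set.image_singleton.symm) := by
  obtain ⟨ξ, hξ⟩ := u.good.exists_full_hom (u.val M)
    ((v.val M).comap (f.toFun '' ·) fun h => h.image f.mono) fun a _ =>
      (u.letter M a).hom ≫ eqToHom (f.x_eq a) ≫
        (v.letter M (f.toFun a)).inv ≫ eqToHom (congrArg (v.val M).e Set.image_singleton.symm)
  exact ⟨ξ, fun a => hξ a trivial⟩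

/-- The morphism of valuations induced by an embedding of words. -/
def Emb.hom (f : Emb u v) :
    HomOn (u.val M) ((v.val M).comap (f.toFun '' ·) fun h => h.image f.mono) Set.univ :=
  (f.exists_hom M).choose

theorem Emb.hom_singleton (f : Emb u v) (a : u.Λ) :
    (f.hom M).app {a} (Set.subset_univ _) = (u.letter M a).hom ≫ eqToHom (f.x_eq a) ≫
      (v.letter M (f.toFun a)).inv ≫ eqToHom (congrArg (v.val M).e Set.image_singleton.symm) :=
  (f.exists_hom M).choose_spec a

/-- The component of `Emb.hom` at a set. -/
def Emb.map (f : Emb u v) (J : Set u.Λ) : (u.val M).e J ⟶ (v.val M).e (f.toFun '' J) :=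
  (f.hom M).app J (Set.subset_univ _)

instance Emb.isIso_map (f : Emb u v) : IsIso (f.map M Set.univ) := by
  refine u.good.toUniv.isIso_app subset_rfl (f.hom M) fun a _ => ?_
  have : IsIso ((u.letter M a).hom ≫ eqToHom (f.x_eq a) ≫ (v.letter M (f.toFun a)).inv ≫
      eqToHom (congrArg (v.val M).e (Set.image_singleton (f := f.toFun) (a := a)).symm)) :=
    inferInstance
  rwa [← f.hom_singleton] at this

/-- Identities between induced maps follow by exhibiting a morphism of valuations with the right
components at letters. -/
theorem Emb.map_unique (f : Emb u v)
    (ξ : HomOn (u.val M) ((v.val M).comap (f.toFun '' ·) fun h => h.image f.mono) Set.univ)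
    (h : ∀ a, ξ.app {a} (Set.subset_univ _) = (u.letter M a).hom ≫ eqToHom (f.x_eq a) ≫
      (v.letter M (f.toFun a)).inv ≫ eqToHom (congrArg (v.val M).e Set.image_singleton.symm)) :
    f.map M Set.univ = ξ.app Set.univ subset_rfl :=
  u.good.toUniv.hom_ext subset_rfl _ _ fun a _ => (f.hom_singleton M a).trans (h a).symm

theorem Emb.map_id (f : Emb u u) (hf : ∀ a, f.toFun a = a) :
    f.map M Set.univ = eqToHom (congrArg (u.val M).e (by simp [funext hf])) := by
  obtain ⟨f, h1, h2⟩ := f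
  obtain rfl : f = fun a => a := funext hf
  refine Emb.map_unique M _ ⟨fun J _ => eqToHom (congrArg (u.val M).e (Set.image_id J).symm), ?_⟩ ?_
  · intro Γ _ _ _ K L J s h hJ
    exact ((u.val M).m_eqToHom_congr s h _ (fun k => (Set.image_id (L k)).symm)
      (Set.image_id J).symm).symm
  · intro a
    refine Eq.symm ((congrArg (_ ≫ ·) (Category.id_comp _)).trans ?_)
    exact Iso.hom_inv_id_assoc _ _

/-- The composite is again a morphism of valuations with the prescribed letters. The transport
appears because the image under a composite equals the iterated image only propositionally. -/
theorem Emb.map_comp (f : Emb u v) (g : Emb v w) :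
    f.map M Set.univ ≫ g.map M (f.toFun '' Set.univ) =
      (f.comp g).map M Set.univ ≫ eqToHom (congrArg (w.val M).e (f.comp_image g _).symm) := by
  rw [Emb.map_unique M (f.comp g) ⟨fun J _ => f.map M J ≫ g.map M (f.toFun '' J) ≫
    eqToHom (congrArg (w.val M).e (f.comp_image g J)), ?_⟩ ?_]
  · exact (comp_eqToHom_eqToHom _ _ _).symm
  · intro Γ _ _ _ K L J s h hJ
    have h1 := (f.hom M).comm s h hJ
    have h2 := (g.hom M).comm s (h.image f.mono) (Set.subset_univ _)
    have h3 := (w.val M).m_eqToHom_congr s ((h.image f.mono).image g.mono)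
      (h.image (f.comp g).mono)
      (fun k => f.comp_image g _) (f.comp_image g _)
    calc ((u.val M).m s h).hom ≫ f.map M J ≫ g.map M (f.toFun '' J) ≫
          eqToHom (congrArg (w.val M).e (f.comp_image g J))
        = (((u.val M).m s h).hom ≫ f.map M J) ≫ g.map M (f.toFun '' J) ≫ eqToHom _ :=
          (Category.assoc _ _ _).symm
      _ = (tensMap (fun k _ => f.map M (L k)) ≫ ((v.val M).m s (h.image f.mono)).hom) ≫
          g.map M (f.toFun '' J) ≫ eqToHom _ := congrArg (· ≫ _) h1
      _ = tensMap (fun k _ => f.map M (L k)) ≫ (((v.val M).m s (h.image f.mono)).hom ≫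
          g.map M (f.toFun '' J)) ≫ eqToHom _ := by simp only [Category.assoc]
      _ = tensMap (fun k _ => f.map M (L k)) ≫ (tensMap (fun k _ => g.map M (f.toFun '' L k)) ≫
          ((w.val M).m s ((h.image f.mono).image g.mono)).hom) ≫ eqToHom _ :=
          congrArg (fun t => _ ≫ t ≫ _) h2
      _ = tensMap (fun k _ => f.map M (L k)) ≫ tensMap (fun k _ => g.map M (f.toFun '' L k)) ≫
          tensMap (fun k _ => eqToHom (congrArg (w.val M).e
            (f.comp_image g (L k)))) ≫
          ((w.val M).m s (h.image (f.comp g).mono)).hom := by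
        rw [Category.assoc]
        exact congrArg (fun t => _ ≫ _ ≫ t) h3.symm
      _ = tensMap (fun k _ => f.map M (L k) ≫ g.map M (f.toFun '' L k) ≫
          eqToHom (congrArg (w.val M).e (f.comp_image g (L k)))) ≫
          ((w.val M).m s (h.image (f.comp g).mono)).hom := by
        rw [tensMap_comp_assoc, tensMap_comp_assoc]
        simp only [Category.assoc]
  · intro a
    have h1 := f.hom_singleton M a
    have h2 := g.hom_singleton M (f.toFun a)
    have h3 := (g.hom M).app_congr (Set.image_singleton (f := f.toFun) (a := a)) (Set.subset_univ _)
    rw [h2] at h3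
    refine (congrArg₂ (fun s t => s ≫ t ≫ _) h1 h3).trans ?_
    simp [Val.comap]
    refine congrArg (fun t => _ ≫ _ ≫ t) ?_
    exact (congrArg (_ ≫ ·) (eqToHom_trans _ _)).trans (eqToHom_trans _ _)

end Words

/-! ### Decompositions of words -/

theorem IsPart.concat {γ β : Arity α} (p : Partition γ β) {Λ : Type w} [LinearOrder Λ]
    {L : ∀ i, Pos (p.part i) → Set Λ} {N : Pos γ → Set Λ} {J : Set Λ}
    (hL : ∀ i, IsPart Set.univ (L i) (N i)) (hN : IsPart Set.univ N J) :
    IsPart Set.univ (p.concat L) J where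
  mem a := by
    rw [hN.mem]
    constructor
    · rintro ⟨i, -, ha⟩
      obtain ⟨j, -, ha⟩ := ((hL i).mem a).1 ha
      exact ⟨p.pos ⟨i, j⟩, trivial, by rwa [p.concat_pos]⟩
    · rintro ⟨k, -, ha⟩
      exact ⟨_, trivial, (hL _).subset trivial ha⟩
  lt := by
    intro k _ l _ hkl
    have key : ∀ s t : Σ i, Pos (p.part i), sumRel (fun i => (p.part i).1) s t →
        ∀ a ∈ L s.1 s.2, ∀ b ∈ L t.1 t.2, a < b := by
      intro s t hst a ha b hb
      cases hst with
      | left _ _ hij =>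
        exact hN.lt _ trivial _ trivial hij a ((hL _).subset trivial ha) b
          ((hL _).subset trivial hb)
      | right _ _ hjk => exact (hL _).lt _ trivial _ trivial hjk a ha b hb
    exact key _ _ (p.pos.symm.map_rel_iff.2 hkl)

/-- A decomposition of a word `W` as the concatenation of a sequence of words. -/
structure Decomp {C : Type u} {γ : Arity α} (v : Pos γ → Word α C) (W : Word α C) where
  /-- the embeddings of the blocks -/
  emb : ∀ k, Emb (v k) W
  part : IsPart Set.univ (fun k => (emb k).toFun '' Set.univ) Set.univ

namespace Decomp

variable {C : Type u} {γ β : Arity α}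

/-- Composition of decompositions. -/
def comp {p : Partition γ β} {z : ∀ i, Pos (p.part i) → Word α C} {v : Pos γ → Word α C}
    {W : Word α C} (dz : ∀ i, Decomp (z i) (v i)) (d : Decomp v W) : Decomp (p.concat z) W where
  emb k := ((dz (p.pos.symm k).1).emb (p.pos.symm k).2).comp (d.emb (p.pos.symm k).1)
  part := by
    have h := IsPart.concat p (fun i => (dz i).part.image (d.emb i).mono) d.part
    convert h using 2 with k
    exact (((dz (p.pos.symm k).1).emb (p.pos.symm k).2).comp_image _ _).symm

/-- The decomposition of a word as one block. -/
def single {β : Arity α} [Unique (Pos β)] (W : Word α C) : Decomp (γ := β) (fun _ => W) W where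
  emb _ := ⟨fun a => a, fun _ _ h => h, fun _ => rfl⟩
  part := ⟨fun a => by simp, fun k _ l _ h => absurd h (by
    rw [Subsingleton.elim k l]; exact lt_irrefl _)⟩

variable {v : Pos γ → Word α C} {W W' : Word α C}

theorem exists_emb_eq (d : Decomp v W) (a : W.Λ) : ∃ k b, (d.emb k).toFun b = a := by
  obtain ⟨k, -, b, -, h⟩ := (d.part.mem a).1 trivial
  exact ⟨k, b, h⟩

/-- The order of two points is decided by their block indices, or inside a common block, so it is
the same in any word with the same decomposition. -/
theorem emb_lt (d : Decomp v W) (d' : Decomp v W') {k l : Pos γ} {a : (v k).Λ} {b : (v l).Λ}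
    (h : (d.emb k).toFun a < (d.emb l).toFun b) : (d'.emb k).toFun a < (d'.emb l).toFun b := by
  rcases lt_trichotomy k l with hkl | rfl | hkl
  · exact d'.part.lt k trivial l trivial hkl _ ⟨a, trivial, rfl⟩ _ ⟨b, trivial, rfl⟩
  · exact (d'.emb k).mono ((d.emb k).mono.lt_iff_lt.1 h)
  · exact absurd (d.part.lt l trivial k trivial hkl _ ⟨b, trivial, rfl⟩ _ ⟨a, trivial, rfl⟩) h.not_gt

theorem exists_map (d : Decomp v W) (d' : Decomp v W') :
    ∃ θ : Emb W W', Function.Surjective θ.toFun ∧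
      ∀ k a, θ.toFun ((d.emb k).toFun a) = (d'.emb k).toFun a := by
  choose k b h using d.exists_emb_eq
  -- The chosen block and letter of the point `d.emb l a` might differ from `l` and `a`; a strict
  -- inequality of their images in `W'` would make two equal points of `W` comparable strictly.
  have key : ∀ l a, (d'.emb (k ((d.emb l).toFun a))).toFun (b ((d.emb l).toFun a)) =
      (d'.emb l).toFun a := by
    intro l a
    have h1 := h ((d.emb l).toFun a)
    rcases lt_trichotomy ((d'.emb (k ((d.emb l).toFun a))).toFun (b ((d.emb l).toFun a)))
      ((d'.emb l).toFun a) with h2 | h2 | h2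
    · exact absurd h1 (emb_lt d' d h2).ne
    · exact h2
    · exact absurd h1.symm (emb_lt d' d h2).ne
  refine ⟨⟨fun a => (d'.emb (k a)).toFun (b a), fun a a' haa => emb_lt d d' ?_, fun a => ?_⟩,
    fun a => ?_, key⟩
  · rwa [h, h]
  · rw [← (d'.emb (k a)).x_eq, (d.emb (k a)).x_eq, h]
  · obtain ⟨l, c, rfl⟩ := d'.exists_emb_eq a
    exact ⟨_, key l c⟩

end Decomp

/-! ### Comparison isomorphism of a decomposition -/

section

variable {hα : (Ordinal.omega0.{w} : WithTop Ordinal.{w}) ≤ α}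
  {C : Type u} [Category.{v} C] (M : UnbiasedMonoidal hα C) {γ β : Arity α}

/-- The action of `T γ` on a family of isomorphisms. -/
@[simps]
def UnbiasedMonoidal.mapIso {x y : Pos γ → C} (f : ∀ k, x k ≅ y k) :
    (M.T γ).obj x ≅ (M.T γ).obj y where
  hom := (M.T γ).map fun k => (f k).hom
  inv := (M.T γ).map fun k => (f k).inv
  hom_inv_id := ((M.T γ).map_comp _ _).symm.trans
    ((congrArg (M.T γ).map (funext fun k => (f k).hom_inv_id)).trans ((M.T γ).map_id _))
  inv_hom_id := ((M.T γ).map_comp _ _).symm.trans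
    ((congrArg (M.T γ).map (funext fun k => (f k).inv_hom_id)).trans ((M.T γ).map_id _))

theorem UnbiasedMonoidal.map_comp' {x y z : Pos γ → C} (f : ∀ k, x k ⟶ y k) (g : ∀ k, y k ⟶ z k) :
    (M.T γ).map (fun k => f k ≫ g k) = (M.T γ).map f ≫ (M.T γ).map g :=
  (M.T γ).map_comp f g

variable {W W' : Word α C} {v : Pos γ → Word α C}

/-- The morphism on values induced by a surjective embedding. -/
def Emb.evMap (θ : Emb W W') (hθ : Function.Surjective θ.toFun) : W.ev M ⟶ W'.ev M :=
  θ.map M Set.univ ≫ eqToHom (congrArg (W'.val M).e (by rw [Set.image_univ, hθ.range_eq]))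

/-- The comparison isomorphism of a decomposition. -/
def Decomp.mu (d : Decomp v W) : (M.T γ).obj (fun k => (v k).ev M) ≅ W.ev M :=
  M.mapIso (fun k => asIso ((d.emb k).map M Set.univ)) ≪≫ (W.val M).mT d.part

/-- The morphism of valuations induced by `θ` commutes with the comparison isomorphisms, and
`Emb.map_comp` identifies its composite with each block embedding. -/
theorem Decomp.mu_evMap (d : Decomp v W) (d' : Decomp v W') (θ : Emb W W')
    (hθ : Function.Surjective θ.toFun)
    (h : ∀ k a, θ.toFun ((d.emb k).toFun a) = (d'.emb k).toFun a) :
    (d.mu M).hom ≫ θ.evMap M hθ = (d'.mu M).hom := by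
  have h0 : ∀ k, (d.emb k).comp θ = d'.emb k := by
    intro k
    have : ((d.emb k).comp θ).toFun = (d'.emb k).toFun := funext fun a => h k a
    generalize (d.emb k).comp θ = f at this ⊢
    generalize d'.emb k = g at this ⊢
    cases f; cases g; cases this; rfl
  have hI : ∀ k, (d'.emb k).toFun '' Set.univ = θ.toFun '' ((d.emb k).toFun '' Set.univ) :=
    fun k => by rw [Emb.comp_image, h0]
  have hU : θ.toFun '' Set.univ = Set.univ := by rw [Set.image_univ, hθ.range_eq]
  have h1 := (θ.hom M).mT_comm d.part
  have h2 := (W'.val M).mT_congr (d.part.image θ.mono) d'.part (fun k => (hI k).symm) hU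
  have h3 : ∀ k, (d.emb k).map M Set.univ ≫ θ.map M ((d.emb k).toFun '' Set.univ) ≫
      eqToHom (congrArg (W'.val M).e (hI k).symm) = (d'.emb k).map M Set.univ := by
    intro k
    rw [← Category.assoc, Emb.map_comp, Category.assoc, eqToHom_trans]
    have : ∀ (f g : Emb (v k) W') (hfg : f = g) (h : (W'.val M).e (f.toFun '' Set.univ) =
        (W'.val M).e (g.toFun '' Set.univ)),
        f.map M Set.univ ≫ eqToHom h = g.map M Set.univ := by
      rintro f _ rfl h
      simp
    exact this _ _ (h0 k) _
  have h4 : (M.T γ).map (fun k => (d.emb k).map M Set.univ) ≫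
      (M.T γ).map (fun k => θ.map M ((d.emb k).toFun '' Set.univ)) ≫
      (M.T γ).map (fun k => eqToHom (congrArg (W'.val M).e (hI k).symm)) =
        (M.T γ).map (fun k => (d'.emb k).map M Set.univ) := by
    rw [← M.map_comp', ← M.map_comp']
    exact congrArg (M.T γ).map (funext h3)
  calc ((M.T γ).map (fun k => (d.emb k).map M Set.univ) ≫ ((W.val M).mT d.part).hom) ≫
        θ.map M Set.univ ≫ eqToHom (congrArg (W'.val M).e hU)
      = (M.T γ).map (fun k => (d.emb k).map M Set.univ) ≫ (((W.val M).mT d.part).hom ≫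
        θ.map M Set.univ) ≫ eqToHom (congrArg (W'.val M).e hU) := by simp only [Category.assoc]
    _ = (M.T γ).map (fun k => (d.emb k).map M Set.univ) ≫
        ((M.T γ).map (fun k => θ.map M ((d.emb k).toFun '' Set.univ)) ≫
        ((W'.val M).mT (d.part.image θ.mono)).hom) ≫ eqToHom (congrArg (W'.val M).e hU) :=
      congrArg (fun t => _ ≫ t ≫ _) h1.symm
    _ = (M.T γ).map (fun k => (d.emb k).map M Set.univ) ≫
        (M.T γ).map (fun k => θ.map M ((d.emb k).toFun '' Set.univ)) ≫
        (M.T γ).map (fun k => eqToHom (congrArg (W'.val M).e (hI k).symm)) ≫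
        ((W'.val M).mT d'.part).hom := by
      rw [Category.assoc]
      exact congrArg (fun t => _ ≫ _ ≫ t) h2.symm
    _ = (M.T γ).map (fun k => (d'.emb k).map M Set.univ) ≫ ((W'.val M).mT d'.part).hom := by
      rw [← h4]
      simp only [Category.assoc]

/-- Inside `W` this is `mT_assoc`; naturality of `η` and functoriality of `Emb.map` carry it back to
the values of the small words. -/
theorem Decomp.mu_comp {p : Partition γ β} {z : ∀ i, Pos (p.part i) → Word α C}
    (dz : ∀ i, Decomp (z i) (v i)) (d : Decomp v W) :
    (M.T γ).map (fun i => ((dz i).mu M).hom) ≫ (d.mu M).hom =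
      (M.η p fun i j => (z i j).ev M).hom ≫ ((Decomp.comp dz d).mu M).hom := by
  have hL : ∀ i, IsPart Set.univ (fun j => (d.emb i).toFun '' (((dz i).emb j).toFun '' Set.univ))
      ((d.emb i).toFun '' Set.univ) := fun i => (dz i).part.image (d.emb i).mono
  have h1 : ∀ i, ((dz i).mu M).hom ≫ (d.emb i).map M Set.univ =
      (M.T (p.part i)).map (fun j => ((dz i).emb j).map M Set.univ ≫
        (d.emb i).map M (((dz i).emb j).toFun '' Set.univ)) ≫ ((W.val M).mT (hL i)).hom := by
    intro i
    rw [M.map_comp']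
    refine (Category.assoc _ _ _).trans (Eq.trans ?_ (Category.assoc _ _ _).symm)
    exact congrArg (_ ≫ ·) (((d.emb i).hom M).mT_comm (dz i).part).symm
  have h2 := (W.val M).mT_assoc p hL d.part (IsPart.concat p hL d.part)
  have h3 := M.η_naturality p fun i j => ((dz i).emb j).map M Set.univ ≫
        (d.emb i).map M (((dz i).emb j).toFun '' Set.univ)
  have h4 := (W.val M).mT_congr (Decomp.comp dz d).part (IsPart.concat p hL d.part)
    (fun k => (Emb.comp_image _ _ _).symm) rfl
  have h5 : (M.T γ).map (fun i => ((dz i).mu M).hom) ≫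
      (M.T γ).map (fun i => (d.emb i).map M Set.univ) =
      (M.T γ).map (fun i => (M.T (p.part i)).map (fun j => ((dz i).emb j).map M Set.univ ≫
        (d.emb i).map M (((dz i).emb j).toFun '' Set.univ))) ≫
      (M.T γ).map fun i => ((W.val M).mT (hL i)).hom := by
    rw [← M.map_comp', ← M.map_comp']
    exact congrArg (M.T γ).map (funext h1)
  have h6 : (M.T β).map (p.concatMap fun i j => ((dz i).emb j).map M Set.univ ≫
        (d.emb i).map M (((dz i).emb j).toFun '' Set.univ)) =
      (M.T β).map (fun k => ((Decomp.comp dz d).emb k).map M Set.univ) ≫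
        (M.T β).map (fun k => eqToHom (congrArg (W.val M).e (Emb.comp_image _ _ _).symm)) := by
    rw [← M.map_comp']
    exact congrArg (M.T β).map (funext fun k => Emb.map_comp M _ _)
  refine (Category.assoc _ _ _).symm.trans ((congrArg (· ≫ _) h5).trans ?_)
  refine (Category.assoc _ _ _).trans ((congrArg (_ ≫ ·) h2).trans ?_)
  refine (Category.assoc _ _ _).symm.trans ((congrArg (· ≫ _) h3).trans ?_)
  refine (Category.assoc _ _ _).trans (congrArg (_ ≫ ·) ?_)
  refine (congrArg (· ≫ _) h6).trans ((Category.assoc _ _ _).trans (congrArg (_ ≫ ·) ?_))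
  exact h4.trans (Category.comp_id _)

theorem Decomp.mu_single (W : Word α C) :
    (M.ι (W.ev M)).hom ≫ ((Decomp.single (β := one hα) W).mu M).hom = 𝟙 _ := by
  have h1 := (W.val M).mT_one (Decomp.single (β := one hα) W).part fun k => Set.image_id _
  refine Eq.trans (congrArg (fun t => _ ≫ t ≫ _) ?_) h1
  refine congrArg (M.T (one hα)).map (funext fun k => ?_)
  exact Emb.map_id M _ fun a => rfl

end

/-! ### The strict algebra of words -/

instance wellFoundedLT_sigma {I : Type w} [LinearOrder I] [WellFoundedLT I] (X : I → Type w)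
    [∀ i, LinearOrder (X i)] [∀ i, WellFoundedLT (X i)] : WellFoundedLT (Σₗ i, X i) where
  wf := by
    have key : ∀ (i : I) (a : X i), Acc (Sigma.Lex (· < ·) fun i (a b : X i) => a < b) ⟨i, a⟩ := by
      intro i
      induction i using WellFoundedLT.induction with
      | _ i ih =>
        intro a
        induction a using WellFoundedLT.induction with
        | _ a iha =>
          refine Acc.intro _ ?_
          rintro ⟨j, b⟩ h
          cases h with
          | left _ _ hij => exact ih _ hij b
          | right _ _ hab => exact iha _ hab
    exact ⟨fun x => key x.1 x.2⟩

section

variable (hα : (Ordinal.omega0.{w} : WithTop Ordinal.{w}) ≤ α) {C : Type u} {γ β : Arity α}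

theorem isPart_sigma {I : Type w} [LinearOrder I] (X : I → Type w) [∀ i, LinearOrder (X i)] :
    IsPart Set.univ (fun i => (fun a : X i => (toLex ⟨i, a⟩ : Σₗ i, X i)) '' Set.univ)
      Set.univ where
  mem a := ⟨fun _ => ⟨(ofLex a).1, trivial, (ofLex a).2, trivial, rfl⟩, fun _ => trivial⟩
  lt := by
    rintro i - j - hij _ ⟨a, -, rfl⟩ _ ⟨b, -, rfl⟩
    exact Sigma.Lex.left _ _ hij

/-- The concatenation of a sequence of words. -/
def Word.concat (v : Pos γ → Word α C) : Word α C where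
  Λ := Σₗ k, (v k).Λ
  good := (good_of_isSmall hα (Set.univ : Set (Pos γ))).sum (isPart_sigma fun k => (v k).Λ)
    fun k _ => (v k).good.image fun _ _ h => Sigma.Lex.right _ _ h
  x a := (v (ofLex a).1).x (ofLex a).2

/-- The canonical decomposition of a concatenation. -/
def Decomp.concat (v : Pos γ → Word α C) : Decomp v (Word.concat hα v) where
  emb k := ⟨fun a => toLex ⟨k, a⟩, fun _ _ h => Sigma.Lex.right _ _ h, fun _ => rfl⟩
  part := isPart_sigma fun k => (v k).Λ

/-- Words are equivalent if there is an order isomorphism between them that preserves letters. -/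
instance Word.setoid (α : WithTop Ordinal.{w}) (C : Type u) : Setoid (Word α C) where
  r u v := ∃ f : Emb u v, Function.Surjective f.toFun
  iseqv := {
    refl u := ⟨⟨fun a => a, fun _ _ h => h, fun _ => rfl⟩, fun a => ⟨a, rfl⟩⟩
    symm := by
      rintro u v ⟨f, hf⟩
      let e := f.mono.orderIsoOfSurjective f.toFun hf
      refine ⟨⟨e.symm, e.symm.strictMono, fun a => ?_⟩, e.symm.surjective⟩
      rw [f.x_eq]
      exact congrArg v.x (e.apply_symm_apply a).symm
    trans := fun ⟨f, hf⟩ ⟨g, hg⟩ => ⟨f.comp g, hg.comp hf⟩ }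

variable [Category.{v} C] (M : UnbiasedMonoidal hα C)

/-- A strict algebra of names of objects of `C`. -/
structure StrictCover where
  /-- the type of names -/
  A : Type (max u (w + 1))
  /-- the object with a given name -/
  ev : A → C
  /-- the tensor product of names -/
  τ : ∀ {γ : Arity α}, (Pos γ → A) → A
  /-- the comparison of tensor products -/
  μ : ∀ {γ : Arity α} (a : Pos γ → A), (M.T γ).obj (fun i => ev (a i)) ≅ ev (τ a)
  τ_one : ∀ a : A, τ (fun _ : Pos (one hα) => a) = a
  τ_concat : ∀ {γ β : Arity α} (p : Partition γ β) (z : ∀ i, Pos (p.part i) → A),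
    τ (fun i => τ (z i)) = τ (p.concat z)
  unit : ∀ a : A, (M.ι (ev a)).hom ≫ (μ fun _ => a).hom = eqToHom (congrArg ev (τ_one a).symm)
  assoc : ∀ {γ β : Arity α} (p : Partition γ β) (z : ∀ i, Pos (p.part i) → A),
    (M.T γ).map (fun i => (μ (z i)).hom) ≫ (μ fun i => τ (z i)).hom ≫
      eqToHom (congrArg ev (τ_concat p z)) = (M.η p fun i j => ev (z i j)).hom ≫ (μ (p.concat z)).hom
  exists_iso : ∀ X : C, ∃ a, Nonempty (ev a ≅ X)

variable {hα}

/-- Rigidity: once `a = b` is substituted, `θ` is an automorphism of a well-order and hence the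
identity. Comparison of representatives is therefore mere transport, as strictness requires. -/
theorem Emb.evMap_out {a b : _root_.Quotient (Word.setoid α C)} (h : a = b) (θ : Emb a.out b.out)
    (hθ : Function.Surjective θ.toFun) :
    θ.evMap M hθ = eqToHom (congrArg (fun a : _root_.Quotient (Word.setoid α C) => a.out.ev M) h) := by
  subst h
  have h1 : θ.mono.orderIsoOfSurjective θ.toFun hθ = OrderIso.refl _ := Subsingleton.elim _ _
  have h2 := Emb.map_id M θ fun k => congrArg (fun e : a.out.Λ ≃o a.out.Λ => e k) h1
  rw [Emb.evMap, h2, eqToHom_trans]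

/-- A decomposition of the representative of the class of a concatenation. -/
theorem Decomp.exists_out (v : Pos γ → Word α C) :
    Nonempty (Decomp v (_root_.Quotient.mk (Word.setoid α C) (Word.concat hα v)).out) := by
  obtain ⟨f, hf⟩ := (Word.setoid α C).symm (_root_.Quotient.mk_out (Word.concat hα v))
  refine ⟨⟨fun k => ((Decomp.concat hα v).emb k).comp f, ?_⟩⟩
  have h := (Decomp.concat hα v).part.image f.mono
  rw [Set.image_univ (f := f.toFun), hf.range_eq] at h
  convert h using 2
  exact (Emb.comp_image _ _ _).symm

/-- Words that decompose into the same sequence are isomorphic. All strict laws for names come from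
this. -/
theorem Decomp.out_eq {v : Pos γ → Word α C} {a b : _root_.Quotient (Word.setoid α C)}
    (d : Decomp v a.out) (d' : Decomp v b.out) : a = b := by
  obtain ⟨θ, hθ, -⟩ := d.exists_map d'
  exact _root_.Quotient.out_equiv_out.1 ⟨θ, hθ⟩

theorem Decomp.mu_eqToHom {v : Pos γ → Word α C} {a b : _root_.Quotient (Word.setoid α C)}
    (d : Decomp v a.out) (d' : Decomp v b.out) (h : a = b) :
    (d.mu M).hom ≫ eqToHom (congrArg (fun a : _root_.Quotient (Word.setoid α C) => a.out.ev M) h) =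
      (d'.mu M).hom := by
  obtain ⟨θ, hθ, hd⟩ := d.exists_map d'
  rw [← Emb.evMap_out M h θ hθ, d.mu_evMap M d' θ hθ hd]

/-- The strict algebra of equivalence classes of words. -/
def wordCover : StrictCover hα M :=
  have dec (γ : Arity α) (a : Pos γ → _root_.Quotient (Word.setoid α C)) :
      Decomp (fun i => (a i).out)
        (_root_.Quotient.mk (Word.setoid α C) (Word.concat hα fun i => (a i).out)).out :=
    (Decomp.exists_out _).some
  { A := _root_.Quotient (Word.setoid α C)
    ev a := a.out.ev M
    τ a := _root_.Quotient.mk _ (Word.concat hα fun i => (a i).out)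
    μ a := (dec _ a).mu M
    -- In each strict law the representatives of both sides decompose into the same sequence of
    -- words; the matching coherence law is `mu_eqToHom` for these two decompositions.
    τ_one a := Decomp.out_eq (dec _ _) (Decomp.single a.out)
    τ_concat p z := Decomp.out_eq (Decomp.comp (fun i => dec _ (z i)) (dec _ _)) (dec _ _)
    unit a := by
      rw [← Decomp.mu_eqToHom M (Decomp.single a.out) (dec _ fun _ => a)
        (Decomp.out_eq (Decomp.single a.out) (dec _ _)), ← Category.assoc, Decomp.mu_single,
        Category.id_comp]
    assoc p z := by
      rw [← Category.assoc, Decomp.mu_comp, Category.assoc,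
        Decomp.mu_eqToHom M _ (dec _ (p.concat z))
          (Decomp.out_eq (Decomp.comp (fun i => dec _ (z i)) (dec _ _)) (dec _ _))]
    exists_iso X := by
      -- The one-letter word `X`; the representative of its class is only isomorphic to it, hence
      -- the detour through `evMap`.
      let W : Word α C := ⟨PUnit.{w + 1}, by
        rw [← Set.eq_univ_of_forall (s := {PUnit.unit}) fun a => rfl]
        exact Good.singleton _, fun _ => X⟩
      obtain ⟨f, hf⟩ : (Word.setoid α C).r _ W := _root_.Quotient.mk_out W
      have : IsIso (f.evMap M hf) := by
        unfold Emb.evMap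
        infer_instance
      exact ⟨_root_.Quotient.mk _ W, ⟨asIso (f.evMap M hf) ≪≫
        eqToIso (congrArg (W.val M).e (Set.eq_univ_of_forall (s := {PUnit.unit}) fun a => rfl).symm) ≪≫
        W.letter M PUnit.unit⟩⟩ }

end

/-! ### Strictification -/

namespace StrictCover

variable {hα : (Ordinal.omega0.{w} : WithTop Ordinal.{w}) ≤ α} {C : Type u} [Category.{v} C]
  {M : UnbiasedMonoidal hα C} (S : StrictCover hα M)

/-- The objects of the strictification. -/
abbrev Obj : Type (max u (w + 1)) := InducedCategory C S.ev

@[simp]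
theorem eqToHom_hom {a b : S.Obj} (h : a = b) :
    (eqToHom h : a ⟶ b).hom = eqToHom (congrArg S.ev h) :=
  eqToHom_map (inducedFunctor S.ev) h

theorem map_eqToHom_comp {D : Type*} [Category* D] {I J : Type*} {E : Type*} [Category* E]
    (F : (I → E) ⥤ D) (G : (J → E) ⥤ D) {x y : I → E} {a b : J → E} (h : ∀ i, x i = y i)
    (h' : F.obj y = G.obj a) (hab : a = b) :
    F.map (fun i => eqToHom (h i)) ≫ eqToHom h' ≫ G.map (eqToHom hab) =
      eqToHom ((congrArg F.obj (funext h)).trans (h'.trans (congrArg G.obj hab))) := by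
  obtain rfl : x = y := funext h
  subst hab
  refine (congrArg (· ≫ _) (F.map_id _)).trans ?_
  simp

theorem eqToHom_comp_map {D : Type*} [Category* D] {E : Type*} [Category* E] (G : E ⥤ D) {x y : D}
    {a b : E} (h : x = y) (h' : y = G.obj a) (hab : a = b) :
    eqToHom h ≫ eqToHom h' ≫ G.map (eqToHom hab) =
      eqToHom (h.trans (h'.trans (congrArg G.obj hab))) := by
  subst hab
  simp

/-- The tensor products of the strictification. -/
abbrev T (β : Arity α) : (Pos β → S.Obj) ⥤ S.Obj where
  obj a := S.τ a
  map {a b} f := InducedCategory.homMk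
    ((S.μ a).inv ≫ (M.T β).map (fun i => (f i).hom) ≫ (S.μ b).hom)
  map_id a := by
    ext
    refine (congrArg (fun t => (S.μ a).inv ≫ t ≫ (S.μ a).hom) ((M.T β).map_id _)).trans ?_
    simp
  map_comp {a b c} f g := by
    ext
    refine (congrArg (fun t => (S.μ a).inv ≫ t ≫ (S.μ c).hom)
      (M.map_comp' (fun i => (f i).hom) fun i => (g i).hom)).trans ?_
    simp

theorem T_one (a : S.Obj) : a = (S.T (one hα)).obj fun _ => a :=
  (S.τ_one a).symm

theorem T_concat {γ β : Arity α} (p : Partition γ β) (z : ∀ i, Pos (p.part i) → S.Obj) :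
    ((S.T γ).obj fun i => (S.T (p.part i)).obj (z i)) = (S.T β).obj (p.concat z) :=
  S.τ_concat p z

theorem μ_T_map_hom {β : Arity α} {a b : Pos β → S.Obj} (f : ∀ i, a i ⟶ b i) :
    (S.μ a).hom ≫ ((S.T β).map f).hom = (M.T β).map (fun i => (f i).hom) ≫ (S.μ b).hom :=
  Iso.hom_inv_id_assoc _ _

theorem T_one_hom (a : S.Obj) :
    (eqToHom (S.T_one a)).hom = (M.ι (S.ev a)).hom ≫ (S.μ fun _ => a).hom :=
  (S.eqToHom_hom _).trans (S.unit a).symm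

theorem T_concat_hom {γ β : Arity α} (p : Partition γ β) (z : ∀ i, Pos (p.part i) → S.Obj) :
    (M.T γ).map (fun i => (S.μ (z i)).hom) ≫ (S.μ fun i => S.τ (z i)).hom ≫
      (eqToHom (S.T_concat p z)).hom =
        (M.η p fun i j => S.ev (z i j)).hom ≫ (S.μ (p.concat z)).hom :=
  (congrArg (fun t => _ ≫ _ ≫ t) (S.eqToHom_hom _)).trans (S.assoc p z)

/-- The associativity law of `μ` solved for the inverses, since `μ` enters `toStrict` inverted. -/
theorem T_concat_hom_inv {γ β : Arity α} (p : Partition γ β) (z : ∀ i, Pos (p.part i) → S.Obj) :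
    (S.μ fun i => S.τ (z i)).inv ≫ (M.T γ).map (fun i => (S.μ (z i)).inv) ≫
        (M.η p fun i j => S.ev (z i j)).hom =
      (eqToHom (S.T_concat p z)).hom ≫ (S.μ (p.concat z)).inv := by
  refine (Iso.inv_comp_eq _).2 ((Iso.inv_comp_eq (M.mapIso fun i => S.μ (z i))).2
    ((cancel_mono (S.μ (p.concat z)).hom).1 ((S.T_concat_hom p z).symm.trans ?_)))
  simp

/-- The strictification. -/
abbrev strict : UnbiasedMonoidal hα S.Obj where
  T := S.T
  ι a := eqToIso (S.T_one a)
  ι_naturality {a b} f := by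
    ext
    refine (congrArg (f.hom ≫ ·) (S.T_one_hom b)).trans ?_
    refine Eq.trans ?_ (congrArg (· ≫ ((S.T (one hα)).map fun _ => f).hom) (S.T_one_hom a)).symm
    refine (Category.assoc _ _ _).symm.trans ((congrArg (· ≫ _) (M.ι_naturality f.hom)).trans ?_)
    exact (Category.assoc _ _ _).trans ((congrArg (_ ≫ ·) (S.μ_T_map_hom fun _ => f).symm).trans
      (Category.assoc _ _ _).symm)
  η p z := eqToIso (S.T_concat p z)
  η_naturality {γ β} p {z z'} f := by
    ext
    have : Epi ((M.T γ).map fun i => (S.μ (z i)).hom) :=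
      inferInstanceAs (Epi (M.mapIso fun i => S.μ (z i)).hom)
    -- Precomposing with the two layers of `μ` turns the square in the strict category into
    -- naturality of `M.η`.
    refine (cancel_epi (S.μ fun i => S.τ (z i)).hom).1
      ((cancel_epi ((M.T γ).map fun i => (S.μ (z i)).hom)).1 ?_)
    have h1 := S.μ_T_map_hom fun i => (S.T (p.part i)).map (f i)
    have h2 : ((M.T γ).map fun i => (S.μ (z i)).hom) ≫
        (M.T γ).map (fun i => ((S.T (p.part i)).map (f i)).hom) =
        ((M.T γ).map fun i => (M.T (p.part i)).map fun j => (f i j).hom) ≫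
          (M.T γ).map fun i => (S.μ (z' i)).hom := by
      refine (M.map_comp' _ _).symm.trans (Eq.trans ?_ (M.map_comp' _ _))
      exact congrArg (M.T γ).map (funext fun i => S.μ_T_map_hom (f i))
    have h3 := M.η_naturality p fun i j => (f i j).hom
    calc ((M.T γ).map fun i => (S.μ (z i)).hom) ≫ (S.μ fun i => S.τ (z i)).hom ≫
          ((S.T γ).map fun i => (S.T (p.part i)).map (f i)).hom ≫ (eqToHom (S.T_concat p z')).hom
        = (((M.T γ).map fun i => (S.μ (z i)).hom) ≫
          (M.T γ).map (fun i => ((S.T (p.part i)).map (f i)).hom)) ≫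
          (S.μ fun i => S.τ (z' i)).hom ≫ (eqToHom (S.T_concat p z')).hom := by
          rw [Category.assoc]
          refine congrArg (_ ≫ ·) ((Category.assoc _ _ _).symm.trans ?_)
          exact (congrArg (· ≫ _) h1).trans (Category.assoc _ _ _)
      _ = ((M.T γ).map fun i => (M.T (p.part i)).map fun j => (f i j).hom) ≫
          (M.η p fun i j => S.ev (z' i j)).hom ≫ (S.μ (p.concat z')).hom := by
          rw [h2, Category.assoc, S.T_concat_hom]
      _ = (M.η p fun i j => S.ev (z i j)).hom ≫ (S.μ (p.concat z)).hom ≫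
          ((S.T β).map (p.concatMap f)).hom := by
          rw [S.μ_T_map_hom, ← Category.assoc, ← Category.assoc]
          exact congrArg (· ≫ _) h3
      _ = ((M.T γ).map fun i => (S.μ (z i)).hom) ≫ (S.μ fun i => S.τ (z i)).hom ≫
          (eqToHom (S.T_concat p z)).hom ≫ ((S.T β).map (p.concatMap f)).hom := by
          rw [← Category.assoc, ← S.T_concat_hom]
          simp only [Category.assoc]
  -- All structure isomorphisms are transports, and tensor products of transports are transports;
  -- parallel ones coincide, so coherence and unit laws are automatic.
  coherence d p q z :=
    (map_eqToHom_comp (S.T _) (S.T _) (fun i => S.T_concat (q i) (z i)) (S.T_concat p _)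
      (Partition.concat_concat d p q z)).trans (eqToHom_trans (S.T_concat d _)
        (S.T_concat (Partition.induced d p q) (Partition.regroup d p q z))).symm
  unit_inner β x := map_eqToHom_comp (S.T _) (S.T _) (fun i => S.T_one (x i))
    (S.T_concat (singletons hα β) _) (concat_singletons hα β x)
  unit_outer β x := eqToHom_comp_map (S.T _) (S.T_one _) (S.T_concat (whole hα β) _)
    (concat_whole hα β x)

theorem strict_isStrict : S.strict.IsStrict :=
  ⟨fun a => ⟨S.T_one a, rfl⟩, fun p z => ⟨S.T_concat p z, rfl⟩⟩

/-- The unbiased monoidal functor from the strictification. -/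
def fromStrict : UnbiasedFunctor S.strict M where
  F := inducedFunctor S.ev
  χ β a := S.μ a
  χ_naturality β a b f := (Iso.hom_inv_id_assoc _ _).symm
  pentagon p z := by
    refine Eq.trans ?_ (S.assoc p z)
    exact congrArg (fun t => _ ≫ _ ≫ t) (S.eqToHom_hom (S.τ_concat p z))
  triangle a := (S.unit a).trans (S.eqToHom_hom _).symm

/-- A name of an object. -/
def name (X : C) : S.Obj := (S.exists_iso X).choose

/-- The isomorphism between the value of the name of an object and the object. -/
def nameIso (X : C) : S.ev (S.name X) ≅ X := (S.exists_iso X).choose_spec.some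

/-- The unbiased monoidal functor to the strictification. -/
def toStrict : UnbiasedFunctor M S.strict where
  F := {
    obj := S.name
    map {X Y} f := InducedCategory.homMk ((S.nameIso X).hom ≫ f ≫ (S.nameIso Y).inv) }
  χ β x := InducedCategory.isoMk ((S.μ _).symm ≪≫ M.mapIso (fun i => S.nameIso (x i)) ≪≫
    (S.nameIso ((M.T β).obj x)).symm)
  χ_naturality β x y f := by
    ext
    have h : (M.T β).map (fun i => (S.nameIso (x i)).hom ≫ f i ≫ (S.nameIso (y i)).inv) ≫
        (M.T β).map (fun i => (S.nameIso (y i)).hom) =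
        (M.T β).map (fun i => (S.nameIso (x i)).hom) ≫ (M.T β).map f := by
      rw [← M.map_comp', ← M.map_comp']
      simp
    change ((S.μ _).inv ≫ (M.T β).map (fun i => (S.nameIso (x i)).hom ≫ f i ≫
        (S.nameIso (y i)).inv) ≫ (S.μ _).hom) ≫ (S.μ _).inv ≫
        (M.T β).map (fun i => (S.nameIso (y i)).hom) ≫ (S.nameIso ((M.T β).obj y)).inv =
      ((S.μ _).inv ≫ (M.T β).map (fun i => (S.nameIso (x i)).hom) ≫
        (S.nameIso ((M.T β).obj x)).inv) ≫ (S.nameIso ((M.T β).obj x)).hom ≫ (M.T β).map f ≫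
          (S.nameIso ((M.T β).obj y)).inv
    simp only [Category.assoc, Iso.hom_inv_id_assoc, Iso.inv_hom_id_assoc]
    rw [← Category.assoc ((M.T β).map _) ((M.T β).map _), h, Category.assoc]
  pentagon {γ β} p z := by
    ext
    let ε := S.nameIso
    let z' : ∀ i, Pos (p.part i) → S.Obj := fun i j => S.name (z i j)
    let ψ : ∀ i, S.ev (S.τ (z' i)) ⟶ S.ev (S.name ((M.T (p.part i)).obj (z i))) := fun i =>
      (S.μ (z' i)).inv ≫ (M.T (p.part i)).map (fun j => (ε (z i j)).hom) ≫ (ε _).inv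
    have h1 : (M.T γ).map ψ ≫ (M.T γ).map (fun i => (ε ((M.T (p.part i)).obj (z i))).hom) =
        (M.T γ).map (fun i => (S.μ (z' i)).inv) ≫
          (M.T γ).map fun i => (M.T (p.part i)).map fun j => (ε (z i j)).hom := by
      rw [← M.map_comp', ← M.map_comp']
      simp [ψ]
    have h2 := M.η_naturality p fun i j => (ε (z i j)).hom
    have h3 := S.T_concat_hom_inv p z'
    calc ((S.μ fun i => S.τ (z' i)).inv ≫ (M.T γ).map ψ ≫ (S.μ _).hom) ≫
          ((S.μ fun i => S.name ((M.T (p.part i)).obj (z i))).inv ≫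
            (M.T γ).map (fun i => (ε ((M.T (p.part i)).obj (z i))).hom) ≫ (ε _).inv) ≫
            (ε _).hom ≫ (M.η p z).hom ≫ (ε _).inv
        = (S.μ fun i => S.τ (z' i)).inv ≫ ((M.T γ).map ψ ≫
            (M.T γ).map (fun i => (ε ((M.T (p.part i)).obj (z i))).hom)) ≫
            (M.η p z).hom ≫ (ε _).inv := by simp
      _ = ((S.μ fun i => S.τ (z' i)).inv ≫ (M.T γ).map (fun i => (S.μ (z' i)).inv)) ≫
          (((M.T γ).map fun i => (M.T (p.part i)).map fun j => (ε (z i j)).hom) ≫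
            (M.η p z).hom) ≫ (ε _).inv := by
          rw [h1]
          simp only [Category.assoc]
      _ = ((S.μ fun i => S.τ (z' i)).inv ≫ (M.T γ).map (fun i => (S.μ (z' i)).inv) ≫
          (M.η p fun i j => S.ev (z' i j)).hom) ≫
          (M.T β).map (p.concatMap fun i j => (ε (z i j)).hom) ≫ (ε _).inv := by
          rw [h2]
          simp only [Category.assoc]
          rfl
      _ = (eqToHom (S.T_concat p z')).hom ≫ (S.μ (p.concat z')).inv ≫
          (M.T β).map (p.concatMap fun i j => (ε (z i j)).hom) ≫ (ε _).inv := by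
          rw [h3, Category.assoc]
  triangle X := by
    ext
    calc (eqToHom (S.T_one (S.name X))).hom ≫ (S.μ fun _ => S.name X).inv ≫
          (M.T (one hα)).map (fun _ => (S.nameIso X).hom) ≫ (S.nameIso _).inv
        = ((M.ι (S.ev (S.name X))).hom ≫ (S.μ fun _ => S.name X).hom) ≫
          (S.μ fun _ => S.name X).inv ≫ (M.T (one hα)).map (fun _ => (S.nameIso X).hom) ≫
          (S.nameIso _).inv := congrArg (· ≫ _) (S.T_one_hom (S.name X))
      _ = ((M.ι (S.ev (S.name X))).hom ≫ (M.T (one hα)).map (fun _ => (S.nameIso X).hom)) ≫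
          (S.nameIso _).inv := by simp
      _ = (S.nameIso X).hom ≫ (M.ι X).hom ≫ (S.nameIso _).inv := by
          rw [← M.ι_naturality, Category.assoc]

theorem toStrict_isWeakEquivalence : S.toStrict.IsWeakEquivalence := by
  refine ⟨⟨fun {X Y} f => ?_⟩, ⟨fun {X Y} f g h => ?_⟩, ⟨fun a => ?_⟩⟩
  · refine ⟨(S.nameIso X).inv ≫ f.hom ≫ (S.nameIso Y).hom, ?_⟩
    ext
    simp [toStrict]
  · have h' := congrArg InducedCategory.Hom.hom h
    simpa [toStrict] using h'
  · exact ⟨S.ev a, ⟨InducedCategory.isoMk (S.nameIso (S.ev a))⟩⟩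

/-- The inverse is the value functor with `μ` as structure isomorphism. The chosen isomorphisms
`nameIso` give both natural isomorphisms, and they are monoidal because `toStrict` is defined by
conjugation with them. -/
theorem toStrict_isStrongEquivalence : S.toStrict.IsStrongEquivalence := by
  refine ⟨S.fromStrict, ⟨⟨NatIso.ofComponents S.nameIso fun {X Y} f => ?_, fun β x => ?_⟩⟩,
    ⟨⟨NatIso.ofComponents (fun a => InducedCategory.isoMk (S.nameIso (S.ev a))) fun {a b} f => ?_,
      fun β a => ?_⟩⟩⟩
  · change ((S.nameIso X).hom ≫ f ≫ (S.nameIso Y).inv) ≫ (S.nameIso Y).hom =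
      (S.nameIso X).hom ≫ f
    simp
  · change ((S.μ _).hom ≫ (S.μ _).inv ≫ (M.T β).map (fun i => (S.nameIso (x i)).hom) ≫
      (S.nameIso ((M.T β).obj x)).inv) ≫ (S.nameIso ((M.T β).obj x)).hom =
        (M.T β).map (fun i => (S.nameIso (x i)).hom) ≫ 𝟙 _
    simp
  · ext
    change ((S.nameIso (S.ev a)).hom ≫ f.hom ≫ (S.nameIso (S.ev b)).inv) ≫
      (S.nameIso (S.ev b)).hom = (S.nameIso (S.ev a)).hom ≫ f.hom
    simp
  · ext
    change (((S.μ _).inv ≫ (M.T β).map (fun i => (S.nameIso (S.ev (a i))).hom) ≫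
      (S.nameIso ((M.T β).obj fun i => S.ev (a i))).inv) ≫ (S.nameIso _).hom ≫ (S.μ a).hom ≫
        (S.nameIso (S.ev (S.τ a))).inv) ≫ (S.nameIso (S.ev (S.τ a))).hom =
      ((S.μ _).inv ≫ (M.T β).map (fun i => (S.nameIso (S.ev (a i))).hom) ≫ (S.μ a).hom) ≫ 𝟙 _
    simp

end StrictCover

end Unbiased

end

/-- Words range over well-orders in universe `w`, whence the universe `max u (w + 1)` of the new
objects; the morphisms are those of `C`. -/
theorem mainTheorem1 (α : WithTop Ordinal.{w})
    (hα : (Ordinal.omega0.{w} : WithTop Ordinal.{w}) ≤ α)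
    (C : Type u) [Category.{v} C] (M : Unbiased.UnbiasedMonoidal hα C) :
    ∃ (D : Type (max u (w + 1))) (_ : Category.{v} D) (N : Unbiased.UnbiasedMonoidal hα D),
      N.IsStrict ∧ ∃ F : Unbiased.UnbiasedFunctor M N,
        F.IsWeakEquivalence ∧ F.IsStrongEquivalence :=
  have S := Unbiased.wordCover M
  ⟨S.Obj, inferInstance, S.strict, S.strict_isStrict, S.toStrict, S.toStrict_isWeakEquivalence,
    S.toStrict_isStrongEquivalence⟩
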